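/- Let $e^1,\dots,e^5$ be the standard basis of $\mathbb{R}^5$, write $e^{ij\dots}=e^i\wedge e^j\wedge\cdots$, and let $$\mathcal{D}=\{d\in\mathrm{Hom}(\mathbb{R}^5,\Lambda^2\mathbb{R}^5)\mid \hat d\circ d=0\},$$ where $\hat d$ is the (graded) derivation of $\Lambda\mathbb{R}^5$ induced by $d$. A point $d\in\mathcal{D}$ is written as the $5$-tuple $(de^1,\dots,de^5)$, with $0$, $12$, $13+24$, … standing for $0$, $e^{12}$, $e^{13}+e^{24}$, …; it defines a Lie algebra structure on the dual space of $\mathbb{R}^5$ with Chevalley–Eilenberg differential $d$ on one-forms, and $d$ is called nilpotent if this Lie algebra is nilpotent. The group $\mathrm{GL}(5,\mathbb{R})$ acts on $\mathcal{D}$ by $d\mapsto g^{-1}\circ d\circ g$, and $\mathrm{U}(2)\subset\mathrm{GL}(5,\mathbb{R})$ is the subgroup acting on $\mathbb{R}^5=\mathbb{C}^2\oplus\mathbb{R}$ in the standard way, with complex coordinates $e^1+ie^2$, $e^3+ie^4$ on $\mathbb{C}^2$. An element $d$ of $\mathcal{D}$ is *hypo* if $$\hat d(e^{12}+e^{34})=0,\qquad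 \hat d(e^{135}+e^{425})=0,\qquad \hat d(e^{145}+e^{235})=0.$$ A $5$-dimensional real Lie algebra *admits a hypo structure* if it is isomorphic to the Lie algebra defined by some hypo $d\in\mathcal{D}$. For $d\in\mathcal{D}$ let $H_d\subset\mathcal{D}/\mathrm{U}(2)$ be the image of the set of hypo elements in the $\mathrm{GL}(5,\mathbb{R})$-orbit of $d$. Consider the families $$\mathcal{M}_1=\{(\lambda e^{35},\,he^{35}+ke^{15},\,0,\,(-\lambda e^2+he^1+\mu e^3)\wedge e^5,\,0)\mid \lambda,\mu,h,k\in\mathbb{R}\},$$ $$\begin{aligned}\mathcal{M}_2=\Bigl\{\bigl(0,\;&xe^{34}+\lambda e^{35},\;0,\;x(e^{14}-e^{23})-ye^{34}+\lambda e^{15}-\mu e^{35},\\ &-h(e^{14}-e^{23})+ke^{34}-xe^{15}+ye^{35}\bigr)\;\Big|\;\operatorname{rk}\begin{pmatrix}x&y&\lambda&\mu\\h&k&x&y\end{pmatrix}<2\Bigr\},\end{aligned}$$ $$\mathcal{M}_3=\{(0,0,0,0,(\lambda+\mu)e^{12}+(\lambda-\mu)e^{34})\mid\lambda,\mu\in\mathbb{R}\}.$$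 **Theorem.** (1) An element of $\mathcal{D}$ is nilpotent and hypo if and only if its $\mathrm{U}(2)$-orbit intersects $\mathcal{M}_1$, $\mathcal{M}_2$ or $\mathcal{M}_3$. (2) A $5$-dimensional real Lie algebra is nilpotent, non-abelian and admits a hypo structure if and only if it is isomorphic to the Lie algebra defined by exactly one of $$a=(0,0,0,12,13+24),\quad b=(0,0,0,0,12+34),\quad c=(0,0,0,0,12),\quad f=(0,0,12,13,14),\quad g=(0,0,0,12,13).$$ (3) For distinct $d_1,d_2$ in $\{a,b,c,f,g\}$, the closure in $\mathcal{D}$ of the $\mathrm{GL}(5,\mathbb{R})$-orbit of $d_1$ contains $d_2$ if and only if $(d_1,d_2)$ is one of $(a,b),(a,c),(a,g),(b,c),(f,g),(f,c),(g,c)$. (4) For distinct $d_1,d_2$ in $\{a,b,c,f,g\}$, the closure of $H_{d_1}$ in $\mathcal{D}/\mathrm{U}(2)$ (with the quotient topology) contains $H_{d_2}$ if and only if $(d_1,d_2)$ is $(a,c)$ or $(f,g)$. -/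

import Mathlib

/-! Lie algebra structures on `ℝ⁵`, encoded by their differential on one-forms, and hypo structures. -/

noncomputable section

namespace HypoLie

/-! ### Exterior forms on the five-dimensional space -/

/-- The real vector space on which the forms live. -/
abbrev V : Type := EuclideanSpace ℝ (Fin 5)

/-- One-forms; the space `ℝ⁵` with basis `e¹, …, e⁵` of the classical notation. -/
abbrev OneForm : Type := V →L[ℝ] ℝ

/-- `Form k` is `Λᵏ ℝ⁵`. -/
abbrev Form (k : ℕ) : Type := V [⋀^Fin k]→L[ℝ] ℝ

/-- The standard basis of `V`. -/
abbrev basisVec (i : Fin 5) : V := EuclideanSpace.single i (1 : ℝ)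

/-- The standard coframe (dual basis), indexed from `0`. -/
abbrev coframe (i : Fin 5) : OneForm := EuclideanSpace.proj i

abbrev e₁ : OneForm := coframe 0
abbrev e₂ : OneForm := coframe 1
abbrev e₃ : OneForm := coframe 2
abbrev e₄ : OneForm := coframe 3
abbrev e₅ : OneForm := coframe 4

/-- A one-form regarded as an element of `Form 1`. -/
def toForm (α : OneForm) : Form 1 := ContinuousAlternatingMap.ofSubsingleton ℝ V ℝ (0 : Fin 1) α

/-- Exterior product `α ∧ σ` of a one-form with a `k`-form. -/
def wedge {k : ℕ} (α : OneForm) (σ : Form k) : Form (k + 1) :=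
  ContinuousAlternatingMap.alternatizeUncurryFin (α.smulRight σ)

/-- `α ⋏ β` is the two-form `α ∧ β`. -/
def wedgeTwo (α β : OneForm) : Form 2 := wedge α (toForm β)

infixl:72 " ⋏ " => wedgeTwo

/-- `α ∧ β ∧ γ`. -/
def wedgeThree (α β γ : OneForm) : Form 3 := wedge α (wedge β (toForm γ))

/-- Exterior product `τ ∧ σ` of a two-form with a `k`-form, by expanding
`τ = ½ ∑ τ(e_i, e_j) eⁱ ∧ eʲ`. -/
def wedgeForm {k : ℕ} (τ : Form 2) (σ : Form k) : Form (k + 2) :=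
  (1 / 2 : ℝ) • ∑ i : Fin 5, ∑ j : Fin 5,
    τ ![basisVec i, basisVec j] • wedge (coframe i) (wedge (coframe j) σ)

/-- The vector space `Hom(ℝ⁵, Λ²ℝ⁵)` with its usual topology. -/
abbrev Hom12 : Type := OneForm →L[ℝ] Form 2

/-- The derivation of the exterior algebra induced by `d : ℝ⁵ → Λ²ℝ⁵`, in positive degrees:
`d̂ σ = ∑ᵢ d eⁱ ∧ (eᵢ ⌟ σ)`.
See `extD_toForm` and `extD_wedge` for the two properties that characterize it. -/
def extD (d : Hom12) {k : ℕ} (σ : Form (k + 1)) : Form (k + 2) :=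
  ∑ i : Fin 5, wedgeForm (d (coframe i)) (σ.curryLeft (basisVec i))

/-! ### Elementary facts on the exterior product and the derivation -/

theorem wedge_apply {k : ℕ} (α : OneForm) (σ : Form k) (v : Fin (k + 1) → V) :
    wedge α σ v = ∑ i : Fin (k + 1), (-1) ^ (i : ℕ) * (α (v i) * σ (i.removeNth v)) := by
  simp [wedge, ContinuousAlternatingMap.alternatizeUncurryFin_apply]

theorem wedge_add {k : ℕ} (α : OneForm) (σ τ : Form k) :
    wedge α (σ + τ) = wedge α σ + wedge α τ := by
  ext v
  simp [wedge_apply, mul_add, Finset.sum_add_distrib]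

theorem wedge_smul {k : ℕ} (α : OneForm) (c : ℝ) (σ : Form k) :
    wedge α (c • σ) = c • wedge α σ := by
  ext v
  simp only [wedge_apply, ContinuousAlternatingMap.smul_apply, smul_eq_mul, Finset.mul_sum]
  exact Finset.sum_congr rfl fun _ _ => by ring

/-- `σ ↦ α ∧ σ` as a linear map. -/
def wedgeLM (k : ℕ) (α : OneForm) : Form k →ₗ[ℝ] Form (k + 1) where
  toFun := wedge α
  map_add' := wedge_add α
  map_smul' := wedge_smul α

@[simp] theorem wedge_zero {k : ℕ} (α : OneForm) : wedge α (0 : Form k) = 0 :=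
  (wedgeLM k α).map_zero

theorem wedge_sum {k : ℕ} {ι : Type} (s : Finset ι) (α : OneForm) (σ : ι → Form k) :
    wedge α (∑ i ∈ s, σ i) = ∑ i ∈ s, wedge α (σ i) :=
  map_sum (wedgeLM k α) σ s

theorem wedge_neg {k : ℕ} (α : OneForm) (σ : Form k) : wedge α (-σ) = -wedge α σ :=
  (wedgeLM k α).map_neg σ

theorem wedge_sub {k : ℕ} (α : OneForm) (σ τ : Form k) :
    wedge α (σ - τ) = wedge α σ - wedge α τ :=
  (wedgeLM k α).map_sub σ τ

theorem add_wedge {k : ℕ} (α β : OneForm) (σ : Form k) :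
    wedge (α + β) σ = wedge α σ + wedge β σ := by
  ext v
  simp [wedge_apply, add_mul, mul_add, Finset.sum_add_distrib]

theorem wedge_self {k : ℕ} (α : OneForm) (σ : Form k) : wedge α (wedge α σ) = 0 := by
  have h := ContinuousAlternatingMap.alternatizeUncurryFin_alternatizeUncurryFinCLM_comp_of_symmetric
    (f := α.smulRight (α.smulRight σ)) (fun x y => by
      simp only [ContinuousLinearMap.smulRight_apply, smul_apply, smul_smul]
      rw [mul_comm])
  rw [← h, wedge]
  congr 1
  ext x v
  simp [wedge]

theorem wedge_anticomm {k : ℕ} (α β : OneForm) (σ : Form k) :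
    wedge α (wedge β σ) = -wedge β (wedge α σ) := by
  have h := wedge_self (α + β) σ
  simp only [add_wedge, wedge_add, wedge_self, zero_add, add_zero] at h
  exact eq_neg_of_add_eq_zero_right h

theorem curryLeft_wedge {k : ℕ} (α : OneForm) (σ : Form (k + 1)) (x : V) :
    (wedge α σ).curryLeft x = α x • σ - wedge α (σ.curryLeft x) := by
  ext v
  simp only [ContinuousAlternatingMap.curryLeft_apply_apply, wedge_apply,
    ContinuousAlternatingMap.sub_apply, ContinuousAlternatingMap.smul_apply, smul_eq_mul]
  rw [Fin.sum_univ_succ, sub_eq_add_neg, ← Finset.sum_neg_distrib]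
  congr 1
  · simp [Matrix.vecCons]
  · refine Finset.sum_congr rfl fun i _ => ?_
    have : i.succ.removeNth (Matrix.vecCons x v) = Matrix.vecCons x (i.removeNth v) := by
      funext j
      refine Fin.cases ?_ (fun j => ?_) j <;> simp [Matrix.vecCons, Fin.removeNth]
    rw [this]
    simp [pow_succ]

theorem wedgeForm_add {k : ℕ} (τ : Form 2) (σ ρ : Form k) :
    wedgeForm τ (σ + ρ) = wedgeForm τ σ + wedgeForm τ ρ := by
  simp only [wedgeForm, wedge_add, smul_add, Finset.sum_add_distrib]

theorem wedgeForm_smul {k : ℕ} (τ : Form 2) (c : ℝ) (σ : Form k) :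
    wedgeForm τ (c • σ) = c • wedgeForm τ σ := by
  simp only [wedgeForm, wedge_smul, Finset.smul_sum, smul_comm c]

/-- The exterior product with `σ` as a linear map on two-forms. -/
def wedgeFormLM {k : ℕ} (σ : Form k) : Form 2 →ₗ[ℝ] Form (k + 2) where
  toFun τ := wedgeForm τ σ
  map_add' τ τ' := by
    simp only [wedgeForm, ContinuousAlternatingMap.add_apply, add_smul, Finset.sum_add_distrib,
      smul_add]
  map_smul' c τ := by
    simp only [wedgeForm, ContinuousAlternatingMap.smul_apply, smul_eq_mul, mul_smul,
      Finset.smul_sum, RingHom.id_apply, smul_comm c]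

@[simp] theorem zero_wedgeForm {k : ℕ} (σ : Form k) : wedgeForm 0 σ = 0 :=
  (wedgeFormLM σ).map_zero

theorem wedgeForm_wedge {k : ℕ} (τ : Form 2) (α : OneForm) (σ : Form k) :
    wedgeForm τ (wedge α σ) = wedge α (wedgeForm τ σ) := by
  simp only [wedgeForm, wedge_smul, wedge_sum]
  congr 1
  refine Finset.sum_congr rfl fun i _ => Finset.sum_congr rfl fun j _ => ?_
  congr 1
  rw [wedge_anticomm (coframe j) α, wedge_neg, wedge_anticomm (coframe i) α, neg_neg]

theorem vec_eq_sum (x : V) : x = ∑ i : Fin 5, x i • basisVec i := by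
  ext j
  simp [Pi.single_apply]

theorem oneForm_eq_sum (α : OneForm) : α = ∑ i : Fin 5, α (basisVec i) • coframe i := by
  ext x
  conv_lhs => rw [vec_eq_sum x]
  simp [mul_comm]

theorem twoForm_swap (τ : Form 2) (x y : V) : τ ![y, x] = -τ ![x, y] := by
  have h := τ.toAlternatingMap.map_swap ![x, y] (i := 0) (j := 1) (by decide)
  have h' : (![x, y] ∘ (Equiv.swap (0 : Fin 2) 1)) = ![y, x] := by
    funext i
    fin_cases i <;> rfl
  rw [h'] at h
  exact h

theorem twoForm_apply_left (τ : Form 2) (x y : V) :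
    τ ![x, y] = ∑ i : Fin 5, x i * τ ![basisVec i, y] := by
  have h : ∀ u : V, τ ![u, y] = τ.curryLeft u ![y] := fun u => rfl
  simp only [h]
  conv_lhs => rw [vec_eq_sum x]
  simp only [map_sum, map_smul, ContinuousAlternatingMap.sum_apply,
    ContinuousAlternatingMap.smul_apply, smul_eq_mul]

theorem twoForm_apply (τ : Form 2) (x y : V) :
    τ ![x, y] = ∑ i : Fin 5, ∑ j : Fin 5, τ ![basisVec i, basisVec j] * (x i * y j) := by
  rw [twoForm_apply_left]
  refine Finset.sum_congr rfl fun i _ => ?_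
  rw [twoForm_swap τ y, twoForm_apply_left τ y, ← Finset.sum_neg_distrib, Finset.mul_sum]
  refine Finset.sum_congr rfl fun j _ => ?_
  rw [twoForm_swap τ (basisVec i)]
  ring

theorem wedge_apply_two (α : OneForm) (σ : Form 1) (x y : V) :
    wedge α σ ![x, y] = α x * σ ![y] - α y * σ ![x] := by
  have h0 : (0 : Fin 2).removeNth ![x, y] = ![y] := by funext i; fin_cases i; rfl
  have h1 : (1 : Fin 2).removeNth ![x, y] = ![x] := by funext i; fin_cases i; rfl
  rw [wedge_apply, Fin.sum_univ_two, h0, h1]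
  simp
  ring

theorem wedge_apply_three (α : OneForm) (σ : Form 2) (x y z : V) :
    wedge α σ ![x, y, z] = α x * σ ![y, z] - α y * σ ![x, z] + α z * σ ![x, y] := by
  have h0 : (0 : Fin 3).removeNth ![x, y, z] = ![y, z] := by
    funext i; fin_cases i <;> rfl
  have h1 : (1 : Fin 3).removeNth ![x, y, z] = ![x, z] := by
    funext i; fin_cases i <;> rfl
  have h2 : (2 : Fin 3).removeNth ![x, y, z] = ![x, y] := by
    funext i; fin_cases i <;> rfl
  rw [wedge_apply, Fin.sum_univ_three, h0, h1, h2]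
  simp
  ring

theorem wedgeTwo_apply (α β : OneForm) (x y : V) :
    (α ⋏ β) ![x, y] = α x * β y - α y * β x := by
  rw [wedgeTwo, wedge_apply_two]
  rfl

theorem wedgeForm_apply_two (τ : Form 2) (σ : Form 0) (x y : V) :
    wedgeForm τ σ ![x, y] = τ ![x, y] * σ ![] := by
  have hw : ∀ (β : OneForm) (u : V), wedge β σ ![u] = β u * σ ![] := by
    intro β u
    rw [wedge_apply, Fin.sum_univ_one, Subsingleton.elim ((0 : Fin 1).removeNth ![u]) ![]]
    simp
  have h : wedgeForm τ σ ![x, y] = (1 / 2) * (τ ![x, y] * σ ![] - τ ![y, x] * σ ![]) := by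
    rw [twoForm_apply τ x y, twoForm_apply τ y x]
    simp only [wedgeForm, ContinuousAlternatingMap.smul_apply, smul_eq_mul,
      ContinuousAlternatingMap.sum_apply, wedge_apply_two, hw, Finset.sum_mul,
      ← Finset.sum_sub_distrib]
    congr 1
    refine Finset.sum_congr rfl fun i _ => Finset.sum_congr rfl fun j _ => ?_
    simp only [PiLp.proj_apply]
    ring
  rw [h, twoForm_swap τ x y]
  ring

theorem wedgeForm_apply_three (τ : Form 2) (σ : Form 1) (x y z : V) :
    wedgeForm τ σ ![x, y, z] =
      τ ![x, y] * σ ![z] - τ ![x, z] * σ ![y] + τ ![y, z] * σ ![x] := by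
  have h : wedgeForm τ σ ![x, y, z] = (1 / 2) * (τ ![x, y] * σ ![z] - τ ![y, x] * σ ![z]
      - τ ![x, z] * σ ![y] + τ ![z, x] * σ ![y] + τ ![y, z] * σ ![x] - τ ![z, y] * σ ![x]) := by
    rw [twoForm_apply τ x y, twoForm_apply τ y x, twoForm_apply τ x z, twoForm_apply τ z x,
      twoForm_apply τ y z, twoForm_apply τ z y]
    simp only [wedgeForm, ContinuousAlternatingMap.smul_apply, smul_eq_mul,
      ContinuousAlternatingMap.sum_apply, wedge_apply_two, wedge_apply_three, Finset.sum_mul,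
      ← Finset.sum_sub_distrib, ← Finset.sum_add_distrib]
    congr 1
    refine Finset.sum_congr rfl fun i _ => Finset.sum_congr rfl fun j _ => ?_
    simp only [PiLp.proj_apply]
    ring
  rw [h, twoForm_swap τ x y, twoForm_swap τ x z, twoForm_swap τ y z]
  ring

theorem extD_apply_three (d : Hom12) (σ : Form 2) (x y z : V) :
    extD d σ ![x, y, z] = ∑ i : Fin 5, (d (coframe i) ![x, y] * σ ![basisVec i, z]
      - d (coframe i) ![x, z] * σ ![basisVec i, y]
      + d (coframe i) ![y, z] * σ ![basisVec i, x]) := by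
  simp only [extD, ContinuousAlternatingMap.sum_apply, wedgeForm_apply_three,
    ContinuousAlternatingMap.curryLeft_apply_apply]

/-- On one-forms, the derivation is `d` itself. -/
theorem extD_toForm (d : Hom12) (α : OneForm) : extD d (toForm α) = d α := by
  have h0 : ∀ τ : Form 2, ∀ i : Fin 5,
      wedgeForm τ ((toForm α).curryLeft (basisVec i)) = α (basisVec i) • τ := by
    intro τ i
    ext v
    obtain ⟨x, y, rfl⟩ : ∃ x y, v = ![x, y] := ⟨v 0, v 1, by ext j; fin_cases j <;> rfl⟩
    have h1 : (toForm α).curryLeft (basisVec i) ![] = α (basisVec i) := rfl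
    rw [wedgeForm_apply_two, h1, ContinuousAlternatingMap.smul_apply, smul_eq_mul, mul_comm]
  conv_rhs => rw [oneForm_eq_sum α]
  simp only [extD, h0, map_sum, map_smul]

/-- The graded Leibniz rule `d̂(α ∧ σ) = dα ∧ σ - α ∧ d̂σ`. -/
theorem extD_wedge (d : Hom12) {k : ℕ} (α : OneForm) (σ : Form (k + 1)) :
    extD d (wedge α σ) = wedgeForm (d α) σ - wedge α (extD d σ) := by
  have hα : wedgeForm (d α) σ =
      ∑ i : Fin 5, α (basisVec i) • wedgeForm (d (coframe i)) σ := by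
    conv_lhs => rw [oneForm_eq_sum α]
    simp only [map_sum, map_smul]
    change wedgeFormLM σ _ = _
    simp only [map_sum, map_smul]
    rfl
  rw [hα, extD, extD, wedge_sum, ← Finset.sum_sub_distrib]
  refine Finset.sum_congr rfl fun i _ => ?_
  rw [curryLeft_wedge, sub_eq_add_neg, ← neg_one_smul ℝ (wedge α (σ.curryLeft _)), wedgeForm_add,
    wedgeForm_smul, wedgeForm_smul, wedgeForm_wedge, neg_one_smul ℝ (wedge α _), sub_eq_add_neg]

/-! ### The variety of Lie brackets, and the Lie algebra defined by one of its points -/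

/-- The variety `𝒟 = {d ∈ Hom(ℝ⁵, Λ²ℝ⁵) | d̂ ∘ d = 0}`, with the subspace topology. -/
abbrev Brackets : Type := {d : Hom12 // ∀ α : OneForm, extD d (d α) = 0}

/-- The bracket dual to `d`: it is determined by `α([x, y]) = -(dα)(x, y)`. -/
def bracket (d : Hom12) (x y : V) : V :=
  -∑ i : Fin 5, d (coframe i) ![x, y] • basisVec i

theorem oneForm_bracket (d : Hom12) (α : OneForm) (x y : V) :
    α (bracket d x y) = -d α ![x, y] := by
  conv_rhs => rw [oneForm_eq_sum α]
  simp only [bracket, map_neg, map_sum, map_smul, ContinuousAlternatingMap.sum_apply,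
    ContinuousAlternatingMap.smul_apply, smul_eq_mul]
  congr 1
  exact Finset.sum_congr rfl fun i _ => mul_comm _ _

theorem bracket_apply (d : Hom12) (x y : V) (i : Fin 5) :
    bracket d x y i = -d (coframe i) ![x, y] := oneForm_bracket d (coframe i) x y

theorem twoForm_bracket (d : Hom12) (τ : Form 2) (x y z : V) :
    τ ![bracket d x y, z] = -∑ i : Fin 5, d (coframe i) ![x, y] * τ ![basisVec i, z] := by
  rw [twoForm_apply_left]
  simp only [bracket_apply, neg_mul, Finset.sum_neg_distrib]

theorem extD_apply_bracket (d : Hom12) (τ : Form 2) (x y z : V) :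
    extD d τ ![x, y, z] =
      -τ ![bracket d x y, z] + τ ![bracket d x z, y] - τ ![bracket d y z, x] := by
  rw [extD_apply_three, Finset.sum_add_distrib, Finset.sum_sub_distrib, twoForm_bracket,
    twoForm_bracket, twoForm_bracket]
  ring

theorem bracket_skew (d : Hom12) (x y : V) : bracket d x y = -bracket d y x := by
  refine PiLp.ext fun i => ?_
  rw [PiLp.neg_apply, bracket_apply, bracket_apply, twoForm_swap _ y x]

theorem bracket_self (d : Hom12) (x : V) : bracket d x x = 0 := by
  refine PiLp.ext fun i => ?_
  have h := twoForm_swap (d (coframe i)) x x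
  rw [bracket_apply, PiLp.zero_apply]
  linarith

theorem bracket_add_left (d : Hom12) (x y z : V) :
    bracket d (x + y) z = bracket d x z + bracket d y z := by
  refine PiLp.ext fun i => ?_
  rw [PiLp.add_apply, bracket_apply, bracket_apply, bracket_apply, twoForm_apply_left _ (x + y),
    twoForm_apply_left _ x, twoForm_apply_left _ y]
  simp only [PiLp.add_apply, add_mul, Finset.sum_add_distrib]
  ring

theorem bracket_smul_left (d : Hom12) (c : ℝ) (x z : V) :
    bracket d (c • x) z = c • bracket d x z := by
  refine PiLp.ext fun i => ?_
  rw [PiLp.smul_apply, bracket_apply, bracket_apply, twoForm_apply_left _ (c • x),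
    twoForm_apply_left _ x]
  simp only [PiLp.smul_apply, smul_eq_mul, mul_assoc, ← Finset.mul_sum]
  ring

theorem bracket_add_right (d : Hom12) (x y z : V) :
    bracket d x (y + z) = bracket d x y + bracket d x z := by
  rw [bracket_skew, bracket_add_left, bracket_skew d x y, bracket_skew d x z, neg_add]

theorem bracket_smul_right (d : Hom12) (c : ℝ) (x z : V) :
    bracket d x (c • z) = c • bracket d x z := by
  rw [bracket_skew, bracket_smul_left, bracket_skew d x z, smul_neg]

theorem bracket_jacobi (d : Brackets) (x y z : V) :
    bracket d.1 x (bracket d.1 y z) =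
      bracket d.1 (bracket d.1 x y) z + bracket d.1 y (bracket d.1 x z) := by
  refine PiLp.ext fun i => ?_
  have h : extD d.1 (d.1 (coframe i)) ![x, y, z] = 0 := by rw [d.2]; rfl
  rw [extD_apply_bracket] at h
  rw [PiLp.add_apply, bracket_apply, bracket_apply, bracket_apply,
    twoForm_swap _ (bracket d.1 y z) x, twoForm_swap _ (bracket d.1 x z) y]
  linarith

/-- The five-dimensional vector space `V` with the Lie bracket whose Chevalley-Eilenberg
differential on one-forms is `d`. -/
def LieAlg (_d : Brackets) : Type := V

instance (d : Brackets) : AddCommGroup (LieAlg d) := inferInstanceAs (AddCommGroup V)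

instance (d : Brackets) : Module ℝ (LieAlg d) := inferInstanceAs (Module ℝ V)

instance (d : Brackets) : LieRing (LieAlg d) where
  bracket := bracket d.1
  add_lie := bracket_add_left d.1
  lie_add := bracket_add_right d.1
  lie_self := bracket_self d.1
  leibniz_lie := bracket_jacobi d

instance (d : Brackets) : LieAlgebra ℝ (LieAlg d) where
  lie_smul := bracket_smul_right d.1

/-! ### The actions of `GL(5, ℝ)` and of `U(2)` -/

/-- The action of an invertible linear map by change of coframe: `d ↦ g⁻¹ ∘ d ∘ g`, where `g` acts
on forms as the pull-back by `f`. -/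
def act (f : V ≃L[ℝ] V) (d : Hom12) : Hom12 :=
  (ContinuousAlternatingMap.compContinuousLinearMapCLM (f.symm : V →L[ℝ] V)).comp
    (d.comp ((ContinuousLinearMap.compL ℝ V V ℝ).flip (f : V →L[ℝ] V)))

theorem act_apply (f : V ≃L[ℝ] V) (d : Hom12) (α : OneForm) :
    act f d α = (d (α.comp (f : V →L[ℝ] V))).compContinuousLinearMap (f.symm : V →L[ℝ] V) := rfl

theorem act_one (d : Hom12) : act 1 d = d := rfl

theorem act_mul (f g : V ≃L[ℝ] V) (d : Hom12) : act (f * g) d = act f (act g d) := rfl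

/-- The `GL(5, ℝ)`-orbit of a point of `𝒟`. -/
def orbitGL (d : Brackets) : Set Brackets := {d' | ∃ f : V ≃L[ℝ] V, d'.1 = act f d.1}

/-- Multiplication by the imaginary unit on `ℂ² ⊕ 0`, in the coordinates `z₁ = x₁ + i x₂`,
`z₂ = x₃ + i x₄` of `ℝ⁵ = ℂ² ⊕ ℝ`. -/
def J (x : V) : V := !₂[-x 1, x 0, -x 3, x 2, 0]

/-- The group `U(2)` acting on `ℝ⁵ = ℂ² ⊕ ℝ`: the linear isometries that fix the last basis vector
and are complex linear on its orthogonal complement `ℂ²`. -/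
def U2 : Subgroup (V ≃ₗᵢ[ℝ] V) where
  carrier := {f | (∀ x, f (J x) = J (f x)) ∧ f (basisVec 4) = basisVec 4}
  one_mem' := ⟨fun _ => rfl, rfl⟩
  mul_mem' := by
    rintro f g ⟨hf, hf'⟩ ⟨hg, hg'⟩
    refine ⟨fun x => ?_, ?_⟩
    · change f (g (J x)) = J (f (g x))
      rw [hg, hf]
    · change f (g (basisVec 4)) = basisVec 4
      rw [hg', hf']
  inv_mem' := by
    rintro f ⟨hf, hf'⟩
    refine ⟨fun x => ?_, ?_⟩
    · change f.symm (J x) = J (f.symm x)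
      rw [LinearIsometryEquiv.symm_apply_eq, hf, LinearIsometryEquiv.apply_symm_apply]
    · change f.symm (basisVec 4) = basisVec 4
      rw [LinearIsometryEquiv.symm_apply_eq, hf']

/-- The equivalence relation on `𝒟` whose classes are the `U(2)`-orbits. -/
def u2Setoid : Setoid Brackets where
  r d d' := ∃ f ∈ U2, d'.1 = act f.toContinuousLinearEquiv d.1
  iseqv :=
    { refl := fun d => ⟨1, U2.one_mem, rfl⟩
      symm := by
        rintro d d' ⟨f, hf, h⟩
        refine ⟨f⁻¹, U2.inv_mem hf, ?_⟩
        have h1 : act f⁻¹.toContinuousLinearEquiv (act f.toContinuousLinearEquiv d.1) =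
            act (f⁻¹.toContinuousLinearEquiv * f.toContinuousLinearEquiv) d.1 := rfl
        have h2 : f⁻¹.toContinuousLinearEquiv * f.toContinuousLinearEquiv = 1 := by
          refine ContinuousLinearEquiv.ext ?_
          exact funext fun x => f.symm_apply_apply x
        rw [h, h1, h2, act_one]
      trans := by
        rintro d d' d'' ⟨f, hf, h⟩ ⟨g, hg, h'⟩
        refine ⟨g * f, U2.mul_mem hg hf, ?_⟩
        rw [h', h]
        rfl }

/-- The quotient `𝒟 / U(2)`, with the quotient topology. -/
abbrev ModU2 : Type := Quotient u2Setoid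

/-! ### Hypo structures -/

/-- `d` is hypo: the forms `e¹² + e³⁴`, `e¹³⁵ + e⁴²⁵` and `e¹⁴⁵ + e²³⁵` are closed. -/
def IsHypo (d : Brackets) : Prop :=
  extD d.1 (e₁ ⋏ e₂ + e₃ ⋏ e₄) = 0 ∧
  extD d.1 (wedgeThree e₁ e₃ e₅ + wedgeThree e₄ e₂ e₅) = 0 ∧
  extD d.1 (wedgeThree e₁ e₄ e₅ + wedgeThree e₂ e₃ e₅) = 0

/-- The space `H_d` of hypo points in the `GL(5, ℝ)`-orbit of `d`, taken modulo `U(2)`. -/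
def hypoSpace (d : Brackets) : Set ModU2 :=
  Quotient.mk u2Setoid '' {d' | d' ∈ orbitGL d ∧ IsHypo d'}

/-- The linear map `d` with `d eⁱ = τ i`, classically written `(τ 1, …, τ 5)`. -/
def ofTuple (τ : Fin 5 → Form 2) : Hom12 :=
  ∑ i : Fin 5, (ContinuousLinearMap.apply ℝ ℝ (basisVec i)).smulRight (τ i)

theorem ofTuple_apply (τ : Fin 5 → Form 2) (α : OneForm) :
    ofTuple τ α = ∑ i : Fin 5, α (basisVec i) • τ i := by
  simp [ofTuple]

theorem ofTuple_coframe (τ : Fin 5 → Form 2) (i : Fin 5) : ofTuple τ (coframe i) = τ i := by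
  rw [ofTuple_apply, Finset.sum_eq_single i] <;> simp +contextual [eq_comm]

/-! ### The three families -/

/-- The family `ℳ₁`. -/
def family₁ : Set Hom12 :=
  {d | ∃ l m h k : ℝ, d = ofTuple ![l • (e₃ ⋏ e₅), h • (e₃ ⋏ e₅) + k • (e₁ ⋏ e₅), 0,
    ((-l) • e₂ + h • e₁ + m • e₃) ⋏ e₅, 0]}

/-- The family `ℳ₂`. -/
def family₂ : Set Hom12 :=
  {d | ∃ x y h k l m : ℝ, (!![x, y, l, m; h, k, x, y]).rank < 2 ∧
    d = ofTuple ![0, x • (e₃ ⋏ e₄) + l • (e₃ ⋏ e₅), 0,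
      x • (e₁ ⋏ e₄ - e₂ ⋏ e₃) - y • (e₃ ⋏ e₄) + l • (e₁ ⋏ e₅) - m • (e₃ ⋏ e₅),
      (-h) • (e₁ ⋏ e₄ - e₂ ⋏ e₃) + k • (e₃ ⋏ e₄) - x • (e₁ ⋏ e₅) + y • (e₃ ⋏ e₅)]}

/-- The family `ℳ₃`. -/
def family₃ : Set Hom12 :=
  {d | ∃ l m : ℝ, d = ofTuple ![0, 0, 0, 0, (l + m) • (e₁ ⋏ e₂) + (l - m) • (e₃ ⋏ e₄)]}

/-! ### The nodes and the arrows of the diagram -/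

/-- The five nodes of the diagram:
`a = (0,0,0,12,13+24)`, `b = (0,0,0,0,12+34)`, `c = (0,0,0,0,12)`,
`f = (0,0,12,13,14)`, `g = (0,0,0,12,13)`. -/
inductive Node : Type
  | a | b | c | f | g

/-- The differentials of the coframe in each of the five Lie algebras. -/
def nodeTuple : Node → Fin 5 → Form 2
  | .a => ![0, 0, 0, e₁ ⋏ e₂, e₁ ⋏ e₃ + e₂ ⋏ e₄]
  | .b => ![0, 0, 0, 0, e₁ ⋏ e₂ + e₃ ⋏ e₄]
  | .c => ![0, 0, 0, 0, e₁ ⋏ e₂]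
  | .f => ![0, 0, e₁ ⋏ e₂, e₁ ⋏ e₃, e₁ ⋏ e₄]
  | .g => ![0, 0, 0, e₁ ⋏ e₂, e₁ ⋏ e₃]

theorem extD_add (d : Hom12) {k : ℕ} (σ ρ : Form (k + 1)) :
    extD d (σ + ρ) = extD d σ + extD d ρ := by
  simp only [extD, ContinuousAlternatingMap.curryLeft_add, add_apply,
    wedgeForm_add, Finset.sum_add_distrib]

theorem extD_smul (d : Hom12) {k : ℕ} (c : ℝ) (σ : Form (k + 1)) :
    extD d (c • σ) = c • extD d σ := by
  simp only [extD, ContinuousAlternatingMap.curryLeft_smul, smul_apply,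
    wedgeForm_smul, Finset.smul_sum]

@[simp] theorem extD_zero (d : Hom12) {k : ℕ} : extD d (0 : Form (k + 1)) = 0 := by
  simpa using extD_smul d 0 (0 : Form (k + 1))

theorem extD_wedgeTwo (d : Hom12) (α β : OneForm) :
    extD d (α ⋏ β) = wedgeForm (d α) (toForm β) - wedge α (d β) := by
  rw [wedgeTwo, extD_wedge, extD_toForm]

theorem extD_ofTuple (τ : Fin 5 → Form 2) (h : ∀ i, extD (ofTuple τ) (τ i) = 0) (α : OneForm) :
    extD (ofTuple τ) (ofTuple τ α) = 0 := by
  rw [ofTuple_apply, Fin.sum_univ_five]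
  simp only [extD_add, extD_smul, h, smul_zero, add_zero]

theorem wedgeTwo_self (α : OneForm) : α ⋏ α = 0 := by
  ext v
  obtain ⟨x, y, rfl⟩ : ∃ x y, v = ![x, y] := ⟨v 0, v 1, by ext j; fin_cases j <;> rfl⟩
  rw [wedgeTwo_apply, mul_comm, sub_self]
  rfl

theorem wedge_wedgeTwo_left (α β : OneForm) : wedge α (α ⋏ β) = 0 := wedge_self _ _

theorem wedge_wedgeTwo_right (α β : OneForm) : wedge α (β ⋏ α) = 0 := by
  rw [wedgeTwo, wedge_anticomm, ← wedgeTwo, wedgeTwo_self, wedge_zero, neg_zero]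

theorem node_closed (n : Node) (i : Fin 5) :
    extD (ofTuple (nodeTuple n)) (nodeTuple n i) = 0 := by
  have hc : ∀ i : Fin 5, ofTuple (nodeTuple n) (coframe i) = nodeTuple n i := ofTuple_coframe _
  have h1 : ofTuple (nodeTuple n) e₁ = nodeTuple n 0 := hc 0
  have h2 : ofTuple (nodeTuple n) e₂ = nodeTuple n 1 := hc 1
  have h3 : ofTuple (nodeTuple n) e₃ = nodeTuple n 2 := hc 2
  have h4 : ofTuple (nodeTuple n) e₄ = nodeTuple n 3 := hc 3
  generalize hD : ofTuple (nodeTuple n) = D at h1 h2 h3 h4 ⊢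
  cases n <;> fin_cases i <;>
    simp [nodeTuple] at h1 h2 h3 h4 ⊢ <;>
    simp [extD_add, extD_wedgeTwo, h1, h2, h3, h4, wedge_wedgeTwo_left, wedge_wedgeTwo_right]

/-- The point of `𝒟` at a node of the diagram. -/
def node (n : Node) : Brackets :=
  ⟨ofTuple (nodeTuple n), extD_ofTuple _ (node_closed n)⟩

/-- The arrows with a double head. -/
inductive DoubleArrow : Node → Node → Prop
  | a_c : DoubleArrow .a .c
  | f_g : DoubleArrow .f .g

/-- The arrows of the diagram, with a single or a double head. -/
inductive Arrow : Node → Node → Prop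
  | a_c : Arrow .a .c
  | a_b : Arrow .a .b
  | a_g : Arrow .a .g
  | b_c : Arrow .b .c
  | f_g : Arrow .f .g
  | f_c : Arrow .f .c
  | g_c : Arrow .g .c

end HypoLie

end

open HypoLie

noncomputable section

namespace HypoLie

/-! ### Coordinates -/

/-! Everything is rewritten in terms of the bracket dual to `d`, whose structure constants are
`coef`. Basis vectors and coframe are called e₁, …, e₅ and e¹, …, e⁵ below; Lean indices are one
lower.

(1) Let `d` be nilpotent, hypo and nonzero. The derived algebra, which is the annihilator of the
closed one-forms, contains a nonzero central vector ξ. Since U(2) is transitive on the spheres of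
ℂ², ξ can be moved into the plane of e₄ and e₅. If ξ is not a multiple of e₅, take ξ = e₄ + t e₅.
The hypo equations, centrality and unimodularity then form a linear system whose solution
(`CentralForm`) has de³ = 0. Nilpotency provides a second vector x in ker e³, central modulo ξ.
Depending on the position of x, a rotation of the first complex coordinate brings `d` into ℳ₁ or ℳ₂;
the one remaining configuration is excluded because it has a closed one-form not vanishing on ξ
(`CentralPair.meetsFamily`). If ξ is a multiple of e₅, a vector central modulo e₅ forces every deⁱ
except de⁵ to vanish, and de⁵ is a real (1,1)-form on ℂ². Diagonalizing it by U(2) gives ℳ₃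
(`meetsFamily_of_central_five`). Conversely, the families are hypo by direct computation, and
nilpotent because each nonzero member is isomorphic to a node.

(2) Explicit coframes identify each nonzero member of the families with one of the five nodes
(`family₁_classify`, `family₂_classify`, `family₃_classify`). The nodes are pairwise non-isomorphic
by the invariants used in (3).

(3) Each arrow is realized by an explicit curve. The other degenerations are excluded by three
closed GL-invariant conditions: derived algebra of dimension at most one, decomposability of every
exact two-form, and vanishing of brackets of length four (`exists_invariant`).

(4) A closed U(2)-invariant set has closed image in the quotient, so an inclusion of hypo closures
can be refuted upstairs. The invariants of (3) leave only the seven arrows. Two hold by perturbing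
the parameters of ℳ₂ and ℳ₁; the other five fail because of closed U(2)-invariant conditions read
off from the families. -/

theorem form_two_ext {σ τ : Form 2} (h : ∀ x y, σ ![x, y] = τ ![x, y]) : σ = τ := by
  ext v
  obtain ⟨x, y, rfl⟩ : ∃ x y, v = ![x, y] := ⟨v 0, v 1, by ext j; fin_cases j <;> rfl⟩
  exact h x y

theorem form_three_ext {σ τ : Form 3} (h : ∀ x y z, σ ![x, y, z] = τ ![x, y, z]) : σ = τ := by
  ext v
  obtain ⟨x, y, z, rfl⟩ : ∃ x y z, v = ![x, y, z] :=
    ⟨v 0, v 1, v 2, by ext j; fin_cases j <;> rfl⟩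
  exact h x y z

theorem form_four_ext {σ τ : Form 4} (h : ∀ x y z w, σ ![x, y, z, w] = τ ![x, y, z, w]) :
    σ = τ := by
  ext v
  obtain ⟨x, y, z, w, rfl⟩ : ∃ x y z w, v = ![x, y, z, w] :=
    ⟨v 0, v 1, v 2, v 3, by ext j; fin_cases j <;> rfl⟩
  exact h x y z w

theorem oneForm_apply (α : OneForm) (x : V) : α x = ∑ i : Fin 5, α (basisVec i) * x i := by
  conv_lhs => rw [oneForm_eq_sum α]
  simp

theorem hom12_ext_bracket {d d' : Hom12} (h : ∀ x y, bracket d x y = bracket d' x y) :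
    d = d' := by
  refine ContinuousLinearMap.ext fun α => form_two_ext fun x y => ?_
  have := congrArg α (h x y)
  rw [oneForm_bracket, oneForm_bracket] at this
  linarith

/-- The structure constants: the components of the bracket in the standard basis. -/
def coef (d : Hom12) (i j k : Fin 5) : ℝ := d (coframe i) ![basisVec j, basisVec k]

theorem coef_swap (d : Hom12) (i j k : Fin 5) : coef d i k j = -coef d i j k :=
  twoForm_swap _ _ _

theorem coef_self (d : Hom12) (i j : Fin 5) : coef d i j j = 0 := by
  have := coef_swap d i j j
  linarith

theorem bracket_basis (d : Hom12) (i j k : Fin 5) :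
    bracket d (basisVec j) (basisVec k) i = -coef d i j k := bracket_apply _ _ _ _

/-- The value of a two-form with the ten components `c₁₂, …, c₄₅`. -/
def twoFormVal (c : Fin 5 → Fin 5 → ℝ) (x y : V) : ℝ :=
  c 0 1 * (x 0 * y 1 - x 1 * y 0) + c 0 2 * (x 0 * y 2 - x 2 * y 0) +
  c 0 3 * (x 0 * y 3 - x 3 * y 0) + c 0 4 * (x 0 * y 4 - x 4 * y 0) +
  c 1 2 * (x 1 * y 2 - x 2 * y 1) + c 1 3 * (x 1 * y 3 - x 3 * y 1) +
  c 1 4 * (x 1 * y 4 - x 4 * y 1) + c 2 3 * (x 2 * y 3 - x 3 * y 2) +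
  c 2 4 * (x 2 * y 4 - x 4 * y 2) + c 3 4 * (x 3 * y 4 - x 4 * y 3)

theorem twoForm_apply_val (τ : Form 2) (x y : V) :
    τ ![x, y] = twoFormVal (fun j k => τ ![basisVec j, basisVec k]) x y := by
  have hs : ∀ i j : Fin 5, τ ![basisVec j, basisVec i] = -τ ![basisVec i, basisVec j] :=
    fun i j => twoForm_swap _ _ _
  have h0 : ∀ i : Fin 5, τ ![basisVec i, basisVec i] = 0 := fun i => by
    have := hs i i
    linarith
  rw [twoForm_apply]
  simp only [Fin.sum_univ_five, twoFormVal, h0]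
  rw [hs 0 1, hs 0 2, hs 0 3, hs 0 4, hs 1 2, hs 1 3, hs 1 4, hs 2 3, hs 2 4, hs 3 4]
  ring

theorem hom12_apply_coframe (d : Hom12) (i : Fin 5) (x y : V) :
    d (coframe i) ![x, y] = twoFormVal (coef d i) x y := twoForm_apply_val _ _ _

theorem bracket_val (d : Hom12) (i : Fin 5) (x y : V) :
    bracket d x y i = -twoFormVal (coef d i) x y := by
  rw [bracket_apply, hom12_apply_coframe]

/-! ### The derivation in terms of the bracket -/

theorem wedge_apply_four (α : OneForm) (σ : Form 3) (x y z w : V) :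
    wedge α σ ![x, y, z, w] = α x * σ ![y, z, w] - α y * σ ![x, z, w] + α z * σ ![x, y, w]
      - α w * σ ![x, y, z] := by
  have h0 : (0 : Fin 4).removeNth ![x, y, z, w] = ![y, z, w] := by
    funext i; fin_cases i <;> rfl
  have h1 : (1 : Fin 4).removeNth ![x, y, z, w] = ![x, z, w] := by
    funext i; fin_cases i <;> rfl
  have h2 : (2 : Fin 4).removeNth ![x, y, z, w] = ![x, y, w] := by
    funext i; fin_cases i <;> rfl
  have h3 : (3 : Fin 4).removeNth ![x, y, z, w] = ![x, y, z] := by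
    funext i; fin_cases i <;> rfl
  rw [wedge_apply, Fin.sum_univ_four, h0, h1, h2, h3]
  simp
  ring

theorem wedgeForm_apply_four (τ σ : Form 2) (x y z w : V) :
    wedgeForm τ σ ![x, y, z, w] =
      τ ![x, y] * σ ![z, w] - τ ![x, z] * σ ![y, w] + τ ![x, w] * σ ![y, z]
      + τ ![y, z] * σ ![x, w] - τ ![y, w] * σ ![x, z] + τ ![z, w] * σ ![x, y] := by
  -- Before skew symmetry of `τ` is used, the identity holds term by term in the double sum over the
  -- basis.
  have h : wedgeForm τ σ ![x, y, z, w] = (1 / 2) * (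
      (τ ![x, y] - τ ![y, x]) * σ ![z, w] - (τ ![x, z] - τ ![z, x]) * σ ![y, w]
      + (τ ![x, w] - τ ![w, x]) * σ ![y, z] + (τ ![y, z] - τ ![z, y]) * σ ![x, w]
      - (τ ![y, w] - τ ![w, y]) * σ ![x, z] + (τ ![z, w] - τ ![w, z]) * σ ![x, y]) := by
    rw [twoForm_apply τ x y, twoForm_apply τ y x, twoForm_apply τ x z, twoForm_apply τ z x,
      twoForm_apply τ y z, twoForm_apply τ z y, twoForm_apply τ x w, twoForm_apply τ w x,
      twoForm_apply τ y w, twoForm_apply τ w y, twoForm_apply τ z w, twoForm_apply τ w z]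
    simp only [wedgeForm, ContinuousAlternatingMap.smul_apply, smul_eq_mul,
      ContinuousAlternatingMap.sum_apply, wedge_apply_four, wedge_apply_three, Finset.sum_mul,
      ← Finset.sum_sub_distrib, ← Finset.sum_add_distrib]
    congr 1
    refine Finset.sum_congr rfl fun i _ => Finset.sum_congr rfl fun j _ => ?_
    simp only [PiLp.proj_apply]
    ring
  rw [h, twoForm_swap τ x y, twoForm_swap τ x z, twoForm_swap τ y z, twoForm_swap τ x w,
    twoForm_swap τ y w, twoForm_swap τ z w]
  ring

theorem threeForm_bracket (d : Hom12) (σ : Form 3) (x y z w : V) :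
    σ ![bracket d x y, z, w] =
      -∑ i : Fin 5, d (coframe i) ![x, y] * σ ![basisVec i, z, w] := by
  have h : ∀ u : V, σ ![u, z, w] = σ.curryLeft u ![z, w] := fun u => rfl
  simp only [h]
  simp only [bracket, map_neg, map_sum, map_smul, ContinuousAlternatingMap.neg_apply,
    ContinuousAlternatingMap.sum_apply, ContinuousAlternatingMap.smul_apply, smul_eq_mul]

theorem extD_apply_bracket_four (d : Hom12) (σ : Form 3) (x y z w : V) :
    extD d σ ![x, y, z, w] =
      -σ ![bracket d x y, z, w] + σ ![bracket d x z, y, w] - σ ![bracket d x w, y, z]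
      - σ ![bracket d y z, x, w] + σ ![bracket d y w, x, z] - σ ![bracket d z w, x, y] := by
  simp only [extD, ContinuousAlternatingMap.sum_apply, wedgeForm_apply_four,
    ContinuousAlternatingMap.curryLeft_apply_apply, threeForm_bracket]
  simp only [Finset.sum_add_distrib, Finset.sum_sub_distrib]
  ring

/-! ### Hypo structures in terms of the bracket -/

/-- The two-form `e¹² + e³⁴`. -/
def w₁ (x y : V) : ℝ := x 0 * y 1 - x 1 * y 0 + (x 2 * y 3 - x 3 * y 2)
/-- The two-form `e¹³ + e⁴²`. -/
def w₂ (x y : V) : ℝ := x 0 * y 2 - x 2 * y 0 + (x 3 * y 1 - x 1 * y 3)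
/-- The two-form `e¹⁴ + e²³`. -/
def w₃ (x y : V) : ℝ := x 0 * y 3 - x 3 * y 0 + (x 1 * y 2 - x 2 * y 1)

/-- The value of `w ∧ e⁵` for a two-form `w`. -/
def wedgeFive (w : V → V → ℝ) (x y z : V) : ℝ := w x y * z 4 - w x z * y 4 + w y z * x 4

/-- The value of the differential of a two-form. -/
def dTwo (b : V → V → V) (w : V → V → ℝ) (x y z : V) : ℝ :=
  -w (b x y) z + w (b x z) y - w (b y z) x

/-- The value of the differential of a three-form. -/
def dThree (b : V → V → V) (s : V → V → V → ℝ) (x y z w : V) : ℝ :=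
  -s (b x y) z w + s (b x z) y w - s (b x w) y z - s (b y z) x w + s (b y w) x z - s (b z w) x y

theorem isHypo_iff (d : Brackets) : IsHypo d ↔
    (∀ x y z, dTwo (bracket d.1) w₁ x y z = 0) ∧
    (∀ x y z w, dThree (bracket d.1) (wedgeFive w₂) x y z w = 0) ∧
    (∀ x y z w, dThree (bracket d.1) (wedgeFive w₃) x y z w = 0) := by
  have hw : ∀ α β : OneForm, wedge α (toForm β) = α ⋏ β := fun _ _ => rfl
  have h1 : ∀ x y, (e₁ ⋏ e₂ + e₃ ⋏ e₄) ![x, y] = w₁ x y := by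
    intro x y
    simp only [ContinuousAlternatingMap.add_apply, wedgeTwo_apply, PiLp.proj_apply, w₁]
    ring
  have h2 : ∀ x y z, (wedgeThree e₁ e₃ e₅ + wedgeThree e₄ e₂ e₅) ![x, y, z] =
      wedgeFive w₂ x y z := by
    intro x y z
    simp only [ContinuousAlternatingMap.add_apply, wedgeThree, wedge_apply_three, hw,
      wedgeTwo_apply, PiLp.proj_apply, w₂, wedgeFive]
    ring
  have h3 : ∀ x y z, (wedgeThree e₁ e₄ e₅ + wedgeThree e₂ e₃ e₅) ![x, y, z] =
      wedgeFive w₃ x y z := by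
    intro x y z
    simp only [ContinuousAlternatingMap.add_apply, wedgeThree, wedge_apply_three, hw,
      wedgeTwo_apply, PiLp.proj_apply, w₃, wedgeFive]
    ring
  refine and_congr ⟨fun h x y z => ?_, fun h => form_three_ext fun x y z => ?_⟩
    (and_congr ⟨fun h x y z w => ?_, fun h => form_four_ext fun x y z w => ?_⟩
      ⟨fun h x y z w => ?_, fun h => form_four_ext fun x y z w => ?_⟩)
  · have := congrArg (fun σ : Form 3 => σ ![x, y, z]) h
    simp only [extD_apply_bracket, h1] at this
    exact this
  · rw [extD_apply_bracket]; simp only [h1]; exact h x y z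
  · have := congrArg (fun σ : Form 4 => σ ![x, y, z, w]) h
    simp only [extD_apply_bracket_four, h2] at this
    exact this
  · rw [extD_apply_bracket_four]; simp only [h2]; exact h x y z w
  · have := congrArg (fun σ : Form 4 => σ ![x, y, z, w]) h
    simp only [extD_apply_bracket_four, h3] at this
    exact this
  · rw [extD_apply_bracket_four]; simp only [h3]; exact h x y z w

/-! ### The action on brackets -/

theorem bracket_act (f : V ≃L[ℝ] V) (d : Hom12) (x y : V) :
    bracket (act f d) x y = f (bracket d (f.symm x) (f.symm y)) := by
  refine PiLp.ext fun i => ?_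
  have h := oneForm_bracket d ((coframe i).comp (f : V →L[ℝ] V)) (f.symm x) (f.symm y)
  rw [bracket_apply, act_apply]
  have h' : ((d ((coframe i).comp (f : V →L[ℝ] V))).compContinuousLinearMap
      (f.symm : V →L[ℝ] V)) ![x, y] =
      d ((coframe i).comp (f : V →L[ℝ] V)) ![f.symm x, f.symm y] := by
    rw [ContinuousAlternatingMap.compContinuousLinearMap_apply]
    congr 1
    ext j; fin_cases j <;> rfl
  rw [h', ← h]
  rfl

theorem jacobi_iff (d : Hom12) : (∀ α : OneForm, extD d (d α) = 0) ↔
    ∀ x y z, bracket d (bracket d x y) z - bracket d (bracket d x z) y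
      + bracket d (bracket d y z) x = 0 := by
  have key : ∀ (α : OneForm) x y z, extD d (d α) ![x, y, z] = α (bracket d (bracket d x y) z
      - bracket d (bracket d x z) y + bracket d (bracket d y z) x) := by
    intro α x y z
    rw [extD_apply_bracket, map_add, map_sub, oneForm_bracket, oneForm_bracket, oneForm_bracket]
    ring
  constructor
  · intro h x y z
    refine PiLp.ext fun i => ?_
    exact (key (coframe i) x y z).symm.trans (by rw [h]; rfl)
  · intro h α
    refine form_three_ext fun x y z => ?_
    rw [key, h, map_zero]; rfl

/-- The action of `GL(5, ℝ)` on `𝒟`. -/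
def actB (f : V ≃L[ℝ] V) (d : Brackets) : Brackets :=
  ⟨act f d.1, (jacobi_iff _).2 fun x y z => by
    have := (jacobi_iff d.1).1 d.2 (f.symm x) (f.symm y) (f.symm z)
    simp only [bracket_act, ContinuousLinearEquiv.symm_apply_apply, ← map_sub, ← map_add, this,
      map_zero]⟩

theorem act_symm_act (f : V ≃L[ℝ] V) (d : Hom12) : act f.symm (act f d) = d := by
  refine hom12_ext_bracket fun x y => ?_
  simp [bracket_act]

theorem mem_orbitGL_symm {d d' : Brackets} (h : d' ∈ orbitGL d) : d ∈ orbitGL d' := by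
  obtain ⟨f, hf⟩ := h
  exact ⟨f.symm, by rw [hf, act_symm_act]⟩

theorem mem_orbitGL_trans {d d' d'' : Brackets} (h : d' ∈ orbitGL d) (h' : d'' ∈ orbitGL d') :
    d'' ∈ orbitGL d := by
  obtain ⟨f, hf⟩ := h
  obtain ⟨g, hg⟩ := h'
  exact ⟨g * f, by rw [hg, hf, act_mul]⟩

theorem mem_orbitGL_iff {d d' : Brackets} :
    d' ∈ orbitGL d ↔ Nonempty (LieAlg d ≃ₗ⁅ℝ⁆ LieAlg d') := by
  constructor
  · rintro ⟨f, hf⟩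
    refine ⟨{ (f.toLinearEquiv : V ≃ₗ[ℝ] V) with map_lie' := ?_ }⟩
    intro x y
    have h : ∀ x y : V, f (bracket d.1 x y) = bracket d'.1 (f x) (f y) := fun x y => by
      rw [hf, bracket_act, f.symm_apply_apply, f.symm_apply_apply]
    exact h x y
  · rintro ⟨e⟩
    let f : V ≃L[ℝ] V := (show V ≃ₗ[ℝ] V from e.toLinearEquiv).toContinuousLinearEquiv
    refine ⟨f, hom12_ext_bracket fun x y => ?_⟩
    have h : f (bracket d.1 (f.symm x) (f.symm y)) =
        bracket d'.1 (f (f.symm x)) (f (f.symm y)) := e.map_lie (f.symm x) (f.symm y)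
    rw [bracket_act, h, f.apply_symm_apply, f.apply_symm_apply]

/-! ### The group `U(2)` in coordinates -/

/-- `f` acts on `ℂ² ⊕ ℝ` by the complex matrix `(p q; r s)` on the first summand, and trivially on
the second. -/
structure ActsBy (f : V → V) (p q r s : ℂ) : Prop where
  zero : ∀ x, f x 0 = p.re * x 0 - p.im * x 1 + q.re * x 2 - q.im * x 3
  one : ∀ x, f x 1 = p.im * x 0 + p.re * x 1 + q.im * x 2 + q.re * x 3
  two : ∀ x, f x 2 = r.re * x 0 - r.im * x 1 + s.re * x 2 - s.im * x 3
  three : ∀ x, f x 3 = r.im * x 0 + r.re * x 1 + s.im * x 2 + s.re * x 3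
  four : ∀ x, f x 4 = x 4

theorem exists_actsBy {f : V ≃ₗᵢ[ℝ] V} (hf : f ∈ U2) : ∃ p q r s, ActsBy f p q r s := by
  obtain ⟨hJ, h4⟩ := hf
  have h1 : f (basisVec 1) = J (f (basisVec 0)) := by
    rw [← hJ]; congr 1; ext i; fin_cases i <;> simp [J]
  have h3 : f (basisVec 3) = J (f (basisVec 2)) := by
    rw [← hJ]; congr 1; ext i; fin_cases i <;> simp [J]
  have h0 : -f (basisVec 0) = J (f (basisVec 1)) := by
    rw [← hJ, ← map_neg]; congr 1; ext i; fin_cases i <;> simp [J]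
  have h2 : -f (basisVec 2) = J (f (basisVec 3)) := by
    rw [← hJ, ← map_neg]; congr 1; ext i; fin_cases i <;> simp [J]
  have hx : ∀ x i, f x i = x 0 * f (basisVec 0) i + x 1 * J (f (basisVec 0)) i
      + x 2 * f (basisVec 2) i + x 3 * J (f (basisVec 2)) i + x 4 * basisVec 4 i := by
    intro x i
    conv_lhs => rw [vec_eq_sum x]
    rw [← h1, ← h3, ← h4]
    simp [Fin.sum_univ_five, -EuclideanSpace.basisFun_apply]
  -- The image of `J` has zero last coordinate, so a map commuting with `J` preserves ℂ².
  have h04 : f (basisVec 0) 4 = 0 := by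
    have := congrArg (fun v : V => v 4) h0
    simpa [J] using this
  have h24 : f (basisVec 2) 4 = 0 := by
    have := congrArg (fun v : V => v 4) h2
    simpa [J] using this
  refine ⟨⟨f (basisVec 0) 0, f (basisVec 0) 1⟩, ⟨f (basisVec 2) 0, f (basisVec 2) 1⟩,
    ⟨f (basisVec 0) 2, f (basisVec 0) 3⟩, ⟨f (basisVec 2) 2, f (basisVec 2) 3⟩, ?_⟩
  constructor <;> intro x <;> rw [hx] <;> simp [J, h04, h24] <;> ring

/-- The linear map of `ℂ² ⊕ ℝ` given by a complex matrix on the first summand. -/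
def complexMap (p q r s : ℂ) : V →ₗ[ℝ] V where
  toFun x := !₂[p.re * x 0 - p.im * x 1 + q.re * x 2 - q.im * x 3,
    p.im * x 0 + p.re * x 1 + q.im * x 2 + q.re * x 3,
    r.re * x 0 - r.im * x 1 + s.re * x 2 - s.im * x 3,
    r.im * x 0 + r.re * x 1 + s.im * x 2 + s.re * x 3, x 4]
  map_add' x y := by ext i; fin_cases i <;> simp <;> ring
  map_smul' c x := by ext i; fin_cases i <;> simp <;> ring

/-- The hypotheses say that the columns of the complex matrix are orthonormal: two norms, then the
real and imaginary parts of the hermitian product. -/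
theorem exists_mem_U2 (p q r s : ℂ) (h₁ : p.re ^ 2 + p.im ^ 2 + r.re ^ 2 + r.im ^ 2 = 1)
    (h₂ : q.re ^ 2 + q.im ^ 2 + s.re ^ 2 + s.im ^ 2 = 1)
    (h₃ : p.re * q.re + p.im * q.im + r.re * s.re + r.im * s.im = 0)
    (h₄ : p.re * q.im - p.im * q.re + r.re * s.im - r.im * s.re = 0) :
    ∃ f ∈ U2, ActsBy f p q r s := by
  let g : V →ₗᵢ[ℝ] V := ⟨complexMap p q r s, fun x => by
    rw [EuclideanSpace.norm_eq, EuclideanSpace.norm_eq]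
    congr 1
    simp only [Fin.sum_univ_five, Real.norm_eq_abs, sq_abs]
    simp [complexMap]
    linear_combination (x 0 ^ 2 + x 1 ^ 2) * h₁ + (x 2 ^ 2 + x 3 ^ 2) * h₂ +
      2 * (x 0 * x 2 + x 1 * x 3) * h₃ + 2 * (x 1 * x 2 - x 0 * x 3) * h₄⟩
  refine ⟨g.toLinearIsometryEquiv rfl, ⟨fun x => ?_, ?_⟩, ?_⟩
  · ext i; fin_cases i <;> simp [g, complexMap, J] <;> ring
  · ext i; fin_cases i <;> simp [g, complexMap]
  · constructor <;> intro x <;> simp [g, complexMap]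

/-- Transitivity of U(2) on the spheres of ℂ², with target the imaginary axis of the second
coordinate, that is the line of e₄. -/
theorem exists_U2_to_fourth (v : V) : ∃ f ∈ U2, ∃ r : ℝ,
    r ^ 2 = v 0 ^ 2 + v 1 ^ 2 + v 2 ^ 2 + v 3 ^ 2 ∧
    f v 0 = 0 ∧ f v 1 = 0 ∧ f v 2 = 0 ∧ f v 3 = r ∧ f v 4 = v 4 := by
  have hn : 0 ≤ v 0 ^ 2 + v 1 ^ 2 + v 2 ^ 2 + v 3 ^ 2 := by positivity
  obtain h0 | h0 := hn.eq_or_lt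
  · refine ⟨1, U2.one_mem, 0, by rw [← h0]; norm_num, ?_⟩
    change v 0 = 0 ∧ v 1 = 0 ∧ v 2 = 0 ∧ v 3 = 0 ∧ v 4 = v 4
    refine ⟨?_, ?_, ?_, ?_, rfl⟩ <;>
      nlinarith [sq_nonneg (v 0), sq_nonneg (v 1), sq_nonneg (v 2), sq_nonneg (v 3)]
  · set n := √(v 0 ^ 2 + v 1 ^ 2 + v 2 ^ 2 + v 3 ^ 2) with hnd
    have hn2 : n ^ 2 = v 0 ^ 2 + v 1 ^ 2 + v 2 ^ 2 + v 3 ^ 2 := Real.sq_sqrt hn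
    have hnp : n ≠ 0 := (Real.sqrt_pos.2 h0).ne'
    -- With z₁, z₂ the complex coordinates of `v`, the rows are (z₂, -z₁)/n, which kills `v`, and
    -- i(z̄₁, z̄₂)/n, which sends it to in.
    obtain ⟨f, hf, hA⟩ := exists_mem_U2 ⟨v 2 / n, v 3 / n⟩ ⟨-v 0 / n, -v 1 / n⟩
      ⟨v 1 / n, v 0 / n⟩ ⟨v 3 / n, v 2 / n⟩
      (by simp only; field_simp; linear_combination -hn2)
      (by simp only; field_simp; linear_combination -hn2)
      (by simp only; field_simp; ring) (by simp only; field_simp; ring)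
    refine ⟨f, hf, n, hn2, ?_, ?_, ?_, ?_, hA.four v⟩
    · rw [hA.zero]; simp only; field_simp; ring
    · rw [hA.one]; simp only; field_simp; ring
    · rw [hA.two]; simp only; field_simp; ring
    · rw [hA.three]; simp only; field_simp; linear_combination -hn2

/-- Multiplying the first complex coordinate by i z̄₁/|z₁| makes it imaginary. The rotation leaves
e₃, e₄ and e₅ fixed, so it does not disturb a normalization already made on those vectors. -/
theorem exists_U2_to_second (v : V) : ∃ f ∈ U2, f v 0 = 0 ∧
    ∃ c s : ℝ, c ^ 2 + s ^ 2 = 1 ∧ ActsBy f ⟨c, s⟩ 0 0 1 := by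
  have hn : 0 ≤ v 0 ^ 2 + v 1 ^ 2 := by positivity
  have key : ∃ c s : ℝ, c ^ 2 + s ^ 2 = 1 ∧ c * v 0 - s * v 1 = 0 := by
    obtain h0 | h0 := hn.eq_or_lt
    · refine ⟨1, 0, by norm_num, ?_⟩
      nlinarith [sq_nonneg (v 0), sq_nonneg (v 1)]
    · set n := √(v 0 ^ 2 + v 1 ^ 2) with hnd
      have hn2 : n ^ 2 = v 0 ^ 2 + v 1 ^ 2 := Real.sq_sqrt hn
      have hnp : n ≠ 0 := (Real.sqrt_pos.2 h0).ne'
      refine ⟨v 1 / n, v 0 / n, ?_, ?_⟩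
      · field_simp; linear_combination -hn2
      · ring
  obtain ⟨c, s, hcs, h0⟩ := key
  obtain ⟨f, hf, hA⟩ := exists_mem_U2 ⟨c, s⟩ 0 0 1 (by simpa using hcs) (by simp) (by simp)
    (by simp)
  refine ⟨f, hf, ?_, c, s, hcs, hA⟩
  rw [hA.zero]; simpa using h0

/-- `w₁` is the Kähler form ⟨J x, y⟩, and `f` is an isometry commuting with `J`. -/
theorem w₁_map {f : V ≃ₗᵢ[ℝ] V} (hf : f ∈ U2) (x y : V) : w₁ (f x) (f y) = w₁ x y := by
  have h : ∀ x y : V, w₁ x y = inner ℝ (J x) y := by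
    intro x y
    rw [EuclideanSpace.inner_eq_star_dotProduct]
    simp [dotProduct, Fin.sum_univ_five, J, w₁]
    ring
  rw [h, h, ← hf.1, f.inner_map_map]

/-- `w₂ + i w₃` is the complex volume form dz₁ ∧ dz₂, which is multiplied by the determinant; `a`
and `b` are the real and imaginary parts of that determinant. -/
theorem wedgeFive_map {f : V ≃ₗᵢ[ℝ] V} (hf : f ∈ U2) : ∃ a b : ℝ, ∀ x y z : V,
    wedgeFive w₂ (f x) (f y) (f z) = a * wedgeFive w₂ x y z - b * wedgeFive w₃ x y z ∧
    wedgeFive w₃ (f x) (f y) (f z) = b * wedgeFive w₂ x y z + a * wedgeFive w₃ x y z := by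
  obtain ⟨p, q, r, s, h⟩ := exists_actsBy hf
  refine ⟨(p * s - q * r).re, (p * s - q * r).im, fun x y z => ?_⟩
  simp only [wedgeFive, w₂, w₃, h.zero, h.one, h.two, h.three, h.four, Complex.sub_re,
    Complex.sub_im, Complex.mul_re, Complex.mul_im]
  constructor <;> ring

/-- The action of `U(2)` on `𝒟`. -/
abbrev actU (f : V ≃ₗᵢ[ℝ] V) (d : Brackets) : Brackets := actB f.toContinuousLinearEquiv d

theorem bracket_actU (f : V ≃ₗᵢ[ℝ] V) (d : Brackets) (x y : V) :
    bracket (actU f d).1 (f x) (f y) = f (bracket d.1 x y) := by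
  refine (bracket_act _ _ _ _).trans ?_
  change f (bracket d.1 (f.symm (f x)) (f.symm (f y))) = _
  rw [f.symm_apply_apply, f.symm_apply_apply]

theorem IsHypo.actU {f : V ≃ₗᵢ[ℝ] V} (hf : f ∈ U2) {d : Brackets} (h : IsHypo d) :
    IsHypo (actU f d) := by
  rw [isHypo_iff] at h ⊢
  obtain ⟨h1, h2, h3⟩ := h
  obtain ⟨a, b, hab⟩ := wedgeFive_map hf
  refine ⟨fun x y z => ?_, fun x y z w => ?_, fun x y z w => ?_⟩
  · obtain ⟨x, rfl⟩ := f.surjective x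
    obtain ⟨y, rfl⟩ := f.surjective y
    obtain ⟨z, rfl⟩ := f.surjective z
    simp only [dTwo, bracket_actU, w₁_map hf]
    exact h1 x y z
  all_goals
    obtain ⟨x, rfl⟩ := f.surjective x
    obtain ⟨y, rfl⟩ := f.surjective y
    obtain ⟨z, rfl⟩ := f.surjective z
    obtain ⟨w, rfl⟩ := f.surjective w
    have h2' := h2 x y z w
    have h3' := h3 x y z w
    simp only [dThree, bracket_actU, fun x y z => (hab x y z).1, fun x y z => (hab x y z).2]
      at h2' h3' ⊢
  · linear_combination a * h2' - b * h3'
  · linear_combination b * h2' + a * h3'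

theorem actU_inv_actU (f : V ≃ₗᵢ[ℝ] V) (d : Brackets) : actU f⁻¹ (actU f d) = d := by
  refine Subtype.ext (hom12_ext_bracket fun x y => ?_)
  have h1 := bracket_actU f⁻¹ (actU f d) (f x) (f y)
  rw [bracket_actU f d] at h1
  have h : ∀ x, f⁻¹ (f x) = x := fun x => f.symm_apply_apply x
  rwa [h, h, h] at h1

theorem actU_mem_orbitGL (f : V ≃ₗᵢ[ℝ] V) (d : Brackets) : actU f d ∈ orbitGL d := ⟨_, rfl⟩

theorem IsHypo.of_actU {f : V ≃ₗᵢ[ℝ] V} (hf : f ∈ U2) {d : Brackets} (h : IsHypo (HypoLie.actU f d)) :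
    IsHypo d := by
  have := h.actU (U2.inv_mem hf)
  rwa [actU_inv_actU] at this

/-! ### Nilpotency -/

theorem isNilpotent_of_mem_orbitGL {d d' : Brackets} (h : d' ∈ orbitGL d)
    (hd : LieRing.IsNilpotent (LieAlg d)) : LieRing.IsNilpotent (LieAlg d') := by
  obtain ⟨e⟩ := mem_orbitGL_iff.1 h
  exact (LieEquiv.nilpotent_iff_equiv_nilpotent e).1 hd

/-- In a nilpotent Lie algebra, a subset stable under brackets that is not contained in `W ∋ 0` has
an element outside `W` which is central modulo `W`. -/
theorem exists_bracket_mem {d : Brackets} (hd : LieRing.IsNilpotent (LieAlg d)) {N W : Set V}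
    (hN : ∀ x y, y ∈ N → bracket d.1 x y ∈ N) (hW : (0 : V) ∈ W) (hNW : ¬ N ⊆ W) :
    ∃ x ∈ N, x ∉ W ∧ ∀ y, bracket d.1 y x ∈ W := by
  by_contra! hcon
  obtain ⟨k, hk⟩ := (LieModule.isNilpotent_iff ℝ (LieAlg d) (LieAlg d)).1 hd
  -- Under the negated conclusion, an element of `N` outside `W` always has a bracket that is again
  -- in `N` and outside `W`; iterating reaches every term of the lower central series.
  have key : ∀ k, ∃ x : LieAlg d, x ∈ N ∧ x ∉ W ∧
      x ∈ LieModule.lowerCentralSeries ℝ (LieAlg d) (LieAlg d) k := by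
    intro k
    induction k with
    | zero =>
      obtain ⟨x, hx, hx'⟩ := Set.not_subset.1 hNW
      exact ⟨x, hx, hx', LieSubmodule.mem_top _⟩
    | succ k ih =>
      obtain ⟨x, hx, hx', hxk⟩ := ih
      obtain ⟨y, hy⟩ := hcon x hx hx'
      refine ⟨(bracket d.1 y x : V), hN y x hx, hy, ?_⟩
      rw [LieModule.lowerCentralSeries_succ]
      exact LieSubmodule.lie_mem_lie (LieSubmodule.mem_top (R := ℝ) (show LieAlg d from y)) hxk
  obtain ⟨x, -, hx, hxk⟩ := key k
  rw [hk, LieSubmodule.mem_bot] at hxk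
  exact hx (hxk ▸ hW)

/-- Nilpotent Lie algebras are unimodular: each ad is a nilpotent endomorphism, hence traceless. -/
theorem coef_trace {d : Brackets} (hd : LieRing.IsNilpotent (LieAlg d)) (j : Fin 5) :
    ∑ i, coef d.1 i j i = 0 := by
  let b : Module.Basis (Fin 5) ℝ (LieAlg d) := (EuclideanSpace.basisFun (Fin 5) ℝ).toBasis
  have h1 : IsNilpotent (LieAlgebra.ad ℝ (LieAlg d) (b j)) :=
    LieModule.isNilpotent_toEnd_of_isNilpotent ℝ (LieAlg d) (LieAlg d) (b j)
  have h2 := (LinearMap.isNilpotent_trace_of_isNilpotent h1).eq_zero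
  rw [LinearMap.trace_eq_matrix_trace ℝ b, Matrix.trace] at h2
  have hb : ∀ i, b i = basisVec i := fun i => by
    change (EuclideanSpace.basisFun (Fin 5) ℝ).toBasis i = basisVec i
    rw [OrthonormalBasis.coe_toBasis, EuclideanSpace.basisFun_apply]
  have h3 : ∀ i, (LinearMap.toMatrix b b (LieAlgebra.ad ℝ (LieAlg d) (b j))).diag i =
      -coef d.1 i j i := by
    intro i
    rw [Matrix.diag_apply, LinearMap.toMatrix_apply, ← bracket_basis, ← hb, ← hb]
    rfl
  simp only [h3, Finset.sum_neg_distrib, neg_eq_zero] at h2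
  exact h2

theorem bracket_eq_zero_of_triangular {d : Hom12}
    (h : ∀ i j k : Fin 5, i ≤ k → coef d i j k = 0) {k : ℕ} {x y : V}
    (hy : ∀ i : Fin 5, (i : ℕ) < k → y i = 0) (i : Fin 5) (hi : (i : ℕ) < k + 1) :
    bracket d x y i = 0 := by
  rw [bracket_apply, twoForm_apply, neg_eq_zero]
  refine Finset.sum_eq_zero fun a _ => Finset.sum_eq_zero fun b _ => ?_
  obtain hb | hb := le_or_gt i b
  · have := h i a b hb
    rw [coef] at this
    rw [this, zero_mul]
  · rw [hy b (lt_of_lt_of_le hb (Nat.lt_succ_iff.1 hi)), mul_zero, mul_zero]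

/-- The vectors whose first `k` components vanish. -/
def tailSpace (k : ℕ) : Submodule ℝ V where
  carrier := {x | ∀ i : Fin 5, (i : ℕ) < k → x i = 0}
  add_mem' := fun {x y} hx hy i hi => by
    rw [PiLp.add_apply, hx i hi, hy i hi, add_zero]
  zero_mem' := fun i _ => rfl
  smul_mem' := fun c x hx i hi => by
    rw [PiLp.smul_apply, hx i hi, smul_zero]

/-- Each deⁱ involves only earlier one-forms, so a bracket gains one more vanishing leading
component. The spaces `tailSpace k` are ideals that dominate the lower central series and vanish at
k = 5. -/
theorem isNilpotent_of_triangular {d : Brackets}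
    (h : ∀ i j k : Fin 5, i ≤ k → coef d.1 i j k = 0) : LieRing.IsNilpotent (LieAlg d) := by
  let F : ℕ → LieIdeal ℝ (LieAlg d) := fun k =>
    { (show Submodule ℝ (LieAlg d) from tailSpace k) with
      lie_mem := fun {x y} hy i hi =>
        bracket_eq_zero_of_triangular (x := x) h hy i (Nat.lt_succ_of_lt hi) }
  refine (LieModule.isNilpotent_iff ℝ (LieAlg d) (LieAlg d)).2 ⟨5, ?_⟩
  have key : ∀ k, LieModule.lowerCentralSeries ℝ (LieAlg d) (LieAlg d) k ≤ F k := by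
    intro k
    induction k with
    | zero => exact fun x _ i hi => absurd hi (Nat.not_lt_zero _)
    | succ k ih =>
      rw [LieModule.lowerCentralSeries_succ, LieSubmodule.lie_le_iff]
      exact fun x _ y hy i hi => bracket_eq_zero_of_triangular (x := x) h (ih hy) i hi
  refine (LieSubmodule.eq_bot_iff _).2 fun x hx => ?_
  exact PiLp.ext fun i => key 5 hx i i.2

/-! ### Hypo structures in coordinates -/

/-- The equations satisfied by the structure constants of a hypo structure. -/
structure HypoCoef (c : Fin 5 → Fin 5 → Fin 5 → ℝ) : Prop where
  -- In a field name, the digit after `w` selects one of the three closed forms, and the final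
  -- digits are the basis vectors on which its differential is evaluated.
  w1_012 : -c 0 0 2 - c 1 1 2 - c 3 0 1 = 0
  w1_013 : -c 0 0 3 - c 1 1 3 + c 2 0 1 = 0
  w1_014 : -c 0 0 4 - c 1 1 4 = 0
  w1_023 : -c 1 2 3 + c 2 0 2 + c 3 0 3 = 0
  w1_024 : -c 1 2 4 + c 3 0 4 = 0
  w1_034 : -c 1 3 4 - c 2 0 4 = 0
  w1_123 : c 0 2 3 + c 2 1 2 + c 3 1 3 = 0
  w1_124 : c 0 2 4 + c 3 1 4 = 0
  w1_134 : c 0 3 4 - c 2 1 4 = 0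
  w1_234 : -c 2 2 4 - c 3 3 4 = 0
  w2_0123 : c 4 0 2 - c 4 1 3 = 0
  w2_0124 : c 0 0 1 - c 2 1 2 - c 3 0 2 - c 4 1 4 = 0
  w2_0134 : -c 1 0 1 - c 2 1 3 - c 3 0 3 - c 4 0 4 = 0
  w2_0234 : -c 0 0 3 - c 1 0 2 - c 2 2 3 + c 4 3 4 = 0
  w2_1234 : -c 0 1 3 - c 1 1 2 + c 3 2 3 + c 4 2 4 = 0
  w3_0123 : c 4 0 3 + c 4 1 2 = 0
  w3_0124 : c 1 0 1 + c 2 0 2 - c 3 1 2 + c 4 0 4 = 0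
  w3_0134 : c 0 0 1 + c 2 0 3 - c 3 1 3 - c 4 1 4 = 0
  w3_0234 : c 0 0 2 - c 1 0 3 - c 3 2 3 - c 4 2 4 = 0
  w3_1234 : c 0 1 2 - c 1 1 3 - c 2 2 3 + c 4 3 4 = 0

theorem IsHypo.hypoCoef {d : Brackets} (h : IsHypo d) : HypoCoef (coef d.1) := by
  obtain ⟨h1, h2, h3⟩ := (isHypo_iff d).1 h
  constructor
  · have := h1 (basisVec 0) (basisVec 1) (basisVec 2)
    simp [dTwo, w₁, bracket_basis] at this
    linarith
  · have := h1 (basisVec 0) (basisVec 1) (basisVec 3)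
    simp [dTwo, w₁, bracket_basis] at this
    linarith
  · have := h1 (basisVec 0) (basisVec 1) (basisVec 4)
    simp [dTwo, w₁, bracket_basis] at this
    linarith
  · have := h1 (basisVec 0) (basisVec 2) (basisVec 3)
    simp [dTwo, w₁, bracket_basis] at this
    linarith
  · have := h1 (basisVec 0) (basisVec 2) (basisVec 4)
    simp [dTwo, w₁, bracket_basis] at this
    linarith
  · have := h1 (basisVec 0) (basisVec 3) (basisVec 4)
    simp [dTwo, w₁, bracket_basis] at this
    linarith
  · have := h1 (basisVec 1) (basisVec 2) (basisVec 3)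
    simp [dTwo, w₁, bracket_basis] at this
    linarith
  · have := h1 (basisVec 1) (basisVec 2) (basisVec 4)
    simp [dTwo, w₁, bracket_basis] at this
    linarith
  · have := h1 (basisVec 1) (basisVec 3) (basisVec 4)
    simp [dTwo, w₁, bracket_basis] at this
    linarith
  · have := h1 (basisVec 2) (basisVec 3) (basisVec 4)
    simp [dTwo, w₁, bracket_basis] at this
    linarith
  · have := h2 (basisVec 0) (basisVec 1) (basisVec 2) (basisVec 3)
    simp [dThree, wedgeFive, w₂, bracket_basis] at this
    linarith
  · have := h2 (basisVec 0) (basisVec 1) (basisVec 2) (basisVec 4)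
    simp [dThree, wedgeFive, w₂, bracket_basis] at this
    linarith
  · have := h2 (basisVec 0) (basisVec 1) (basisVec 3) (basisVec 4)
    simp [dThree, wedgeFive, w₂, bracket_basis] at this
    linarith
  · have := h2 (basisVec 0) (basisVec 2) (basisVec 3) (basisVec 4)
    simp [dThree, wedgeFive, w₂, bracket_basis] at this
    linarith
  · have := h2 (basisVec 1) (basisVec 2) (basisVec 3) (basisVec 4)
    simp [dThree, wedgeFive, w₂, bracket_basis] at this
    linarith
  · have := h3 (basisVec 0) (basisVec 1) (basisVec 2) (basisVec 3)
    simp [dThree, wedgeFive, w₃, bracket_basis] at this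
    linarith
  · have := h3 (basisVec 0) (basisVec 1) (basisVec 2) (basisVec 4)
    simp [dThree, wedgeFive, w₃, bracket_basis] at this
    linarith
  · have := h3 (basisVec 0) (basisVec 1) (basisVec 3) (basisVec 4)
    simp [dThree, wedgeFive, w₃, bracket_basis] at this
    linarith
  · have := h3 (basisVec 0) (basisVec 2) (basisVec 3) (basisVec 4)
    simp [dThree, wedgeFive, w₃, bracket_basis] at this
    linarith
  · have := h3 (basisVec 1) (basisVec 2) (basisVec 3) (basisVec 4)
    simp [dThree, wedgeFive, w₃, bracket_basis] at this
    linarith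

theorem hom12_ext_coframe {d d' : Hom12}
    (h : ∀ i x y, d (coframe i) ![x, y] = d' (coframe i) ![x, y]) : d = d' :=
  hom12_ext_bracket fun x y => PiLp.ext fun i => by rw [bracket_apply, bracket_apply, h]

/-! ### Membership in the families, read off from the structure constants -/

theorem rank_lt_two_of_rows {M : Matrix (Fin 2) (Fin 4) ℝ} (p q : ℝ) (hpq : p ≠ 0 ∨ q ≠ 0)
    (h : ∀ j, p * M 0 j + q * M 1 j = 0) : M.rank < 2 := by
  by_contra hr
  have hr' : M.rank = Fintype.card (Fin 2) := le_antisymm (Matrix.rank_le_card_height M)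
    (by rw [Fintype.card_fin]; omega)
  have hli : LinearIndependent ℝ M.row := by
    rw [linearIndependent_iff_card_eq_finrank_span, ← hr', Matrix.rank_eq_finrank_span_row]
    rfl
  have := Fintype.linearIndependent_iff.1 hli ![p, q] (by
    ext j
    simpa [Fin.sum_univ_two] using h j)
  have h0 := this 0
  have h1 := this 1
  simp at h0 h1
  tauto

/-- The listed triples are the monomials that occur in ℳ₁; the two equations are the coincidences
among their coefficients. -/
theorem mem_family₁_of_coef {d : Hom12} (h : ∀ i j k : Fin 5, j < k →
    (i, j, k) ∉ ({(0, 2, 4), (1, 2, 4), (1, 0, 4), (3, 1, 4), (3, 0, 4), (3, 2, 4)} :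
      Finset (Fin 5 × Fin 5 × Fin 5)) → coef d i j k = 0)
    (h₁ : coef d 3 1 4 = -coef d 0 2 4) (h₂ : coef d 3 0 4 = coef d 1 2 4) : d ∈ family₁ := by
  refine ⟨coef d 0 2 4, coef d 3 2 4, coef d 1 2 4, coef d 1 0 4, hom12_ext_coframe ?_⟩
  intro i x y
  rw [hom12_apply_coframe, ofTuple_coframe]
  fin_cases i <;>
    simp (disch := decide) [twoFormVal, h, h₁, h₂, wedgeTwo_apply, -mul_eq_mul_left_iff] <;> ring

/-- The pair (p, q) witnesses the rank condition: `g₁` to `g₄` say that p times the first row plus q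
times the second vanishes, with y, h and m equal to minus the corresponding structure constants. -/
theorem mem_family₂_of_coef {d : Hom12} (h : ∀ i j k : Fin 5, j < k →
    (i, j, k) ∉ ({(1, 2, 3), (1, 2, 4), (3, 0, 3), (3, 1, 2), (3, 2, 3), (3, 0, 4), (3, 2, 4),
      (4, 0, 3), (4, 1, 2), (4, 2, 3), (4, 0, 4), (4, 2, 4)} :
      Finset (Fin 5 × Fin 5 × Fin 5)) → coef d i j k = 0)
    (h₁ : coef d 3 0 3 = coef d 1 2 3) (h₂ : coef d 3 1 2 = -coef d 1 2 3)
    (h₃ : coef d 3 0 4 = coef d 1 2 4) (h₄ : coef d 4 1 2 = -coef d 4 0 3)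
    (h₅ : coef d 4 0 4 = -coef d 1 2 3) (h₆ : coef d 4 2 4 = -coef d 3 2 3)
    (p q : ℝ) (hpq : p ≠ 0 ∨ q ≠ 0) (g₁ : p * coef d 1 2 3 = q * coef d 4 0 3)
    (g₂ : p * coef d 3 2 3 = q * coef d 4 2 3) (g₃ : p * coef d 1 2 4 = -(q * coef d 1 2 3))
    (g₄ : p * coef d 3 2 4 = -(q * coef d 3 2 3)) : d ∈ family₂ := by
  refine ⟨coef d 1 2 3, -coef d 3 2 3, -coef d 4 0 3, coef d 4 2 3, coef d 1 2 4, -coef d 3 2 4,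
    rank_lt_two_of_rows p q hpq ?_, hom12_ext_coframe ?_⟩
  · intro j
    fin_cases j <;> simp <;> linarith
  · intro i x y
    rw [hom12_apply_coframe, ofTuple_coframe]
    fin_cases i <;>
      simp (disch := decide) [twoFormVal, h, h₁, h₂, h₃, h₄, h₅, h₆, wedgeTwo_apply,
        -mul_eq_mul_left_iff] <;> ring

theorem mem_family₃_of_coef {d : Hom12} (h : ∀ i j k : Fin 5, j < k →
    (i, j, k) ∉ ({(4, 0, 1), (4, 2, 3)} : Finset (Fin 5 × Fin 5 × Fin 5)) → coef d i j k = 0) :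
    d ∈ family₃ := by
  refine ⟨(coef d 4 0 1 + coef d 4 2 3) / 2, (coef d 4 0 1 - coef d 4 2 3) / 2,
    hom12_ext_coframe ?_⟩
  intro i x y
  rw [hom12_apply_coframe, ofTuple_coframe]
  fin_cases i <;>
    simp (disch := decide) [twoFormVal, h, wedgeTwo_apply] <;> ring

/-! ### Hypo structures with a central vector transverse to `ℝ` -/

/-- The structure constants of a unimodular hypo structure with central vector `e₄ + t e₅`. -/
structure CentralForm (c : Fin 5 → Fin 5 → Fin 5 → ℝ) (t A B C q y u v s m : ℝ) : Prop where
  swap : ∀ i j k, c i k j = -c i j k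
  col : ∀ i j, c i j 3 = -(t * c i j 4)
  row2 : ∀ j k, c 2 j k = 0
  c001 : c 0 0 1 = -v
  c002 : c 0 0 2 = -(t * B)
  c012 : c 0 1 2 = t * A
  c004 : c 0 0 4 = A
  c014 : c 0 1 4 = B
  c024 : c 0 2 4 = q
  c101 : c 1 0 1 = u
  c102 : c 1 0 2 = t * A
  c112 : c 1 1 2 = t * C
  c104 : c 1 0 4 = C
  c114 : c 1 1 4 = -A
  c124 : c 1 2 4 = y
  c301 : c 3 0 1 = t * (B - C)
  c302 : c 3 0 2 = t * q
  c312 : c 3 1 2 = t * y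
  c304 : c 3 0 4 = y
  c314 : c 3 1 4 = -q
  c324 : c 3 2 4 = m
  c401 : c 4 0 1 = t * (t * (B - C)) - s
  c402 : c 4 0 2 = t * (t * q) + t * v
  c412 : c 4 1 2 = t * (t * y) - t * u
  c404 : c 4 0 4 = t * y - u
  c414 : c 4 1 4 = -(t * q) - v
  c424 : c 4 2 4 = t * m - t * (B - C)

/-- For a fixed t this is linear algebra. Centrality of e₄ + t e₅ eliminates the components along
e₄, the hypo equations give de³ = 0, and nine parameters remain. The quadratic Jacobi identity is
not needed here. -/
theorem CentralForm.of_hypoCoef {d : Hom12} {t : ℝ} (hn : ∀ j, ∑ i, coef d i j i = 0)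
    (hh : HypoCoef (coef d)) (hξ : ∀ i j, coef d i j 3 = -(t * coef d i j 4)) :
    ∃ A B C q y u v s m, CentralForm (coef d) t A B C q y u v s m := by
  obtain ⟨a1, a2, a3, a4, a5, a6, a7, a8, a9, a10, a11, a12, a13, a14, a15, a16, a17, a18, a19,
    a20⟩ := hh
  have hs := coef_swap d
  have hd := coef_self d
  generalize coef d = c at *
  -- Since e₄ + t e₅ is central, [e₄, e₅] = [e₄ + t e₅, e₅] = 0.
  have h34 : ∀ i, c i 3 4 = 0 := fun i => by
    have h1 := hξ i 4
    have h2 := hs i 4 3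
    rw [hd i 4] at h1
    linarith
  have h03 := fun i => hξ i 0
  have h13 := fun i => hξ i 1
  have h23 := fun i => hξ i 2
  simp only [h03, h13, h23, h34] at a2 a4 a6 a7 a9 a10 a11 a13 a14 a15 a16 a18 a19 a20
  have z204 : c 2 0 4 = 0 := by linarith
  have z214 : c 2 1 4 = 0 := by linarith
  have z224 : c 2 2 4 = 0 := by linarith
  have z201 : c 2 0 1 = 0 := by linear_combination a2 + t * a3
  have z202 : c 2 0 2 = 0 := by linear_combination a4 + t * a5
  have z212 : c 2 1 2 = 0 := by linear_combination a7 + t * a8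
  -- The trace of ad e₃ supplies the equation needed to determine `c 0 0 2`, `c 1 1 2` and `c 4 2
  -- 4`.
  have n2 := hn 2
  rw [Fin.sum_univ_five, hs 0 0 2, hs 1 1 2, hd, h23 3] at n2
  have row2 : ∀ j k, c 2 j k = 0 := by
    have key : ∀ j k, j < k → c 2 j k = 0 := by
      intro j k hjk
      fin_cases j <;> fin_cases k <;> simp at hjk ⊢ <;>
        first
        | assumption
        | simp [h03, h13, h23, h34, z204, z214, z224]
    intro j k
    rcases lt_trichotomy j k with h | h | h
    · exact key j k h
    · rw [h, hd]
    · rw [hs, key k j h, neg_zero]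
  refine ⟨c 0 0 4, c 0 1 4, c 1 0 4, c 0 2 4, c 1 2 4, c 1 0 1, -c 0 0 1,
    t * (t * (c 0 1 4 - c 1 0 4)) - c 4 0 1, c 3 2 4, ?_⟩
  simp only [z204, z214, z224, mul_zero] at a13 a14 a18 a20
  have t3 : t * c 1 1 4 = -(t * c 0 0 4) := by linear_combination -t * a3
  have t5 : t * c 3 0 4 = t * c 1 2 4 := by linear_combination t * a5
  have t8 : t * c 3 1 4 = -(t * c 0 2 4) := by linear_combination t * a8
  have e414 : c 4 1 4 = c 0 0 1 - t * c 0 2 4 := by linarith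
  have e404 : c 4 0 4 = t * c 1 2 4 - c 1 0 1 := by linarith
  have e424 : c 4 2 4 = t * c 3 2 4 - t * (c 0 1 4 - c 1 0 4) := by linarith
  constructor
  · exact hs
  · exact hξ
  · exact row2
  all_goals try rw [e414] at a11
  all_goals try rw [e404] at a16
  all_goals linarith

theorem CentralForm.mem_family₁ {d : Hom12} {q y C m : ℝ}
    (h : CentralForm (coef d) 0 0 0 C q y 0 0 0 m) : d ∈ family₁ := by
  obtain ⟨hs, hξ, h2, c001, c002, c012, c004, c014, c024, c101, c102, c112, c104, c114, c124,
    c301, c302, c312, c304, c314, c324, c401, c402, c412, c404, c414, c424⟩ := h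
  refine mem_family₁_of_coef ?_ (by rw [c314, c024]) (by rw [c304, c124])
  have h34 : ∀ i, coef d i 3 4 = 0 := fun i => by rw [hs, hξ, coef_self]; ring
  intro i j k hjk hn
  fin_cases i <;> fin_cases j <;> fin_cases k <;> simp at hjk hn ⊢ <;>
    simp [hξ, h34, h2, c001, c002, c012, c004, c014, c101, c102, c112, c114, c301, c302, c312,
      c401, c402, c412, c404, c414, c424]

theorem CentralForm.mem_family₂ {d : Hom12} {t y m : ℝ}
    (h : CentralForm (coef d) t 0 0 0 0 y 0 0 0 m) : d ∈ family₂ := by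
  obtain ⟨hs, hξ, h2, c001, c002, c012, c004, c014, c024, c101, c102, c112, c104, c114, c124,
    c301, c302, c312, c304, c314, c324, c401, c402, c412, c404, c414, c424⟩ := h
  have h34 : ∀ i, coef d i 3 4 = 0 := fun i => by rw [hs, hξ, coef_self]; ring
  -- The row relation has coefficients t and 1: it expresses that e₄ + t e₅ is central.
  refine mem_family₂_of_coef ?_ (by rw [hξ, hξ, c304, c124])
    (by rw [hξ, c312, c124]; ring) (by rw [c304, c124]) (by rw [hξ, c412, c404]; ring)
    (by rw [hξ, c404, c124]; ring) (by rw [hξ, c424, c324]; ring) t 1 (Or.inr one_ne_zero)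
    (by rw [hξ, hξ, c404, c124]; ring) (by rw [hξ, hξ, c424, c324]; ring)
    (by rw [hξ, c124]; ring) (by rw [hξ, c324]; ring)
  intro i j k hjk hn
  fin_cases i <;> fin_cases j <;> fin_cases k <;> simp at hjk hn ⊢ <;>
    simp [hξ, h34, h2, c001, c002, c012, c004, c014, c024, c101, c102, c112, c104, c114, c301,
      c302, c314, c401, c402, c414]

/-- A point of `𝒟` with central vector `e₄ + t e₅` on which closed one-forms vanish, and with a
vector `x` in the kernel of `e³` which is central modulo the first one. -/
structure CentralPair (d : Brackets) (t : ℝ) (x : V) : Prop where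
  hypo : IsHypo d
  nilpotent : LieRing.IsNilpotent (LieAlg d)
  central : ∀ y, bracket d.1 y (basisVec 3 + t • basisVec 4) = 0
  closed : ∀ α, d.1 α = 0 → α (basisVec 3 + t • basisVec 4) = 0
  two : x 2 = 0
  notMem : ∀ r : ℝ, x ≠ r • (basisVec 3 + t • basisVec 4)
  central_mod : ∀ y, ∃ r : ℝ, bracket d.1 y x = r • (basisVec 3 + t • basisVec 4)

/-! ### Equations satisfied by the second vector -/

theorem central_coef {d : Hom12} {t : ℝ}
    (h : ∀ x, bracket d x (basisVec 3 + t • basisVec 4) = 0) (i j : Fin 5) :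
    coef d i j 3 = -(t * coef d i j 4) := by
  have := congrArg (fun v : V => v i) (h (basisVec j))
  simp only [bracket_add_right, bracket_smul_right, PiLp.add_apply, PiLp.smul_apply,
    bracket_basis, PiLp.zero_apply, smul_eq_mul] at this
  linarith

theorem bracket_basis_left (d : Hom12) (i j : Fin 5) (x : V) :
    bracket d (basisVec j) x i = -∑ k, x k * coef d i j k := by
  rw [bracket_skew, PiLp.neg_apply, bracket_apply, twoForm_apply_left, neg_neg,
    ← Finset.sum_neg_distrib]
  refine Finset.sum_congr rfl fun k _ => ?_
  rw [← coef, coef_swap]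
  ring

theorem CentralPair.form {d : Brackets} {t : ℝ} {x : V} (h : CentralPair d t x) :
    ∃ A B C q y u v s m, CentralForm (coef d.1) t A B C q y u v s m :=
  CentralForm.of_hypoCoef (coef_trace h.nilpotent) h.hypo.hypoCoef (central_coef h.central)

/-- The equations expressing that `x` is central modulo `e₄ + t e₅`. -/
theorem CentralPair.coef_eq {d : Brackets} {t : ℝ} {x : V} (h : CentralPair d t x) (j : Fin 5) :
    (∑ k, x k * coef d.1 0 j k = 0) ∧ (∑ k, x k * coef d.1 1 j k = 0) ∧
      ∑ k, x k * coef d.1 4 j k = t * ∑ k, x k * coef d.1 3 j k := by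
  obtain ⟨r, hr⟩ := h.central_mod (basisVec j)
  have h' : ∀ i, -∑ k, x k * coef d.1 i j k = (r • (basisVec 3 + t • basisVec 4)) i := by
    intro i
    rw [← hr, bracket_basis_left]
  have h0 := h' 0
  have h1 := h' 1
  have h3 := h' 3
  have h4 := h' 4
  generalize ∑ k, x k * coef d.1 0 j k = s0 at *
  generalize ∑ k, x k * coef d.1 1 j k = s1 at *
  generalize ∑ k, x k * coef d.1 3 j k = s3 at *
  generalize ∑ k, x k * coef d.1 4 j k = s4 at *
  simp at h0 h1 h3 h4
  refine ⟨h0, h1, ?_⟩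
  linear_combination -h4 + t * h3

/-- Modulo e₄ + t e₅, the vector x is determined by x₀, x₁ and x₄ - t x₃, since x₂ = 0. Only these
three combinations enter the equations. -/
theorem CentralPair.coef_eq' {d : Brackets} {t : ℝ} {x : V} (h : CentralPair d t x) (j : Fin 5) :
    (x 0 * coef d.1 0 j 0 + x 1 * coef d.1 0 j 1 + (x 4 - t * x 3) * coef d.1 0 j 4 = 0) ∧
    (x 0 * coef d.1 1 j 0 + x 1 * coef d.1 1 j 1 + (x 4 - t * x 3) * coef d.1 1 j 4 = 0) ∧
    (x 0 * (coef d.1 4 j 0 - t * coef d.1 3 j 0) + x 1 * (coef d.1 4 j 1 - t * coef d.1 3 j 1) +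
      (x 4 - t * x 3) * (coef d.1 4 j 4 - t * coef d.1 3 j 4) = 0) := by
  have hs := central_coef h.central
  obtain ⟨h0, h1, h2⟩ := h.coef_eq j
  simp only [Fin.sum_univ_five, hs, h.two] at h0 h1 h2
  refine ⟨?_, ?_, ?_⟩
  · linear_combination h0
  · linear_combination h1
  · linear_combination h2

theorem CentralPair.ne_zero {d : Brackets} {t : ℝ} {x : V} (h : CentralPair d t x) :
    x 0 ≠ 0 ∨ x 1 ≠ 0 ∨ x 4 - t * x 3 ≠ 0 := by
  by_contra! hx
  obtain ⟨h0, h1, h2⟩ := hx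
  refine h.notMem (x 3) ?_
  ext i
  fin_cases i <;> simp [h0, h1, h.two]
  linear_combination h2

/-- Here the central vector is e₄ and x is a nonzero multiple of e₂ modulo it. Hence e₂ is central
modulo e₄, which kills all parameters except C, q, y and m. -/
theorem CentralPair.mem_family₁ {d : Brackets} {x : V} (h : CentralPair d 0 x) (hx0 : x 0 = 0)
    (hx4 : x 4 = 0) : d.1 ∈ family₁ := by
  have hx1 : x 1 ≠ 0 := by
    have := h.ne_zero
    simpa [hx0, hx4] using this
  obtain ⟨A, B, C, q, y, u, v, s, m, hc⟩ := h.form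
  have e0 := h.coef_eq' 0
  have e4 := h.coef_eq' 4
  simp only [hx0, hx4, zero_mul, zero_add, sub_zero, add_zero, mul_eq_zero, hx1, false_or,
    hc.swap _ 1 4, hc.c001, hc.c014, hc.c101, hc.c401, hc.c114] at e0 e4
  obtain ⟨h1, h2, h3⟩ := e0
  obtain ⟨h4, h5, -⟩ := e4
  obtain rfl : B = 0 := by linarith
  obtain rfl : A = 0 := by linarith
  obtain rfl : v = 0 := by linarith
  obtain rfl : u = 0 := by linarith
  obtain rfl : s = 0 := by linarith
  exact hc.mem_family₁

/-- Modulo the central vector, x lies in the plane of e₁ and e₂. Its brackets with e₁ and e₂ kill u,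
v and s. Those with e₃ and e₅ give a linear system for A, B, C with only the zero solution, and this
is where division by t is needed. -/
theorem CentralPair.mem_family₂_of_ne {d : Brackets} {t : ℝ} {x : V} (h : CentralPair d t x)
    (ht : t ≠ 0) (hx4 : x 4 - t * x 3 = 0) (hq : coef d.1 0 2 4 = 0) : d.1 ∈ family₂ := by
  have hx := h.ne_zero
  obtain ⟨A, B, C, q, y, u, v, s, m, hc⟩ := h.form
  obtain ⟨a0, b0, c0⟩ := h.coef_eq' 0
  obtain ⟨a1, b1, c1⟩ := h.coef_eq' 1
  obtain ⟨a4, b4, -⟩ := h.coef_eq' 4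
  simp only [hx4, ne_eq, not_true_eq_false, or_false] at hx
  have hd := coef_self d.1
  simp only [hx4, zero_mul, add_zero, hc.swap _ 1 4, hc.swap _ 0 4, hc.swap _ 0 1, hc.c001,
    hc.c014, hc.c101, hc.c401, hc.c301, hc.c114, hc.c004, hc.c104, hd] at a0 b0 c0 a1 b1 c1 a4 b4
  rw [hc.c024] at hq
  have hn : x 0 ^ 2 + x 1 ^ 2 ≠ 0 := by
    intro h0
    rcases hx with h | h <;> exact h (by nlinarith [sq_nonneg (x 0), sq_nonneg (x 1)])
  -- Working with x₀² + x₁² ≠ 0 avoids distinguishing which of the two coordinates is nonzero.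
  have key : ∀ z, x 0 * z = 0 → x 1 * z = 0 → z = 0 := fun z h1 h2 =>
    (mul_eq_zero.1 (show (x 0 ^ 2 + x 1 ^ 2) * z = 0 by
      linear_combination x 0 * h1 + x 1 * h2)).resolve_left hn
  obtain rfl : v = 0 := key v (by linarith) (by linarith)
  obtain rfl : u = 0 := key u (by linarith) (by linarith)
  obtain rfl : s = 0 := key s (by linarith) (by linarith)
  obtain ⟨a2, b2, -⟩ := h.coef_eq' 2
  simp only [hx4, zero_mul, add_zero, hc.swap _ 0 2, hc.swap _ 1 2, hc.c002, hc.c012, hc.c102,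
    hc.c112] at a2 b2
  have a2' : x 0 * B - x 1 * A = 0 :=
    (mul_eq_zero.1 (show t * (x 0 * B - x 1 * A) = 0 by linear_combination a2)).resolve_left ht
  have b2' : x 0 * A + x 1 * C = 0 :=
    (mul_eq_zero.1 (show t * (x 0 * A + x 1 * C) = 0 by linear_combination -b2)).resolve_left ht
  have hB : B = 0 := (mul_eq_zero.1 (show (x 0 ^ 2 + x 1 ^ 2) * B = 0 by
    linear_combination x 0 * a2' - x 1 * a4)).resolve_left hn
  have hA : A = 0 := (mul_eq_zero.1 (show (x 0 ^ 2 + x 1 ^ 2) * A = 0 by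
    linear_combination -x 1 * a2' - x 0 * a4)).resolve_left hn
  have hC : C = 0 := (mul_eq_zero.1 (show (x 0 ^ 2 + x 1 ^ 2) * C = 0 by
    linear_combination x 1 * b2' - x 0 * b4)).resolve_left hn
  subst hA hB hC hq
  exact hc.mem_family₂

/-- Modulo the central vector ξ, x is proportional to e₅ + z e₂, and centrality expresses the other
parameters through z, s and t, except for m. If s = 0 the point is in ℳ₂. If s ≠ 0, Jacobi
determines m and produces a closed one-form equal to 1 on ξ, contradicting that ξ lies in the
derived algebra. -/
theorem CentralPair.mem_family₂_of_transverse {d : Brackets} {t : ℝ} {x : V}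
    (h : CentralPair d t x) (hx0 : x 0 = 0) (hx4 : x 4 - t * x 3 ≠ 0) : d.1 ∈ family₂ := by
  obtain ⟨A, B, C, q, y, u, v, s, m, hc⟩ := h.form
  obtain ⟨z, hz⟩ : ∃ z, x 1 = (x 4 - t * x 3) * z := ⟨x 1 / (x 4 - t * x 3), by field_simp⟩
  have hd := coef_self d.1
  have red : ∀ j, (coef d.1 0 j 4 + z * coef d.1 0 j 1 = 0) ∧
      (coef d.1 1 j 4 + z * coef d.1 1 j 1 = 0) ∧
      (coef d.1 4 j 4 - t * coef d.1 3 j 4 + z * (coef d.1 4 j 1 - t * coef d.1 3 j 1) = 0) := by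
    intro j
    obtain ⟨e0, e1, e2⟩ := h.coef_eq' j
    rw [hx0, hz] at e0 e1 e2
    refine ⟨?_, ?_, ?_⟩ <;> refine (mul_eq_zero.1 ?_).resolve_left hx4
    · linear_combination e0
    · linear_combination e1
    · linear_combination e2
  obtain ⟨a0, b0, c0⟩ := red 0
  obtain ⟨a1, b1, c1⟩ := red 1
  obtain ⟨a2, b2, c2⟩ := red 2
  obtain ⟨a4, b4, c4⟩ := red 4
  simp only [hc.swap _ 1 4, hc.swap _ 1 2, hc.c001,
    hc.c014, hc.c101, hc.c401, hc.c301, hc.c114, hc.c004, hc.c104, hc.c024, hc.c124,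
    hc.c012, hc.c112, hc.c304, hc.c404, hc.c314, hc.c414, hc.c312,
    hc.c412, hc.c324, hc.c424, hd] at a0 b0 c0 a1 b1 c1 a2 b2 c2 a4 b4 c4
  obtain rfl : B = 0 := by linarith
  obtain rfl : A = 0 := by linarith
  obtain rfl : v = 0 := by linarith
  obtain rfl : q = 0 := by linarith
  obtain rfl : u = -(z * s) := by linarith
  obtain rfl : C = z * (z * s) := by linarith
  obtain rfl : y = z * t * (z * (z * s)) := by linarith
  -- This component of the Jacobi identity reads s (m - t² z⁴ s) = 0.
  have jac := congrArg (fun w : V => w 3)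
    ((jacobi_iff d.1).1 d.2 (basisVec 0) (basisVec 1) (basisVec 2))
  simp [bracket_val _ _ (bracket _ _ _), twoFormVal, bracket_basis, hc.c301, hc.c302, hc.c312,
    hc.col, hc.c304, hc.c314, hc.c324, hc.row2, hc.c001, hc.c002, hc.c012, hc.c101, hc.c102,
    hc.c112, hc.c401, hc.c402, hc.c412] at jac
  by_cases hs : s = 0
  · subst hs
    simp only [mul_zero, neg_zero] at hc
    exact hc.mem_family₂
  · exfalso
    obtain rfl : m = t * t * z * z * z * z * s := by
      refine sub_eq_zero.1 ((mul_eq_zero.1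
        (?_ : s * (m - t * t * z * z * z * z * s) = 0)).resolve_left hs)
      linear_combination jac
    -- Its value on e₄ + t e₅ is (1 + t² z²) - t² z² = 1.
    have hcl : d.1 ((1 + t ^ 2 * z ^ 2) • coframe 3 - (t * z ^ 2) • coframe 4) = 0 := by
      refine form_two_ext fun a b => ?_
      rw [map_sub, map_smul, map_smul, ContinuousAlternatingMap.sub_apply,
        ContinuousAlternatingMap.smul_apply, ContinuousAlternatingMap.smul_apply,
        hom12_apply_coframe, hom12_apply_coframe]
      simp only [twoFormVal, hc.col, hc.c301, hc.c302, hc.c312, hc.c304, hc.c314, hc.c324,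
        hc.c401, hc.c402, hc.c412, hc.c404, hc.c414, hc.c424, hc.swap _ 4 3, hd, smul_eq_mul]
      refine Eq.trans ?_ (show (0 : ℝ) = (0 : Form 2) ![a, b] from rfl)
      ring
    have := h.closed _ hcl
    simp at this
    nlinarith

/-! ### Nilpotent hypo structures -/

/-- The `U(2)`-orbit of `d` intersects one of the three families. -/
def MeetsFamily (d : Brackets) : Prop :=
  ∃ f ∈ U2, act f.toContinuousLinearEquiv d.1 ∈ family₁ ∪ family₂ ∪ family₃

theorem MeetsFamily.of_mem {d : Brackets} (h : d.1 ∈ family₁ ∪ family₂ ∪ family₃) :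
    MeetsFamily d := ⟨1, U2.one_mem, h⟩

theorem MeetsFamily.of_actU {f : V ≃ₗᵢ[ℝ] V} (hf : f ∈ U2) {d : Brackets}
    (h : MeetsFamily (actU f d)) : MeetsFamily d := by
  obtain ⟨g, hg, h⟩ := h
  exact ⟨g * f, U2.mul_mem hg hf, h⟩

theorem actU_apply_eq_zero {f : V ≃ₗᵢ[ℝ] V} {d : Brackets} {α : OneForm}
    (h : (actU f d).1 α = 0) : d.1 (α.comp (f.toContinuousLinearEquiv : V →L[ℝ] V)) = 0 := by
  refine form_two_ext fun x y => ?_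
  have h1 := oneForm_bracket d.1 (α.comp (f.toContinuousLinearEquiv : V →L[ℝ] V)) x y
  have h2 : α (bracket (actU f d).1 (f x) (f y)) = 0 := by
    rw [oneForm_bracket, h]
    exact neg_zero
  rw [bracket_actU] at h2
  have h3 := h1.symm.trans h2
  exact neg_eq_zero.1 h3

/-- A rotation of the first complex coordinate fixes e₄ + t e₅ and preserves e³, so all the
conditions are transported. -/
theorem CentralPair.actU {d : Brackets} {t : ℝ} {x : V} (h : CentralPair d t x)
    {f : V ≃ₗᵢ[ℝ] V} (hf : f ∈ U2) {c s : ℝ} (hA : ActsBy f ⟨c, s⟩ 0 0 1) :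
    CentralPair (actU f d) t (f x) := by
  have hξ : f (basisVec 3 + t • basisVec 4) = basisVec 3 + t • basisVec 4 := by
    ext i
    fin_cases i <;> simp [hA.zero, hA.one, hA.two, hA.three, hA.four, -map_add, -map_smul]
  refine ⟨h.hypo.actU hf, isNilpotent_of_mem_orbitGL (actU_mem_orbitGL f d) h.nilpotent,
    fun y => ?_, fun α hα => ?_, ?_, fun r hr => ?_, fun y => ?_⟩
  · obtain ⟨y, rfl⟩ := f.surjective y
    rw [← hξ, bracket_actU, h.central, map_zero]
  · have := h.closed _ (actU_apply_eq_zero hα)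
    rw [← hξ]
    exact this
  · rw [hA.two]
    simp [h.two]
  · refine h.notMem r (f.injective ?_)
    rw [hr, map_smul, hξ]
  · obtain ⟨y, rfl⟩ := f.surjective y
    obtain ⟨r, hr⟩ := h.central_mod y
    exact ⟨r, by rw [bracket_actU, hr, map_smul, hξ]⟩

theorem CentralPair.meetsFamily {d : Brackets} {t : ℝ} {x : V} (h : CentralPair d t x) :
    MeetsFamily d := by
  by_cases hη : x 4 - t * x 3 = 0
  · by_cases ht : t = 0
    · subst ht
      obtain ⟨f, hf, h0, c, s, -, hA⟩ := exists_U2_to_second x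
      refine .of_actU hf (.of_mem (Or.inl (Or.inl ((h.actU hf hA).mem_family₁ h0 ?_))))
      rw [hA.four]
      linarith
    · obtain ⟨f, hf, h0, c, s, -, hA⟩ :=
        exists_U2_to_second (bracket d.1 (basisVec 2) (basisVec 4))
      refine .of_actU hf (.of_mem (Or.inl (Or.inr ((h.actU hf hA).mem_family₂_of_ne ht ?_ ?_))))
      · rw [hA.four, hA.three]
        simpa using hη
      · have h2 : f (basisVec 2) = basisVec 2 := by
          ext i; fin_cases i <;> simp [hA.zero, hA.one, hA.two, hA.three, hA.four]
        have h4 : f (basisVec 4) = basisVec 4 := hf.2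
        rw [← bracket_actU, h2, h4, bracket_basis] at h0
        exact neg_eq_zero.1 h0
  · obtain ⟨f, hf, h0, c, s, -, hA⟩ := exists_U2_to_second x
    refine .of_actU hf (.of_mem (Or.inl (Or.inr ((h.actU hf hA).mem_family₂_of_transverse h0 ?_))))
    rw [hA.four, hA.three]
    simpa using hη

theorem meetsFamily_of_central {d : Brackets} (hh : IsHypo d)
    (hn : LieRing.IsNilpotent (LieAlg d)) {t : ℝ}
    (hc : ∀ y, bracket d.1 y (basisVec 3 + t • basisVec 4) = 0)
    (hcl : ∀ α, d.1 α = 0 → α (basisVec 3 + t • basisVec 4) = 0) : MeetsFamily d := by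
  obtain ⟨A, B, C, q, y, u, v, s, m, hf⟩ :=
    CentralForm.of_hypoCoef (coef_trace hn) hh.hypoCoef (central_coef hc)
  obtain ⟨x, hx, hx', hxy⟩ := exists_bracket_mem hn
    -- As e³ is closed, ker e³ contains the derived algebra and is therefore stable under brackets;
    -- e₁ lies in it and off the central line.
    (N := {x | x 2 = 0}) (W := {x | ∃ r : ℝ, x = r • (basisVec 3 + t • basisVec 4)})
    (fun x y _ => by
      change bracket d.1 x y 2 = 0
      rw [bracket_val]
      simp [twoFormVal, hf.row2])
    ⟨0, by rw [zero_smul]⟩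
    (fun h => by
      obtain ⟨r, hr⟩ := h (show basisVec 0 ∈ {x : V | x 2 = 0} by simp)
      have := congrArg (fun w : V => w 0) hr
      simp at this)
  exact CentralPair.meetsFamily ⟨hh, hn, hc, hcl, hx, fun r hr => hx' ⟨r, hr⟩, hxy⟩

/-- The structure constants of a hypo structure with central vector `e₅` such that `e₄` is central
modulo `e₅`. -/
theorem HypoCoef.of_central_five {d : Hom12} (hh : HypoCoef (coef d))
    (h4 : ∀ i j, coef d i j 4 = 0) (h3 : ∀ i j, i ≠ 4 → coef d i j 3 = 0) :
    (∀ i j k, i ≠ 4 → j < k → coef d i j k = 0) ∧ coef d 4 0 2 = coef d 4 1 3 ∧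
      coef d 4 1 2 = -coef d 4 0 3 := by
  obtain ⟨a1, a2, a3, a4, a5, a6, a7, a8, a9, a10, a11, a12, a13, a14, a15, a16, a17, a18, a19,
    a20⟩ := hh
  have h33 := fun j => h3 3 j (by decide)
  have h03 := fun j => h3 0 j (by decide)
  have h13 := fun j => h3 1 j (by decide)
  have h23 := fun j => h3 2 j (by decide)
  generalize coef d = c at *
  simp only [h4, h03, h13, h23, h33] at a1 a2 a4 a7 a12 a13 a14 a15 a17 a18 a19 a20
  refine ⟨?_, by linarith, by linarith⟩
  intro i j k hi hjk
  fin_cases i <;> fin_cases j <;> fin_cases k <;> simp at hi hjk ⊢ <;>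
    first
    | linarith
    | simp [h4, h03, h13, h23, h33]

/-- A hermitian form on `ℂ²` has a characteristic vector. -/
theorem exists_characteristic (p s a b : ℝ) : ∃ κ : ℝ, ∃ v : V, v ≠ 0 ∧ v 4 = 0 ∧
    p * v 1 + a * v 2 + b * v 3 = κ * v 1 ∧ -(p * v 0) - b * v 2 + a * v 3 = -(κ * v 0) ∧
    -(a * v 0) + b * v 1 + s * v 3 = κ * v 3 ∧ -(b * v 0) - a * v 1 - s * v 2 = -(κ * v 2) := by
  by_cases hab : a = 0 ∧ b = 0
  · refine ⟨p, basisVec 0, fun h => ?_, by simp, ?_⟩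
    · have := congrArg (fun w : V => w 0) h
      simp at this
    · simp [hab.1, hab.2]
  -- The square of r is the discriminant of the characteristic polynomial of the hermitian form, and
  -- κ is its larger root.
  · set r := √((p - s) ^ 2 + 4 * (a ^ 2 + b ^ 2)) with hr
    have hr2 : r ^ 2 = (p - s) ^ 2 + 4 * (a ^ 2 + b ^ 2) := Real.sq_sqrt (by positivity)
    refine ⟨(p + s + r) / 2, !₂[b, a, (p + s + r) / 2 - p, 0, 0], fun h => hab ⟨?_, ?_⟩,
      by simp, ?_, ?_, ?_, ?_⟩
    · exact congrArg (fun w : V => w 1) h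
    · exact congrArg (fun w : V => w 0) h
    · simp; ring
    · simp; ring
    · simp; ring
    · simp; linear_combination hr2 / 4

/-- U(2) is used twice. The first rotation moves a vector central modulo e₅ to e₄ modulo e₅, which
leaves only de⁵, a J-invariant two-form on ℂ². The second moves an eigenvector of the corresponding
hermitian form to the line of e₄, which removes the mixed terms. -/
theorem meetsFamily_of_central_five {d : Brackets} (hh : IsHypo d)
    (hn : LieRing.IsNilpotent (LieAlg d)) (hc : ∀ y, bracket d.1 y (basisVec 4) = 0) :
    MeetsFamily d := by
  obtain ⟨x, -, hx, hxy⟩ := exists_bracket_mem hn (N := Set.univ)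
    (W := {x | ∃ r : ℝ, x = r • basisVec 4}) (fun _ _ _ => Set.mem_univ _) ⟨0, by rw [zero_smul]⟩
    (fun h => by
      obtain ⟨r, hr⟩ := h (Set.mem_univ (basisVec 0))
      have := congrArg (fun w : V => w 0) hr
      simp at this)
  obtain ⟨f, hf, r, hr, x0, x1, x2, x3, x4⟩ := exists_U2_to_fourth x
  have h44 : f (basisVec 4) = basisVec 4 := hf.2
  refine .of_actU hf ?_
  have hr0 : r ≠ 0 := by
    rintro rfl
    refine hx ⟨x 4, f.injective (PiLp.ext fun i => ?_)⟩
    rw [map_smul, h44]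
    fin_cases i <;> simp [x0, x1, x2, x3, x4]
  replace hh := hh.actU hf
  have hc4 : ∀ y, bracket (actU f d).1 y (basisVec 4) = 0 := fun y => by
    obtain ⟨y, rfl⟩ := f.surjective y
    rw [← h44, bracket_actU, hc, map_zero]
  have hcx : ∀ y, ∃ r : ℝ, bracket (actU f d).1 y (f x) = r • basisVec 4 := fun y => by
    obtain ⟨y, rfl⟩ := f.surjective y
    obtain ⟨r, hr⟩ := hxy y
    exact ⟨r, by rw [bracket_actU, hr, map_smul, h44]⟩
  have hfx : f x = r • basisVec 3 + x 4 • basisVec 4 := by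
    ext i; fin_cases i <;> simp [x0, x1, x2, x3, x4]
  clear hn hc hxy
  generalize actU f d = d at *
  have hcoef4 : ∀ i j, coef d.1 i j 4 = 0 := fun i j => by
    have := congrArg (fun w : V => w i) (hc4 (basisVec j))
    simp only [bracket_basis] at this
    exact neg_eq_zero.1 this
  have hcoef3 : ∀ i j, i ≠ 4 → coef d.1 i j 3 = 0 := fun i j hi => by
    obtain ⟨q, hq⟩ := hcx (basisVec j)
    have := congrArg (fun w : V => w i) hq
    rw [hfx, bracket_add_right, bracket_smul_right, bracket_smul_right, hc4] at this
    simp [bracket_basis, hi] at this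
    exact this.resolve_left hr0
  obtain ⟨hz, h02, h12⟩ := hh.hypoCoef.of_central_five hcoef4 hcoef3
  have hz' : ∀ x y i, i ≠ 4 → bracket d.1 x y i = 0 := fun x y i hi => by
    rw [bracket_val]
    simp (disch := decide) [twoFormVal, hz i _ _ hi]
  obtain ⟨κ, v, hv, hv4, v0, v1, v2, v3⟩ := exists_characteristic (coef d.1 4 0 1) (coef d.1 4 2 3)
    (coef d.1 4 0 2) (coef d.1 4 0 3)
  -- This form of the eigenvector equation is U(2)-invariant, since `w₁` is. Once v lies on the line
  -- of e₄, it says that de⁵ pairs e₄ with e₃ alone.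
  have hσ : ∀ y, bracket d.1 y v 4 = -(κ * w₁ y v) := fun y => by
    rw [bracket_val]
    simp only [twoFormVal, hcoef4, ← h02, h12, hv4, w₁]
    linear_combination -(y 0 * v0) - y 1 * v1 - y 2 * v2 - y 3 * v3
  obtain ⟨g, hg, ρ, hρ, w0, w1, w2, w3, w4⟩ := exists_U2_to_fourth v
  have hg4 : g (basisVec 4) = basisVec 4 := hg.2
  refine .of_actU hg (.of_mem (Or.inr ?_))
  have hρ0 : ρ ≠ 0 := by
    rintro rfl
    refine hv (g.injective (PiLp.ext fun i => ?_))
    rw [map_zero]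
    fin_cases i <;> simp [w0, w1, w2, w3, w4, hv4]
  have hgv : g v = ρ • basisVec 3 := by
    ext i; fin_cases i <;> simp [w0, w1, w2, w3, w4, hv4]
  obtain ⟨P, Q, R, S, hA⟩ := exists_actsBy hg
  have hz'' : ∀ x y i, i ≠ 4 → bracket (actU g d).1 x y i = 0 := fun x y i hi => by
    obtain ⟨x, rfl⟩ := g.surjective x
    obtain ⟨y, rfl⟩ := g.surjective y
    rw [bracket_actU]
    have := hz' x y
    fin_cases i <;> simp [hA.zero, hA.one, hA.two, hA.three, this] at hi ⊢
  have hc4' : ∀ y, bracket (actU g d).1 y (basisVec 4) = 0 := fun y => by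
    obtain ⟨y, rfl⟩ := g.surjective y
    rw [← hg4, bracket_actU, hc4, map_zero]
  have hσ' : ∀ y, ρ * bracket (actU g d).1 y (basisVec 3) 4 = -(κ * w₁ y (ρ • basisVec 3)) :=
    fun y => by
      obtain ⟨y, rfl⟩ := g.surjective y
      have := hσ y
      rw [← hA.four (bracket d.1 y v), ← bracket_actU, ← w₁_map hg, hgv, bracket_smul_right] at this
      exact this
  replace hh := hh.actU hg
  generalize actU g d = d at *
  have k4 : ∀ i j, coef d.1 i j 4 = 0 := fun i j => by
    have := congrArg (fun w : V => w i) (hc4' (basisVec j))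
    simp only [bracket_basis] at this
    exact neg_eq_zero.1 this
  have kz : ∀ i j k, i ≠ 4 → coef d.1 i j k = 0 := fun i j k hi => by
    have := hz'' (basisVec j) (basisVec k) i hi
    rw [bracket_basis] at this
    exact neg_eq_zero.1 this
  obtain ⟨-, k02, k12⟩ := hh.hypoCoef.of_central_five k4 (fun i j hi => kz i j 3 hi)
  have k03 : coef d.1 4 0 3 = 0 := by
    have := hσ' (basisVec 0)
    rw [bracket_basis] at this
    simpa [w₁, hρ0] using this
  have k13 : coef d.1 4 1 3 = 0 := by
    have := hσ' (basisVec 1)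
    rw [bracket_basis] at this
    simpa [w₁, hρ0] using this
  refine mem_family₃_of_coef fun i j k hjk hn => ?_
  by_cases hi : i = 4
  · subst hi
    fin_cases j <;> fin_cases k <;> simp at hjk hn ⊢ <;> simp [k4, k02, k12, k03, k13]
  · exact kz i j k hi

theorem zero_mem_family₁ : (0 : Hom12) ∈ family₁ :=
  mem_family₁_of_coef (fun _ _ _ _ _ => rfl) neg_zero.symm rfl

theorem bracket_eq_zero_iff {d : Hom12} : (∀ x y, bracket d x y = 0) ↔ d = 0 := by
  have h0 : ∀ x y, bracket (0 : Hom12) x y = 0 := fun x y => by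
    simp only [bracket]
    simp [show ∀ v : Fin 2 → V, (0 : Form 2) v = 0 from fun _ => rfl]
  refine ⟨fun h => hom12_ext_bracket fun x y => by rw [h, h0], ?_⟩
  rintro rfl
  exact h0

theorem meetsFamily_of_isHypo {d : Brackets} (hh : IsHypo d)
    (hn : LieRing.IsNilpotent (LieAlg d)) : MeetsFamily d := by
  by_cases hd : ∀ x y, bracket d.1 x y = 0
  · exact .of_mem (Or.inl (Or.inl (bracket_eq_zero_iff.1 hd ▸ zero_mem_family₁)))
  · push Not at hd
    obtain ⟨a, b, hab⟩ := hd
    have hbr : ∀ x y, ∀ α, d.1 α = 0 → α (bracket d.1 x y) = 0 := fun x y α hα => by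
      rw [oneForm_bracket, hα]
      exact neg_zero
    -- `N` is the annihilator of the closed one-forms, that is the derived algebra. Remembering
    -- membership in it, and not just centrality, is what the transverse case needs.
    obtain ⟨ξ, hξ, hξ0, hcen⟩ := exists_bracket_mem hn (N := {x | ∀ α, d.1 α = 0 → α x = 0})
      (W := {0}) (fun x y _ => hbr x y) rfl (fun h => hab (h (hbr a b)))
    obtain ⟨f, hf, r, hr, x0, x1, x2, x3, x4⟩ := exists_U2_to_fourth ξ
    have hfξ : f ξ = r • basisVec 3 + ξ 4 • basisVec 4 := by
      ext i; fin_cases i <;> simp [x0, x1, x2, x3, x4]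
    refine .of_actU hf ?_
    have hcen' : ∀ y, bracket (actU f d).1 y (f ξ) = 0 := fun y => by
      obtain ⟨y, rfl⟩ := f.surjective y
      rw [bracket_actU, hcen, map_zero]
    have hcl' : ∀ α, (actU f d).1 α = 0 → α (f ξ) = 0 := fun α hα => hξ _ (actU_apply_eq_zero hα)
    have hn' := isNilpotent_of_mem_orbitGL (actU_mem_orbitGL f d) hn
    by_cases hr0 : r = 0
    · have h4 : ξ 4 ≠ 0 := by
        intro h4
        refine hξ0 (f.injective ?_)
        rw [hfξ, hr0, h4, map_zero, zero_smul, zero_smul, add_zero]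
      refine meetsFamily_of_central_five (hh.actU hf) hn' fun y => ?_
      have := hcen' y
      rw [hfξ, hr0, zero_smul, zero_add, bracket_smul_right] at this
      exact (smul_eq_zero.1 this).resolve_left h4
    · have hs : basisVec 3 + (ξ 4 / r) • basisVec 4 = r⁻¹ • f ξ := by
        rw [hfξ, smul_add, smul_smul, smul_smul, inv_mul_cancel₀ hr0, one_smul, div_eq_inv_mul]
      refine meetsFamily_of_central (hh.actU hf) hn' (t := ξ 4 / r) (fun y => ?_) fun α hα => ?_
      · rw [hs, bracket_smul_right, hcen', smul_zero]
      · rw [hs, map_smul, hcl' α hα, smul_zero]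

/-! ### The elements of the three families are hypo -/

theorem bracket_ofTuple (τ : Fin 5 → Form 2) (x y : V) (i : Fin 5) :
    bracket (ofTuple τ) x y i = -τ i ![x, y] := by
  rw [bracket_apply, ofTuple_coframe]

/-- A bracket given by its five components. -/
theorem bracket_eq_family₁ (l m h k : ℝ) (x y : V) :
    bracket (ofTuple ![l • (e₃ ⋏ e₅), h • (e₃ ⋏ e₅) + k • (e₁ ⋏ e₅), 0,
      ((-l) • e₂ + h • e₁ + m • e₃) ⋏ e₅, 0]) x y =
    !₂[-(l * (x 2 * y 4 - x 4 * y 2)),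
      -(h * (x 2 * y 4 - x 4 * y 2) + k * (x 0 * y 4 - x 4 * y 0)), 0,
      -((-l * x 1 + h * x 0 + m * x 2) * y 4 - x 4 * (-l * y 1 + h * y 0 + m * y 2)), 0] := by
  ext i
  rw [bracket_ofTuple]
  fin_cases i <;> simp [wedgeTwo_apply, -mul_eq_mul_left_iff] <;> ring

theorem bracket_eq_family₂ (x y h k l m : ℝ) (u v : V) :
    bracket (ofTuple ![0, x • (e₃ ⋏ e₄) + l • (e₃ ⋏ e₅), 0,
      x • (e₁ ⋏ e₄ - e₂ ⋏ e₃) - y • (e₃ ⋏ e₄) + l • (e₁ ⋏ e₅) - m • (e₃ ⋏ e₅),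
      (-h) • (e₁ ⋏ e₄ - e₂ ⋏ e₃) + k • (e₃ ⋏ e₄) - x • (e₁ ⋏ e₅) + y • (e₃ ⋏ e₅)]) u v =
    !₂[0, -(x * (u 2 * v 3 - u 3 * v 2) + l * (u 2 * v 4 - u 4 * v 2)), 0,
      -(x * (u 0 * v 3 - u 3 * v 0 - (u 1 * v 2 - u 2 * v 1)) - y * (u 2 * v 3 - u 3 * v 2)
        + l * (u 0 * v 4 - u 4 * v 0) - m * (u 2 * v 4 - u 4 * v 2)),
      -(-h * (u 0 * v 3 - u 3 * v 0 - (u 1 * v 2 - u 2 * v 1)) + k * (u 2 * v 3 - u 3 * v 2)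
        - x * (u 0 * v 4 - u 4 * v 0) + y * (u 2 * v 4 - u 4 * v 2))] := by
  ext i
  rw [bracket_ofTuple]
  fin_cases i <;> simp [wedgeTwo_apply] <;> ring

theorem bracket_eq_family₃ (l m : ℝ) (x y : V) :
    bracket (ofTuple ![0, 0, 0, 0, (l + m) • (e₁ ⋏ e₂) + (l - m) • (e₃ ⋏ e₄)]) x y =
    !₂[0, 0, 0, 0, -((l + m) * (x 0 * y 1 - x 1 * y 0) + (l - m) * (x 2 * y 3 - x 3 * y 2))] := by
  ext i
  rw [bracket_ofTuple]
  fin_cases i <;> simp [wedgeTwo_apply] <;> ring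

theorem isHypo_of_mem_family {d : Brackets} (hd : d.1 ∈ family₁ ∪ family₂ ∪ family₃) :
    IsHypo d := by
  rw [isHypo_iff]
  rcases hd with (⟨l, m, h, k, hd⟩ | ⟨a, b, h, k, l, m, -, hd⟩) | ⟨l, m, hd⟩ <;> rw [hd]
  · simp only [dTwo, dThree, wedgeFive, w₁, w₂, w₃, bracket_eq_family₁]
    refine ⟨fun x y z => ?_, fun x y z w => ?_, fun x y z w => ?_⟩ <;> simp <;> ring
  · simp only [dTwo, dThree, wedgeFive, w₁, w₂, w₃, bracket_eq_family₂]
    refine ⟨fun x y z => ?_, fun x y z w => ?_, fun x y z w => ?_⟩ <;> simp <;> ring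
  · simp only [dTwo, dThree, wedgeFive, w₁, w₂, w₃, bracket_eq_family₃]
    refine ⟨fun x y z => ?_, fun x y z w => ?_, fun x y z w => ?_⟩ <;> simp <;> ring

/-! ### Classification of the elements of the three families -/

/-- The components of the differentials at the nodes. -/
def nodeVal : Node → Fin 5 → V → V → ℝ
  | .a, i, x, y => ![0, 0, 0, x 0 * y 1 - x 1 * y 0,
      x 0 * y 2 - x 2 * y 0 + (x 1 * y 3 - x 3 * y 1)] i
  | .b, i, x, y => ![0, 0, 0, 0, x 0 * y 1 - x 1 * y 0 + (x 2 * y 3 - x 3 * y 2)] i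
  | .c, i, x, y => ![0, 0, 0, 0, x 0 * y 1 - x 1 * y 0] i
  | .f, i, x, y => ![0, 0, x 0 * y 1 - x 1 * y 0, x 0 * y 2 - x 2 * y 0,
      x 0 * y 3 - x 3 * y 0] i
  | .g, i, x, y => ![0, 0, 0, x 0 * y 1 - x 1 * y 0, x 0 * y 2 - x 2 * y 0] i

theorem bracket_node (n : Node) (x y : V) (i : Fin 5) :
    bracket (node n).1 x y i = -nodeVal n i x y := by
  rw [node, bracket_ofTuple]
  cases n <;> fin_cases i <;> simp [nodeTuple, nodeVal, wedgeTwo_apply] <;> ring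

/-- The vector with components the linear forms given by the rows of `M`. -/
def rowMap (M : Matrix (Fin 5) (Fin 5) ℝ) : V →ₗ[ℝ] V where
  toFun x := !₂[∑ j, M 0 j * x j, ∑ j, M 1 j * x j, ∑ j, M 2 j * x j, ∑ j, M 3 j * x j,
    ∑ j, M 4 j * x j]
  map_add' x y := by ext i; fin_cases i <;> simp [mul_add, Finset.sum_add_distrib]
  map_smul' c x := by ext i; fin_cases i <;> simp [Finset.mul_sum, mul_left_comm]

theorem rowMap_apply (M : Matrix (Fin 5) (Fin 5) ℝ) (x : V) (i : Fin 5) :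
    rowMap M x i = ∑ j, M i j * x j := by
  fin_cases i <;> simp [rowMap]

/-- A coframe satisfying the structure equations of a node. -/
theorem mem_orbitGL_node {d : Brackets} {n : Node} (M : Matrix (Fin 5) (Fin 5) ℝ)
    (hM : ∀ x : V, (∀ i, ∑ j, M i j * x j = 0) → ∀ i, x i = 0)
    (h : ∀ i x y, ∑ j, M i j * bracket d.1 x y j = -nodeVal n i (rowMap M x) (rowMap M y)) :
    d ∈ orbitGL (node n) := by
  have hinj : Function.Injective (rowMap M) := by
    rw [← LinearMap.ker_eq_bot, LinearMap.ker_eq_bot']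
    intro x hx
    refine PiLp.ext fun i => hM x (fun i => ?_) i
    rw [← rowMap_apply, hx, PiLp.zero_apply]
  let F : V ≃L[ℝ] V := (LinearEquiv.ofInjectiveEndo (rowMap M) hinj).toContinuousLinearEquiv
  have hF : ∀ x, F x = rowMap M x := fun x => rfl
  refine mem_orbitGL_symm ⟨F, hom12_ext_bracket fun x y => PiLp.ext fun i => ?_⟩
  obtain ⟨x, rfl⟩ := F.surjective x
  obtain ⟨y, rfl⟩ := F.surjective y
  rw [bracket_act, F.symm_apply_apply, F.symm_apply_apply, bracket_node, hF, hF, hF, rowMap_apply,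
    h]

/-! ### Rank condition and normal forms of the family members -/

theorem exists_row_relation {M : Matrix (Fin 2) (Fin 4) ℝ} (h : M.rank < 2) :
    ∃ p q : ℝ, (p ≠ 0 ∨ q ≠ 0) ∧ ∀ j, p * M 0 j + q * M 1 j = 0 := by
  have hli : ¬ LinearIndependent ℝ M.row := fun hli => by
    have := hli.rank_matrix
    simp at this
    omega
  obtain ⟨g, hg, i, hi⟩ := Fintype.not_linearIndependent_iff.1 hli
  refine ⟨g 0, g 1, ?_, fun j => ?_⟩
  · fin_cases i
    · exact Or.inl hi
    · exact Or.inr hi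
  · have := congrFun hg j
    simpa [Fin.sum_univ_two] using this

theorem minor_eq_zero {M : Matrix (Fin 2) (Fin 4) ℝ} (h : M.rank < 2) (i j : Fin 4) :
    M 0 i * M 1 j = M 0 j * M 1 i := by
  obtain ⟨p, q, hpq, hr⟩ := exists_row_relation h
  have hi := hr i
  have hj := hr j
  rcases hpq with hp | hq
  · refine mul_left_cancel₀ hp ?_
    linear_combination M 1 j * hi - M 1 i * hj
  · refine mul_left_cancel₀ hq ?_
    linear_combination M 0 i * hj - M 0 j * hi

/-- In each case the rows of the matrix form a coframe with the structure equations of the node.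
When l = 0, the algebra is governed by k e¹ + h e³ and h e¹ + m e³ wedged with e⁵, and h² - km
decides whether these are independent. -/
theorem family₁_classify {d : Brackets} {l m h k : ℝ} (hd : d.1 = ofTuple ![l • (e₃ ⋏ e₅),
      h • (e₃ ⋏ e₅) + k • (e₁ ⋏ e₅), 0, ((-l) • e₂ + h • e₁ + m • e₃) ⋏ e₅, 0]) :
    (l ≠ 0 → k ≠ 0 → d ∈ orbitGL (node .f)) ∧ (l ≠ 0 → k = 0 → d ∈ orbitGL (node .g)) ∧
    (l = 0 → h ^ 2 ≠ k * m → d ∈ orbitGL (node .g)) ∧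
    (l = 0 → h ^ 2 = k * m → k ≠ 0 → d ∈ orbitGL (node .c)) ∧
    (l = 0 → h = 0 → k = 0 → m ≠ 0 → d ∈ orbitGL (node .c)) := by
  refine ⟨fun hl hk => ?_, fun hl hk => ?_, ?_, ?_, ?_⟩
  · refine mem_orbitGL_node !![0, 0, 0, 0, 1; 0, 0, l ^ 3 * k, 0, 0; -l ^ 2 * k, 0, 0, 0, 0;
      -l * h, l ^ 2, 0, 0, 0; -m, 0, 0, l, 0] (fun x hx => ?_) (fun i x y => ?_)
    · have h0 := hx 0
      have h1 := hx 1
      have h2 := hx 2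
      have h3 := hx 3
      have h4 := hx 4
      simp [Fin.sum_univ_five, hl, hk] at h0 h1 h2 h3 h4
      simp [h2, hl] at h3 h4
      intro i; fin_cases i <;> simp [h0, h1, h2, h3, h4]
    · rw [hd, bracket_eq_family₁]
      fin_cases i <;> simp [nodeVal, rowMap, Fin.sum_univ_five] <;> ring
  · refine mem_orbitGL_node !![0, 0, 0, 0, 1; 0, 0, -l, 0, 0; -l * h, l ^ 2, 0, 0, 0;
      1, 0, 0, 0, 0; -m, 0, 0, l, 0] (fun x hx => ?_) (fun i x y => ?_)
    · have h0 := hx 0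
      have h1 := hx 1
      have h2 := hx 2
      have h3 := hx 3
      have h4 := hx 4
      simp [Fin.sum_univ_five, hl] at h0 h1 h2 h3 h4
      simp [h3, hl] at h2 h4
      intro i; fin_cases i <;> simp [h0, h1, h2, h3, h4]
    · rw [hd, bracket_eq_family₁, hk]
      fin_cases i <;> simp [nodeVal, rowMap, Fin.sum_univ_five] <;> ring
  · rintro rfl hdet
    refine mem_orbitGL_node !![0, 0, 0, 0, 1; -k, 0, -h, 0, 0; -h, 0, -m, 0, 0;
      0, 1, 0, 0, 0; 0, 0, 0, 1, 0] (fun x hx => ?_) (fun i x y => ?_)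
    · have h0 := hx 0
      have h1 := hx 1
      have h2 := hx 2
      have h3 := hx 3
      have h4 := hx 4
      simp [Fin.sum_univ_five] at h0 h1 h2 h3 h4
      have hdet' := sub_ne_zero.2 hdet
      have e0 : x 0 = 0 := (mul_eq_zero.1 (show (h ^ 2 - k * m) * x 0 = 0 by
        linear_combination m * h1 - h * h2)).resolve_left hdet'
      have e2 : x 2 = 0 := (mul_eq_zero.1 (show (h ^ 2 - k * m) * x 2 = 0 by
        linear_combination k * h2 - h * h1)).resolve_left hdet'
      intro i; fin_cases i <;> simp [h0, e0, e2, h3, h4]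
    · rw [hd, bracket_eq_family₁]
      fin_cases i <;> simp [nodeVal, rowMap, Fin.sum_univ_five] <;> ring
  · rintro rfl hdet hk
    refine mem_orbitGL_node !![0, 0, 0, 0, 1; -k, 0, -h, 0, 0; 0, 0, 1, 0, 0;
      0, -h, 0, k, 0; 0, 1, 0, 0, 0] (fun x hx => ?_) (fun i x y => ?_)
    · have h0 := hx 0
      have h1 := hx 1
      have h2 := hx 2
      have h3 := hx 3
      have h4 := hx 4
      simp [Fin.sum_univ_five] at h0 h1 h2 h3 h4
      simp [h2, h4, hk] at h1 h3
      intro i; fin_cases i <;> simp [h0, h1, h2, h3, h4]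
    · rw [hd, bracket_eq_family₁]
      fin_cases i <;> simp [nodeVal, rowMap, Fin.sum_univ_five]
      · linear_combination (x 2 * y 4 - x 4 * y 2) * hdet
      · ring
  · rintro rfl rfl rfl hm
    refine mem_orbitGL_node !![0, 0, 0, 0, 1; 0, 0, -m, 0, 0; 1, 0, 0, 0, 0;
      0, 1, 0, 0, 0; 0, 0, 0, 1, 0] (fun x hx => ?_) (fun i x y => ?_)
    · have h0 := hx 0
      have h1 := hx 1
      have h2 := hx 2
      have h3 := hx 3
      have h4 := hx 4
      simp [Fin.sum_univ_five, hm] at h0 h1 h2 h3 h4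
      intro i; fin_cases i <;> simp [h0, h1, h2, h3, h4]
    · rw [hd, bracket_eq_family₁]
      fin_cases i <;> simp [nodeVal, rowMap, Fin.sum_univ_five] <;> ring

/-- The 2 × 2 minors both reduce the number of free parameters and close the structure equations. -/
theorem family₂_classify {d : Brackets} {x y h k l m : ℝ}
    (hr : (!![x, y, l, m; h, k, x, y]).rank < 2)
    (hd : d.1 = ofTuple ![0, x • (e₃ ⋏ e₄) + l • (e₃ ⋏ e₅), 0,
      x • (e₁ ⋏ e₄ - e₂ ⋏ e₃) - y • (e₃ ⋏ e₄) + l • (e₁ ⋏ e₅) - m • (e₃ ⋏ e₅),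
      (-h) • (e₁ ⋏ e₄ - e₂ ⋏ e₃) + k • (e₃ ⋏ e₄) - x • (e₁ ⋏ e₅) + y • (e₃ ⋏ e₅)]) :
    (x ≠ 0 → d ∈ orbitGL (node .a)) ∧ (x = 0 → h ≠ 0 → d ∈ orbitGL (node .b)) ∧
    (x = 0 → h = 0 → l ≠ 0 → d ∈ orbitGL (node .g)) ∧
    (x = 0 → h = 0 → l = 0 → m ≠ 0 → d ∈ orbitGL (node .c)) ∧
    (x = 0 → h = 0 → l = 0 → m = 0 → k ≠ 0 → d ∈ orbitGL (node .c)) := by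
  have m01 := minor_eq_zero hr 0 1
  have m02 := minor_eq_zero hr 0 2
  have m03 := minor_eq_zero hr 0 3
  have m12 := minor_eq_zero hr 1 2
  have m13 := minor_eq_zero hr 1 3
  have m23 := minor_eq_zero hr 2 3
  simp at m01 m02 m03 m12 m13 m23
  refine ⟨fun hx => ?_, ?_, ?_, ?_, ?_⟩
  · have hl : l ≠ 0 := by
      rintro rfl
      simp [hx] at m02
    -- The first row is -(x e⁴ + l e⁵), which is closed because of the minors. The minor x² = lh
    -- also gives l ≠ 0, so that the coframe is nondegenerate.
    refine mem_orbitGL_node !![0, 0, 0, -x, -l; 0, 0, x ^ 2, 0, 0; x ^ 3, 0, -x ^ 2 * y, 0, 0;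
      0, x ^ 2, 0, 0, 0; 0, 0, 0, x ^ 3, 0] (fun u hu => ?_) (fun i u v => ?_)
    · have h0 := hu 0
      have h1 := hu 1
      have h2 := hu 2
      have h3 := hu 3
      have h4 := hu 4
      simp [Fin.sum_univ_five, hx] at h0 h1 h2 h3 h4
      simp [h1, h4, hx, hl] at h0 h2
      intro i; fin_cases i <;> simp [h0, h1, h2, h3, h4]
    · rw [hd, bracket_eq_family₂]
      fin_cases i <;> simp [nodeVal, rowMap, Fin.sum_univ_five]
      · linear_combination (u 0 * v 3 - u 3 * v 0 - (u 1 * v 2 - u 2 * v 1)) * m02 -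
          (u 2 * v 3 - u 3 * v 2) * m12 + (u 2 * v 4 - u 4 * v 2) * m23
      · ring
      · linear_combination -x ^ 2 * (u 2 * v 4 - u 4 * v 2) * m23
  · rintro rfl hh
    obtain rfl : l = 0 := by simpa [hh] using m02
    obtain rfl : y = 0 := by simpa [hh] using m01
    obtain rfl : m = 0 := by simpa [hh] using m03
    refine mem_orbitGL_node !![-h, 0, 0, 0, 0; 0, 0, 0, 1, 0; 0, 0, 1, 0, 0;
      0, -h, 0, k, 0; 0, 0, 0, 0, 1] (fun u hu => ?_) (fun i u v => ?_)
    · have h0 := hu 0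
      have h1 := hu 1
      have h2 := hu 2
      have h3 := hu 3
      have h4 := hu 4
      simp [Fin.sum_univ_five, hh] at h0 h1 h2 h3 h4
      simp [h1, hh] at h3
      intro i; fin_cases i <;> simp [h0, h1, h2, h3, h4]
    · rw [hd, bracket_eq_family₂]
      fin_cases i <;> simp [nodeVal, rowMap, Fin.sum_univ_five]; ring
  · rintro rfl rfl hl
    obtain rfl : k = 0 := by simpa [hl] using m12
    obtain rfl : y = 0 := by simpa [hl] using m23
    refine mem_orbitGL_node !![0, 0, 0, 0, 1; 0, 0, -l, 0, 0; -l, 0, m, 0, 0;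
      0, 1, 0, 0, 0; 0, 0, 0, 1, 0] (fun u hu => ?_) (fun i u v => ?_)
    · have h0 := hu 0
      have h1 := hu 1
      have h2 := hu 2
      have h3 := hu 3
      have h4 := hu 4
      simp [Fin.sum_univ_five, hl] at h0 h1 h2 h3 h4
      simp [h1, hl] at h2
      intro i; fin_cases i <;> simp [h0, h1, h2, h3, h4]
    · rw [hd, bracket_eq_family₂]
      fin_cases i <;> simp [nodeVal, rowMap, Fin.sum_univ_five] <;> ring
  · rintro rfl rfl rfl hm
    refine mem_orbitGL_node !![0, 0, 1, 0, 0; 0, 0, 0, -y, -m; 1, 0, 0, 0, 0;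
      0, 1, 0, 0, 0; 0, 0, 0, 1, 0] (fun u hu => ?_) (fun i u v => ?_)
    · have h0 := hu 0
      have h1 := hu 1
      have h2 := hu 2
      have h3 := hu 3
      have h4 := hu 4
      simp [Fin.sum_univ_five] at h0 h1 h2 h3 h4
      simp [h4, hm] at h1
      intro i; fin_cases i <;> simp [h0, h1, h2, h3, h4]
    · rw [hd, bracket_eq_family₂]
      fin_cases i <;> simp [nodeVal, rowMap, Fin.sum_univ_five]
      · linear_combination -(u 2 * v 3 - u 3 * v 2) * m13
      · ring
  · rintro rfl rfl rfl rfl hk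
    obtain rfl : y = 0 := by simpa using m13
    refine mem_orbitGL_node !![0, 0, 1, 0, 0; 0, 0, 0, k, 0; 1, 0, 0, 0, 0;
      0, 1, 0, 0, 0; 0, 0, 0, 0, 1] (fun u hu => ?_) (fun i u v => ?_)
    · have h0 := hu 0
      have h1 := hu 1
      have h2 := hu 2
      have h3 := hu 3
      have h4 := hu 4
      simp [Fin.sum_univ_five, hk] at h0 h1 h2 h3 h4
      intro i; fin_cases i <;> simp [h0, h1, h2, h3, h4]
    · rw [hd, bracket_eq_family₂]
      fin_cases i <;> simp [nodeVal, rowMap, Fin.sum_univ_five] <;> ring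

theorem family₃_classify {d : Brackets} {l m : ℝ}
    (hd : d.1 = ofTuple ![0, 0, 0, 0, (l + m) • (e₁ ⋏ e₂) + (l - m) • (e₃ ⋏ e₄)]) :
    (l + m ≠ 0 → l - m ≠ 0 → d ∈ orbitGL (node .b)) ∧
    (l + m ≠ 0 → l - m = 0 → d ∈ orbitGL (node .c)) ∧
    (l + m = 0 → l - m ≠ 0 → d ∈ orbitGL (node .c)) := by
  refine ⟨fun hp hm => ?_, fun hp hm => ?_, fun hp hm => ?_⟩
  · refine mem_orbitGL_node !![l + m, 0, 0, 0, 0; 0, 1, 0, 0, 0; 0, 0, l - m, 0, 0;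
      0, 0, 0, 1, 0; 0, 0, 0, 0, 1] (fun u hu => ?_) (fun i u v => ?_)
    · have h0 := hu 0
      have h1 := hu 1
      have h2 := hu 2
      have h3 := hu 3
      have h4 := hu 4
      simp [Fin.sum_univ_five, hp, hm] at h0 h1 h2 h3 h4
      intro i; fin_cases i <;> simp [h0, h1, h2, h3, h4]
    · rw [hd, bracket_eq_family₃]
      fin_cases i <;> simp [nodeVal, rowMap, Fin.sum_univ_five]; ring
  · refine mem_orbitGL_node !![l + m, 0, 0, 0, 0; 0, 1, 0, 0, 0; 0, 0, 1, 0, 0;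
      0, 0, 0, 1, 0; 0, 0, 0, 0, 1] (fun u hu => ?_) (fun i u v => ?_)
    · have h0 := hu 0
      have h1 := hu 1
      have h2 := hu 2
      have h3 := hu 3
      have h4 := hu 4
      simp [Fin.sum_univ_five, hp] at h0 h1 h2 h3 h4
      intro i; fin_cases i <;> simp [h0, h1, h2, h3, h4]
    · rw [hd, bracket_eq_family₃, hm]
      fin_cases i <;> simp [nodeVal, rowMap, Fin.sum_univ_five]; ring
  · refine mem_orbitGL_node !![0, 0, l - m, 0, 0; 0, 0, 0, 1, 0; 1, 0, 0, 0, 0;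
      0, 1, 0, 0, 0; 0, 0, 0, 0, 1] (fun u hu => ?_) (fun i u v => ?_)
    · have h0 := hu 0
      have h1 := hu 1
      have h2 := hu 2
      have h3 := hu 3
      have h4 := hu 4
      simp [Fin.sum_univ_five, hm] at h0 h1 h2 h3 h4
      intro i; fin_cases i <;> simp [h0, h1, h2, h3, h4]
    · rw [hd, bracket_eq_family₃, hp]
      fin_cases i <;> simp [nodeVal, rowMap, Fin.sum_univ_five]; ring

theorem eq_zero_or_mem_orbitGL_node {d : Brackets} (hd : d.1 ∈ family₁ ∪ family₂ ∪ family₃) :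
    d.1 = 0 ∨ ∃ n, d ∈ orbitGL (node n) := by
  have h0 : (∀ x y, bracket d.1 x y = 0) → d.1 = 0 ∨ ∃ n, d ∈ orbitGL (node n) :=
    fun h => Or.inl (bracket_eq_zero_iff.1 h)
  rcases hd with (⟨l, m, h, k, hd⟩ | ⟨x, y, h, k, l, m, hr, hd⟩) | ⟨l, m, hd⟩
  · obtain ⟨c1, c2, c3, c4, c5⟩ := family₁_classify hd
    by_cases hl : l = 0
    · by_cases hdet : h ^ 2 = k * m
      · by_cases hk : k = 0
        · obtain rfl : h = 0 := by simpa [hk] using hdet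
          by_cases hm : m = 0
          · refine h0 fun x y => ?_
            rw [hd, bracket_eq_family₁, hl, hk, hm]
            ext i; fin_cases i <;> simp
          · exact Or.inr ⟨_, c5 hl rfl hk hm⟩
        · exact Or.inr ⟨_, c4 hl hdet hk⟩
      · exact Or.inr ⟨_, c3 hl hdet⟩
    · by_cases hk : k = 0
      · exact Or.inr ⟨_, c2 hl hk⟩
      · exact Or.inr ⟨_, c1 hl hk⟩
  · obtain ⟨c1, c2, c3, c4, c5⟩ := family₂_classify hr hd
    by_cases hx : x = 0
    · by_cases hh : h = 0
      · by_cases hl : l = 0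
        · by_cases hm : m = 0
          · by_cases hk : k = 0
            · have hy : y = 0 := by
                have := minor_eq_zero hr 1 3
                simpa [hm] using this
              refine h0 fun u v => ?_
              rw [hd, bracket_eq_family₂, hx, hh, hl, hm, hk, hy]
              ext i; fin_cases i <;> simp
            · exact Or.inr ⟨_, c5 hx hh hl hm hk⟩
          · exact Or.inr ⟨_, c4 hx hh hl hm⟩
        · exact Or.inr ⟨_, c3 hx hh hl⟩
      · exact Or.inr ⟨_, c2 hx hh⟩
    · exact Or.inr ⟨_, c1 hx⟩
  · obtain ⟨c1, c2, c3⟩ := family₃_classify hd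
    by_cases hp : l + m = 0
    · by_cases hm : l - m = 0
      · refine h0 fun x y => ?_
        rw [hd, bracket_eq_family₃, hp, hm]
        ext i; fin_cases i <;> simp
      · exact Or.inr ⟨_, c3 hp hm⟩
    · by_cases hm : l - m = 0
      · exact Or.inr ⟨_, c2 hp hm⟩
      · exact Or.inr ⟨_, c1 hp hm⟩

/-! ### Nilpotency of the families and the first equivalence -/

theorem node_isNilpotent (n : Node) : LieRing.IsNilpotent (LieAlg (node n)) := by
  refine isNilpotent_of_triangular fun i j k hik => ?_
  rw [← neg_eq_zero, ← bracket_basis, bracket_node, neg_eq_zero]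
  cases n <;> fin_cases i <;> fin_cases k <;> simp [nodeVal] at hik ⊢

theorem isNilpotent_of_mem_family {d : Brackets} (hd : d.1 ∈ family₁ ∪ family₂ ∪ family₃) :
    LieRing.IsNilpotent (LieAlg d) := by
  rcases eq_zero_or_mem_orbitGL_node hd with h | ⟨n, hn⟩
  · refine isNilpotent_of_triangular fun i j k _ => ?_
    rw [h]
    rfl
  · exact isNilpotent_of_mem_orbitGL hn (node_isNilpotent n)

theorem nilpotent_and_hypo_iff (d : Brackets) :
    (LieRing.IsNilpotent (LieAlg d) ∧ IsHypo d) ↔ MeetsFamily d := by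
  refine ⟨fun h => meetsFamily_of_isHypo h.2 h.1, ?_⟩
  rintro ⟨f, hf, h⟩
  have h' : (actU f d).1 ∈ family₁ ∪ family₂ ∪ family₃ := h
  exact ⟨isNilpotent_of_mem_orbitGL (mem_orbitGL_symm (actU_mem_orbitGL f d))
    (isNilpotent_of_mem_family h'), (isHypo_of_mem_family h').of_actU hf⟩

/-! ### Topology -/

theorem continuous_ofTuple : Continuous ofTuple := by
  refine continuous_clm_apply.2 fun α => ?_
  simp only [ofTuple_apply]
  fun_prop

theorem continuous_bracket {T : Type*} [TopologicalSpace T] {d : T → Hom12} {u v : T → V}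
    (hd : Continuous d) (hu : Continuous u) (hv : Continuous v) :
    Continuous fun t => bracket (d t) (u t) (v t) := by
  have hc : ∀ i j k, Continuous fun t => coef (d t) i j k := fun i j k => by
    have h1 : Continuous fun t => d t (coframe i) := hd.clm_apply continuous_const
    exact (ContinuousAlternatingMap.apply ℝ V ℝ ![basisVec j, basisVec k]).continuous.comp h1
  have hb : ∀ i, Continuous fun t => bracket (d t) (u t) (v t) i := fun i => by
    simp only [bracket_val, twoFormVal]
    have hu' : ∀ i, Continuous fun t => u t i := fun i => by fun_prop
    have hv' : ∀ i, Continuous fun t => v t i := fun i => by fun_prop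
    have := hc i
    fun_prop
  have : (fun t => bracket (d t) (u t) (v t)) =
      fun t => WithLp.toLp 2 (fun i => bracket (d t) (u t) (v t) i) := rfl
  rw [this]
  exact (PiLp.continuous_toLp 2 _).comp (continuous_pi hb)

theorem continuous_bracket_brackets (x y : V) : Continuous fun d : Brackets => bracket d.1 x y :=
  continuous_bracket continuous_subtype_val continuous_const continuous_const

/-! ### Invariants of the orbits -/

/-- The differentials of one-forms are proportional. -/
def DerivedRankLeOne (d : Brackets) : Prop := ∀ (α β : OneForm) (x y z w : V),
  α (bracket d.1 x y) * β (bracket d.1 z w) = α (bracket d.1 z w) * β (bracket d.1 x y)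

/-- The differentials of one-forms are decomposable. -/
def Decomposable (d : Brackets) : Prop := ∀ (α : OneForm) (x y z w : V),
  α (bracket d.1 x y) * α (bracket d.1 z w) - α (bracket d.1 x z) * α (bracket d.1 y w) +
    α (bracket d.1 x w) * α (bracket d.1 y z) = 0

/-- Iterated brackets of length four vanish. -/
def ThreeStep (d : Brackets) : Prop := ∀ x y z w : V,
  bracket d.1 (bracket d.1 (bracket d.1 x y) z) w = 0

theorem DerivedRankLeOne.of_mem_orbitGL {d d' : Brackets} (h : DerivedRankLeOne d)
    (hd : d' ∈ orbitGL d) : DerivedRankLeOne d' := by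
  obtain ⟨f, hf⟩ := hd
  intro α β x y z w
  rw [hf]
  simp only [bracket_act]
  exact h (α.comp (f : V →L[ℝ] V)) (β.comp (f : V →L[ℝ] V)) _ _ _ _

theorem Decomposable.of_mem_orbitGL {d d' : Brackets} (h : Decomposable d)
    (hd : d' ∈ orbitGL d) : Decomposable d' := by
  obtain ⟨f, hf⟩ := hd
  intro α x y z w
  rw [hf]
  simp only [bracket_act]
  exact h (α.comp (f : V →L[ℝ] V)) _ _ _ _

theorem ThreeStep.of_mem_orbitGL {d d' : Brackets} (h : ThreeStep d)
    (hd : d' ∈ orbitGL d) : ThreeStep d' := by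
  obtain ⟨f, hf⟩ := hd
  intro x y z w
  rw [hf]
  simp only [bracket_act, f.symm_apply_apply]
  rw [h, map_zero]

theorem isClosed_derivedRankLeOne : IsClosed {d | DerivedRankLeOne d} := by
  simp only [DerivedRankLeOne, Set.ofPred_forall]
  refine isClosed_iInter fun α => isClosed_iInter fun β => isClosed_iInter fun x =>
    isClosed_iInter fun y => isClosed_iInter fun z => isClosed_iInter fun w => ?_
  have := continuous_bracket_brackets
  exact isClosed_eq (by fun_prop) (by fun_prop)

theorem isClosed_decomposable : IsClosed {d | Decomposable d} := by
  simp only [Decomposable, Set.ofPred_forall]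
  refine isClosed_iInter fun α => isClosed_iInter fun x =>
    isClosed_iInter fun y => isClosed_iInter fun z => isClosed_iInter fun w => ?_
  have := continuous_bracket_brackets
  exact isClosed_eq (by fun_prop) (by fun_prop)

theorem isClosed_threeStep : IsClosed {d | ThreeStep d} := by
  simp only [ThreeStep, Set.ofPred_forall]
  refine isClosed_iInter fun x => isClosed_iInter fun y => isClosed_iInter fun z =>
    isClosed_iInter fun w => ?_
  exact isClosed_eq (continuous_bracket continuous_subtype_val (continuous_bracket
    continuous_subtype_val (continuous_bracket_brackets x y) continuous_const) continuous_const)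
    continuous_const

theorem node_derivedRankLeOne {n : Node} (h : n = .b ∨ n = .c) : DerivedRankLeOne (node n) := by
  intro α β x y z w
  rw [oneForm_apply α, oneForm_apply α, oneForm_apply β, oneForm_apply β]
  simp only [bracket_node, Fin.sum_univ_five]
  rcases h with rfl | rfl <;> simp [nodeVal] <;> ring

theorem node_not_derivedRankLeOne {n : Node} (h : n = .a ∨ n = .f ∨ n = .g) :
    ¬ DerivedRankLeOne (node n) := by
  intro hd
  rcases h with rfl | rfl | rfl
  · have := hd (coframe 3) (coframe 4) (basisVec 0) (basisVec 1) (basisVec 0) (basisVec 2)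
    simp [bracket_node, nodeVal] at this
  · have := hd (coframe 2) (coframe 3) (basisVec 0) (basisVec 1) (basisVec 0) (basisVec 2)
    simp [bracket_node, nodeVal] at this
  · have := hd (coframe 3) (coframe 4) (basisVec 0) (basisVec 1) (basisVec 0) (basisVec 2)
    simp [bracket_node, nodeVal] at this

theorem node_decomposable {n : Node} (h : n = .c ∨ n = .f ∨ n = .g) : Decomposable (node n) := by
  intro α x y z w
  simp only [oneForm_apply α (bracket _ _ _), bracket_node, Fin.sum_univ_five]
  rcases h with rfl | rfl | rfl <;> simp [nodeVal] <;> ring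

theorem node_not_decomposable {n : Node} (h : n = .a ∨ n = .b) : ¬ Decomposable (node n) := by
  intro hd
  rcases h with rfl | rfl
  · have := hd (coframe 4) (basisVec 0) (basisVec 2) (basisVec 1) (basisVec 3)
    simp [bracket_node, nodeVal] at this
  · have := hd (coframe 4) (basisVec 0) (basisVec 1) (basisVec 2) (basisVec 3)
    simp [bracket_node, nodeVal] at this

theorem node_threeStep {n : Node} (h : n ≠ .f) : ThreeStep (node n) := by
  intro x y z w
  ext i
  rw [bracket_node]
  cases n <;> fin_cases i <;> simp [nodeVal, bracket_node] at h ⊢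

theorem node_f_not_threeStep : ¬ ThreeStep (node .f) := by
  intro hd
  have := congrArg (fun v : V => v 4) (hd (basisVec 0) (basisVec 1) (basisVec 0) (basisVec 0))
  simp [nodeVal, bracket_node] at this

/-! ### Degenerations -/

/-- A closed condition invariant under `GL(5, ℝ)` that separates two nodes. -/
theorem exists_invariant {n₁ n₂ : Node} (hn : n₁ ≠ n₂) (h : ¬ Arrow n₁ n₂) :
    ∃ C : Set Brackets, IsClosed C ∧ (∀ d ∈ C, orbitGL d ⊆ C) ∧ node n₁ ∈ C ∧ node n₂ ∉ C := by
  have hR : (n₁ = .b ∨ n₁ = .c) → (n₂ = .a ∨ n₂ = .f ∨ n₂ = .g) → _ := fun h₁ h₂ =>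
    (⟨_, isClosed_derivedRankLeOne, fun d hd d' hd' => DerivedRankLeOne.of_mem_orbitGL hd hd',
      node_derivedRankLeOne h₁, node_not_derivedRankLeOne h₂⟩ :
    ∃ C : Set Brackets, IsClosed C ∧ (∀ d ∈ C, orbitGL d ⊆ C) ∧ node n₁ ∈ C ∧ node n₂ ∉ C)
  have hD : (n₁ = .c ∨ n₁ = .f ∨ n₁ = .g) → (n₂ = .a ∨ n₂ = .b) → _ := fun h₁ h₂ =>
    (⟨_, isClosed_decomposable, fun d hd d' hd' => Decomposable.of_mem_orbitGL hd hd',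
      node_decomposable h₁, node_not_decomposable h₂⟩ :
    ∃ C : Set Brackets, IsClosed C ∧ (∀ d ∈ C, orbitGL d ⊆ C) ∧ node n₁ ∈ C ∧ node n₂ ∉ C)
  have hT : n₁ ≠ .f → n₂ = .f → _ := fun h₁ h₂ =>
    (⟨_, isClosed_threeStep, fun d hd d' hd' => ThreeStep.of_mem_orbitGL hd hd',
      node_threeStep h₁, h₂ ▸ node_f_not_threeStep⟩ :
    ∃ C : Set Brackets, IsClosed C ∧ (∀ d ∈ C, orbitGL d ⊆ C) ∧ node n₁ ∈ C ∧ node n₂ ∉ C)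
  cases n₁ <;> cases n₂ <;>
    first
    | exact absurd rfl hn
    | exact absurd (by constructor) h
    | exact hT (by rintro ⟨⟩) rfl
    | (refine hR ?_ ?_ <;> (simp; done))
    | (refine hD ?_ ?_ <;> (simp; done))

theorem arrow_asymm {n₁ n₂ : Node} (h : Arrow n₁ n₂) : ¬ Arrow n₂ n₁ := by
  intro h'
  cases h <;> cases h'

/-- Arrows are asymmetric, so for distinct nodes at least one direction is not an arrow, and its
invariant separates the orbits. -/
theorem node_injective {n₁ n₂ : Node} (h : node n₂ ∈ orbitGL (node n₁)) : n₁ = n₂ := by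
  by_contra hn
  by_cases ha : Arrow n₁ n₂
  · obtain ⟨C, -, hC, h1, h2⟩ := exists_invariant (Ne.symm hn) (arrow_asymm ha)
    exact h2 (hC _ h1 (mem_orbitGL_symm h))
  · obtain ⟨C, -, hC, h1, h2⟩ := exists_invariant hn ha
    exact h2 (hC _ h1 h)

/-- A curve whose points other than the origin belong to an orbit. -/
theorem mem_closure_of_curve {n : Node} {d : Brackets} (τ : ℝ → Fin 5 → Form 2)
    (hτ : ∀ i, Continuous fun ε => τ ε i)
    (hJ : ∀ ε x y z, bracket (ofTuple (τ ε)) (bracket (ofTuple (τ ε)) x y) z -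
      bracket (ofTuple (τ ε)) (bracket (ofTuple (τ ε)) x z) y +
      bracket (ofTuple (τ ε)) (bracket (ofTuple (τ ε)) y z) x = 0)
    (h0 : d.1 = ofTuple (τ 0))
    (h : ∀ ε ≠ 0, ∀ d' : Brackets, d'.1 = ofTuple (τ ε) → d' ∈ orbitGL (node n)) :
    d ∈ closure (orbitGL (node n)) := by
  let γ : ℝ → Brackets := fun ε => ⟨ofTuple (τ ε), (jacobi_iff _).2 (hJ ε)⟩
  have hγ : Continuous γ :=
    Continuous.subtype_mk (continuous_ofTuple.comp (continuous_pi hτ)) _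
  have hd : d = γ 0 := Subtype.ext h0
  rw [hd]
  refine mem_closure_of_tendsto (b := nhdsWithin 0 {0}ᶜ)
    (hγ.continuousAt.tendsto.mono_left nhdsWithin_le_nhds) ?_
  filter_upwards [self_mem_nhdsWithin] with ε hε
  exact h ε hε _ rfl

/-! ### The arrows of the diagram -/

/-- In this and the following degenerations the coframe is renumbered so that the terms to be lost
carry a factor ε. For ε ≠ 0 a monomial rescaling by powers of ε recovers the source node. -/
theorem node_b_mem_closure_a : node .b ∈ closure (orbitGL (node .a)) := by
  have hb : ∀ (ε : ℝ) (x y : V), bracket (ofTuple ![0, 0, 0, ε • (e₁ ⋏ e₃), e₁ ⋏ e₂ + e₃ ⋏ e₄]) x y =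
      !₂[0, 0, 0, -(ε * (x 0 * y 2 - x 2 * y 0)), -((x 0 * y 1 - x 1 * y 0) + (x 2 * y 3 - x 3 * y 2))] := by
    intro ε x y
    ext i
    rw [bracket_ofTuple]
    fin_cases i <;> simp [wedgeTwo_apply, -mul_eq_mul_left_iff, -neg_add_rev] <;> ring
  refine mem_closure_of_curve (fun ε => ![0, 0, 0, ε • (e₁ ⋏ e₃), e₁ ⋏ e₂ + e₃ ⋏ e₄])
    (fun i => ?_) (fun ε x y z => ?_) ?_ (fun ε hε d hd => ?_)
  · fin_cases i <;> simp <;> fun_prop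
  · simp only [hb]
    ext i
    fin_cases i <;> simp <;> ring
  · rw [node]
    simp [nodeTuple]
  · refine mem_orbitGL_node !![1, 0, 0, 0, 0; 0, 0, ε, 0, 0; 0, ε, 0, 0, 0; 0, 0, 0, 1, 0; 0, 0, 0, 0, ε]
      (fun x hx => ?_) (fun i x y => ?_)
    · have h0 := hx 0
      have h1 := hx 1
      have h2 := hx 2
      have h3 := hx 3
      have h4 := hx 4
      simp [Fin.sum_univ_five, hε] at h0 h1 h2 h3 h4
      intro i; fin_cases i <;> simp [h0, h1, h2, h3, h4]
    · rw [hd, hb]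
      fin_cases i <;> simp [nodeVal, rowMap, Fin.sum_univ_five] <;> ring

theorem node_g_mem_closure_a : node .g ∈ closure (orbitGL (node .a)) := by
  have hb : ∀ (ε : ℝ) (x y : V), bracket (ofTuple ![0, 0, 0, e₁ ⋏ e₂, e₁ ⋏ e₃ + ε • (e₂ ⋏ e₄)]) x y =
      !₂[0, 0, 0, -((x 0 * y 1 - x 1 * y 0)), -((x 0 * y 2 - x 2 * y 0) + ε * (x 1 * y 3 - x 3 * y 1))] := by
    intro ε x y
    ext i
    rw [bracket_ofTuple]
    fin_cases i <;> simp [wedgeTwo_apply, -mul_eq_mul_left_iff, -neg_add_rev] <;> ring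
  refine mem_closure_of_curve (fun ε => ![0, 0, 0, e₁ ⋏ e₂, e₁ ⋏ e₃ + ε • (e₂ ⋏ e₄)])
    (fun i => ?_) (fun ε x y z => ?_) ?_ (fun ε hε d hd => ?_)
  · fin_cases i <;> simp <;> fun_prop
  · simp only [hb]
    ext i
    fin_cases i <;> simp <;> ring
  · rw [node]
    simp [nodeTuple]
  · refine mem_orbitGL_node !![1, 0, 0, 0, 0; 0, ε, 0, 0, 0; 0, 0, ε, 0, 0; 0, 0, 0, ε, 0; 0, 0, 0, 0, ε]
      (fun x hx => ?_) (fun i x y => ?_)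
    · have h0 := hx 0
      have h1 := hx 1
      have h2 := hx 2
      have h3 := hx 3
      have h4 := hx 4
      simp [Fin.sum_univ_five, hε] at h0 h1 h2 h3 h4
      intro i; fin_cases i <;> simp [h0, h1, h2, h3, h4]
    · rw [hd, hb]
      fin_cases i <;> simp [nodeVal, rowMap, Fin.sum_univ_five] <;> ring

theorem node_c_mem_closure_a : node .c ∈ closure (orbitGL (node .a)) := by
  have hb : ∀ (ε : ℝ) (x y : V), bracket (ofTuple ![0, 0, 0, ε • (e₁ ⋏ e₃), e₁ ⋏ e₂ + ε • (e₃ ⋏ e₄)]) x y =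
      !₂[0, 0, 0, -(ε * (x 0 * y 2 - x 2 * y 0)), -((x 0 * y 1 - x 1 * y 0) + ε * (x 2 * y 3 - x 3 * y 2))] := by
    intro ε x y
    ext i
    rw [bracket_ofTuple]
    fin_cases i <;> simp [wedgeTwo_apply, -mul_eq_mul_left_iff, -neg_add_rev] <;> ring
  refine mem_closure_of_curve (fun ε => ![0, 0, 0, ε • (e₁ ⋏ e₃), e₁ ⋏ e₂ + ε • (e₃ ⋏ e₄)])
    (fun i => ?_) (fun ε x y z => ?_) ?_ (fun ε hε d hd => ?_)
  · fin_cases i <;> simp <;> fun_prop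
  · simp only [hb]
    ext i
    fin_cases i <;> simp <;> ring
  · rw [node]
    simp [nodeTuple]
  · refine mem_orbitGL_node !![1, 0, 0, 0, 0; 0, 0, ε, 0, 0; 0, 1, 0, 0, 0; 0, 0, 0, 1, 0; 0, 0, 0, 0, 1]
      (fun x hx => ?_) (fun i x y => ?_)
    · have h0 := hx 0
      have h1 := hx 1
      have h2 := hx 2
      have h3 := hx 3
      have h4 := hx 4
      simp [Fin.sum_univ_five, hε] at h0 h1 h2 h3 h4
      intro i; fin_cases i <;> simp [h0, h1, h2, h3, h4]
    · rw [hd, hb]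
      fin_cases i <;> simp [nodeVal, rowMap, Fin.sum_univ_five] <;> ring

theorem node_c_mem_closure_b : node .c ∈ closure (orbitGL (node .b)) := by
  have hb : ∀ (ε : ℝ) (x y : V), bracket (ofTuple ![0, 0, 0, 0, e₁ ⋏ e₂ + ε • (e₃ ⋏ e₄)]) x y =
      !₂[0, 0, 0, 0, -((x 0 * y 1 - x 1 * y 0) + ε * (x 2 * y 3 - x 3 * y 2))] := by
    intro ε x y
    ext i
    rw [bracket_ofTuple]
    fin_cases i <;> simp [wedgeTwo_apply, -mul_eq_mul_left_iff, -neg_add_rev] <;> ring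
  refine mem_closure_of_curve (fun ε => ![0, 0, 0, 0, e₁ ⋏ e₂ + ε • (e₃ ⋏ e₄)])
    (fun i => ?_) (fun ε x y z => ?_) ?_ (fun ε hε d hd => ?_)
  · fin_cases i <;> simp <;> fun_prop
  · simp only [hb]
    ext i
    fin_cases i <;> simp
  · rw [node]
    simp [nodeTuple]
  · refine mem_orbitGL_node !![1, 0, 0, 0, 0; 0, 1, 0, 0, 0; 0, 0, ε, 0, 0; 0, 0, 0, 1, 0; 0, 0, 0, 0, 1]
      (fun x hx => ?_) (fun i x y => ?_)
    · have h0 := hx 0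
      have h1 := hx 1
      have h2 := hx 2
      have h3 := hx 3
      have h4 := hx 4
      simp [Fin.sum_univ_five, hε] at h0 h1 h2 h3 h4
      intro i; fin_cases i <;> simp [h0, h1, h2, h3, h4]
    · rw [hd, hb]
      fin_cases i <;> simp [nodeVal, rowMap, Fin.sum_univ_five] <;> ring

theorem node_c_mem_closure_g : node .c ∈ closure (orbitGL (node .g)) := by
  have hb : ∀ (ε : ℝ) (x y : V), bracket (ofTuple ![0, 0, 0, ε • (e₁ ⋏ e₃), e₁ ⋏ e₂]) x y =
      !₂[0, 0, 0, -(ε * (x 0 * y 2 - x 2 * y 0)), -((x 0 * y 1 - x 1 * y 0))] := by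
    intro ε x y
    ext i
    rw [bracket_ofTuple]
    fin_cases i <;> simp [wedgeTwo_apply, -mul_eq_mul_left_iff, -neg_add_rev] <;> ring
  refine mem_closure_of_curve (fun ε => ![0, 0, 0, ε • (e₁ ⋏ e₃), e₁ ⋏ e₂])
    (fun i => ?_) (fun ε x y z => ?_) ?_ (fun ε hε d hd => ?_)
  · fin_cases i <;> simp <;> fun_prop
  · simp only [hb]
    ext i
    fin_cases i <;> simp
  · rw [node]
    simp [nodeTuple]
  · refine mem_orbitGL_node !![1, 0, 0, 0, 0; 0, 0, ε, 0, 0; 0, 1, 0, 0, 0; 0, 0, 0, 1, 0; 0, 0, 0, 0, 1]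
      (fun x hx => ?_) (fun i x y => ?_)
    · have h0 := hx 0
      have h1 := hx 1
      have h2 := hx 2
      have h3 := hx 3
      have h4 := hx 4
      simp [Fin.sum_univ_five, hε] at h0 h1 h2 h3 h4
      intro i; fin_cases i <;> simp [h0, h1, h2, h3, h4]
    · rw [hd, hb]
      fin_cases i <;> simp [nodeVal, rowMap, Fin.sum_univ_five] <;> ring

theorem node_g_mem_closure_f : node .g ∈ closure (orbitGL (node .f)) := by
  have hb : ∀ (ε : ℝ) (x y : V), bracket (ofTuple ![0, 0, ε • (e₁ ⋏ e₄), e₁ ⋏ e₂, e₁ ⋏ e₃]) x y =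
      !₂[0, 0, -(ε * (x 0 * y 3 - x 3 * y 0)), -((x 0 * y 1 - x 1 * y 0)), -((x 0 * y 2 - x 2 * y 0))] := by
    intro ε x y
    ext i
    rw [bracket_ofTuple]
    fin_cases i <;> simp [wedgeTwo_apply, -mul_eq_mul_left_iff, -neg_add_rev] <;> ring
  refine mem_closure_of_curve (fun ε => ![0, 0, ε • (e₁ ⋏ e₄), e₁ ⋏ e₂, e₁ ⋏ e₃])
    (fun i => ?_) (fun ε x y z => ?_) ?_ (fun ε hε d hd => ?_)
  · fin_cases i <;> simp <;> fun_prop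
  · simp only [hb]
    ext i
    fin_cases i <;> simp <;> ring
  · rw [node]
    simp [nodeTuple]
  · refine mem_orbitGL_node !![1, 0, 0, 0, 0; 0, ε, 0, 0, 0; 0, 0, 0, ε, 0; 0, 0, 1, 0, 0; 0, 0, 0, 0, 1]
      (fun x hx => ?_) (fun i x y => ?_)
    · have h0 := hx 0
      have h1 := hx 1
      have h2 := hx 2
      have h3 := hx 3
      have h4 := hx 4
      simp [Fin.sum_univ_five, hε] at h0 h1 h2 h3 h4
      intro i; fin_cases i <;> simp [h0, h1, h2, h3, h4]
    · rw [hd, hb]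
      fin_cases i <;> simp [nodeVal, rowMap, Fin.sum_univ_five] <;> ring

theorem node_c_mem_closure_f : node .c ∈ closure (orbitGL (node .f)) := by
  have hb : ∀ (ε : ℝ) (x y : V), bracket (ofTuple ![0, 0, ε • (e₁ ⋏ e₄), ε • (e₁ ⋏ e₅), e₁ ⋏ e₂]) x y =
      !₂[0, 0, -(ε * (x 0 * y 3 - x 3 * y 0)), -(ε * (x 0 * y 4 - x 4 * y 0)), -((x 0 * y 1 - x 1 * y 0))] := by
    intro ε x y
    ext i
    rw [bracket_ofTuple]
    fin_cases i <;> simp [wedgeTwo_apply, -mul_eq_mul_left_iff, -neg_add_rev] <;> ring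
  refine mem_closure_of_curve (fun ε => ![0, 0, ε • (e₁ ⋏ e₄), ε • (e₁ ⋏ e₅), e₁ ⋏ e₂])
    (fun i => ?_) (fun ε x y z => ?_) ?_ (fun ε hε d hd => ?_)
  · fin_cases i <;> simp <;> fun_prop
  · simp only [hb]
    ext i
    fin_cases i <;> simp <;> ring
  · rw [node]
    simp [nodeTuple]
  -- Along the chain e³, e⁴, e⁵, e² two of the three links carry a factor ε, so the accumulated
  -- weights are 1, ε, ε², ε².
  · refine mem_orbitGL_node !![1, 0, 0, 0, 0; 0, ε ^ 2, 0, 0, 0; 0, 0, 0, 0, ε ^ 2; 0, 0, 0, ε, 0; 0, 0, 1, 0, 0]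
      (fun x hx => ?_) (fun i x y => ?_)
    · have h0 := hx 0
      have h1 := hx 1
      have h2 := hx 2
      have h3 := hx 3
      have h4 := hx 4
      simp [Fin.sum_univ_five, hε] at h0 h1 h2 h3 h4
      intro i; fin_cases i <;> simp [h0, h1, h2, h3, h4]
    · rw [hd, hb]
      fin_cases i <;> simp [nodeVal, rowMap, Fin.sum_univ_five] <;> ring

theorem arrow_iff {n₁ n₂ : Node} (hn : n₁ ≠ n₂) :
    Arrow n₁ n₂ ↔ node n₂ ∈ closure (orbitGL (node n₁)) := by
  constructor
  · intro h
    cases h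
    exacts [node_c_mem_closure_a, node_b_mem_closure_a, node_g_mem_closure_a, node_c_mem_closure_b,
      node_g_mem_closure_f, node_c_mem_closure_f, node_c_mem_closure_g]
  · intro h
    by_contra ha
    obtain ⟨C, hcl, hC, h1, h2⟩ := exists_invariant hn ha
    exact h2 (closure_minimal (hC _ h1) hcl h)

/-! ### Points of `𝒟` in the three families -/

/-- The element of the first family with given parameters. -/
def pointOne (l m h k : ℝ) : Brackets :=
  ⟨ofTuple ![l • (e₃ ⋏ e₅), h • (e₃ ⋏ e₅) + k • (e₁ ⋏ e₅), 0,
    ((-l) • e₂ + h • e₁ + m • e₃) ⋏ e₅, 0], (jacobi_iff _).2 fun x y z => by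
      simp only [bracket_eq_family₁]
      ext i
      fin_cases i <;> simp <;> ring⟩

/-- The elements of the second family, with the rank condition solved by parameters. -/
def pointTwo (A B p q : ℝ) : Brackets :=
  -- The rows are q and -p times (Ap, Bp, -Aq, -Bq), so p times the first plus q times the second
  -- vanishes; a pair (p, q) ≠ 0 thus gives rank less than two.
  ⟨ofTuple ![0, (A * p * q) • (e₃ ⋏ e₄) + (-(A * q ^ 2)) • (e₃ ⋏ e₅), 0,
    (A * p * q) • (e₁ ⋏ e₄ - e₂ ⋏ e₃) - (B * p * q) • (e₃ ⋏ e₄) + (-(A * q ^ 2)) • (e₁ ⋏ e₅)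
      - (-(B * q ^ 2)) • (e₃ ⋏ e₅),
    (-(-(A * p ^ 2))) • (e₁ ⋏ e₄ - e₂ ⋏ e₃) + (-(B * p ^ 2)) • (e₃ ⋏ e₄)
      - (A * p * q) • (e₁ ⋏ e₅) + (B * p * q) • (e₃ ⋏ e₅)], (jacobi_iff _).2 fun x y z => by
      simp only [bracket_eq_family₂]
      ext i
      fin_cases i <;> simp <;> ring⟩

/-- The element of the third family with given parameters. -/
def pointThree (l m : ℝ) : Brackets :=
  ⟨ofTuple ![0, 0, 0, 0, (l + m) • (e₁ ⋏ e₂) + (l - m) • (e₃ ⋏ e₄)],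
    (jacobi_iff _).2 fun x y z => by
      simp only [bracket_eq_family₃]
      ext i
      fin_cases i <;> simp⟩

theorem pointOne_mem (l m h k : ℝ) : (pointOne l m h k).1 ∈ family₁ ∪ family₂ ∪ family₃ :=
  Or.inl (Or.inl ⟨l, m, h, k, rfl⟩)

theorem rank_pointTwo {A B p q : ℝ} (hpq : p ≠ 0 ∨ q ≠ 0) :
    (!![A * p * q, B * p * q, -(A * q ^ 2), -(B * q ^ 2);
      -(A * p ^ 2), -(B * p ^ 2), A * p * q, B * p * q]).rank < 2 := by
  refine rank_lt_two_of_rows p q hpq fun j => ?_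
  fin_cases j <;> simp <;> ring

theorem pointTwo_mem {A B p q : ℝ} (hpq : p ≠ 0 ∨ q ≠ 0) :
    (pointTwo A B p q).1 ∈ family₁ ∪ family₂ ∪ family₃ :=
  Or.inl (Or.inr ⟨_, _, _, _, _, _, rank_pointTwo hpq, rfl⟩)

theorem pointThree_mem (l m : ℝ) : (pointThree l m).1 ∈ family₁ ∪ family₂ ∪ family₃ :=
  Or.inr ⟨l, m, rfl⟩

theorem exists_hypo_mem_orbitGL (n : Node) : ∃ d ∈ orbitGL (node n), IsHypo d := by
  cases n
  · exact ⟨pointTwo 1 0 1 1, (family₂_classify (rank_pointTwo (Or.inl one_ne_zero)) rfl).1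
      (by norm_num), isHypo_of_mem_family (pointTwo_mem (Or.inl one_ne_zero))⟩
  · exact ⟨pointThree 1 0, (family₃_classify rfl).1 (by norm_num) (by norm_num),
      isHypo_of_mem_family (pointThree_mem _ _)⟩
  · exact ⟨pointThree 1 1, (family₃_classify rfl).2.1 (by norm_num) (by norm_num),
      isHypo_of_mem_family (pointThree_mem _ _)⟩
  · exact ⟨pointOne 1 0 0 1, (family₁_classify rfl).1 (by norm_num) (by norm_num),
      isHypo_of_mem_family (pointOne_mem _ _ _ _)⟩
  · exact ⟨pointOne 1 0 0 0, (family₁_classify rfl).2.1 (by norm_num) rfl,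
      isHypo_of_mem_family (pointOne_mem _ _ _ _)⟩

theorem node_unique {d : Brackets} {n n' : Node} (h : d ∈ orbitGL (node n))
    (h' : d ∈ orbitGL (node n')) : n = n' :=
  node_injective (mem_orbitGL_trans h (mem_orbitGL_symm h'))

/-! ### Lie algebras with a hypo structure -/

theorem isLieAbelian_iff_eq_zero {d : Brackets} : IsLieAbelian (LieAlg d) ↔ d.1 = 0 := by
  rw [← bracket_eq_zero_iff]
  exact ⟨fun h x y => h.trivial (show LieAlg d from x) (show LieAlg d from y), fun h => ⟨h⟩⟩

theorem node_ne_zero (n : Node) : (node n).1 ≠ 0 := by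
  rw [Ne, ← bracket_eq_zero_iff]
  intro h
  have h1 := fun i => congrArg (fun v : V => v i) (h (basisVec 0) (basisVec 1))
  cases n
  · simpa [bracket_node, nodeVal] using h1 3
  · simpa [bracket_node, nodeVal] using h1 4
  · simpa [bracket_node, nodeVal] using h1 4
  · simpa [bracket_node, nodeVal] using h1 2
  · simpa [bracket_node, nodeVal] using h1 3

theorem lieAlgebra_hypo_iff (𝔤 : Type*) [LieRing 𝔤] [LieAlgebra ℝ 𝔤] :
    (LieRing.IsNilpotent 𝔤 ∧ ¬ IsLieAbelian 𝔤 ∧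
      ∃ d : Brackets, Nonempty (𝔤 ≃ₗ⁅ℝ⁆ LieAlg d) ∧ IsHypo d) ↔
    ∃! n : Node, Nonempty (𝔤 ≃ₗ⁅ℝ⁆ LieAlg (node n)) := by
  constructor
  · rintro ⟨hn, ha, d, ⟨e⟩, hd⟩
    have hn' : LieRing.IsNilpotent (LieAlg d) := e.nilpotent_iff_equiv_nilpotent.1 hn
    obtain ⟨f, hf, hfam⟩ := meetsFamily_of_isHypo hd hn'
    rcases eq_zero_or_mem_orbitGL_node (d := actU f d) hfam with h | ⟨n, hn⟩
    · have h1 : d.1 = 0 := by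
        rw [← bracket_eq_zero_iff] at h ⊢
        intro x y
        refine f.injective ?_
        rw [← bracket_actU, h, map_zero]
      have h2 : IsLieAbelian (LieAlg d) := isLieAbelian_iff_eq_zero.2 h1
      exact absurd ((lie_abelian_iff_equiv_lie_abelian e).2 h2) ha
    · have hd' : d ∈ orbitGL (node n) :=
        mem_orbitGL_trans hn (mem_orbitGL_symm (actU_mem_orbitGL f d))
      obtain ⟨e'⟩ := mem_orbitGL_iff.1 hd'
      refine ⟨n, ⟨e.trans e'.symm⟩, ?_⟩
      rintro n' ⟨e''⟩
      exact node_injective (mem_orbitGL_iff.2 ⟨e''.symm.trans (e.trans e'.symm)⟩)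
  · rintro ⟨n, ⟨e⟩, -⟩
    obtain ⟨d, hd, hh⟩ := exists_hypo_mem_orbitGL n
    obtain ⟨e'⟩ := mem_orbitGL_iff.1 hd
    refine ⟨e.nilpotent_iff_equiv_nilpotent.2 (node_isNilpotent n), fun ha => ?_,
      d, ⟨e.trans e'⟩, hh⟩
    exact node_ne_zero n (isLieAbelian_iff_eq_zero.1
      ((lie_abelian_iff_equiv_lie_abelian e).1 ha))

/-! ### Degenerations of hypo structures -/

/-- By the first part of the theorem every class has a representative in the families, and the
quotient map, being continuous, sends closures into closures. -/
theorem hypoSpace_subset_closure {n₁ n₂ : Node}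
    (h : ∀ d ∈ orbitGL (node n₂), d.1 ∈ family₁ ∪ family₂ ∪ family₃ → ∃ f ∈ U2,
      actU f d ∈ closure {d' | d' ∈ orbitGL (node n₁) ∧ IsHypo d'}) :
    hypoSpace (node n₂) ⊆ closure (hypoSpace (node n₁)) := by
  rintro _ ⟨d, ⟨hd, hh⟩, rfl⟩
  obtain ⟨f, hf, hfam⟩ :=
    meetsFamily_of_isHypo hh (isNilpotent_of_mem_orbitGL hd (node_isNilpotent n₂))
  obtain ⟨g, hg, hcl⟩ := h (actU f d) (mem_orbitGL_trans hd (actU_mem_orbitGL f d)) hfam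
  have h1 : (Quotient.mk u2Setoid d) = Quotient.mk u2Setoid (actU g (actU f d)) :=
    Quotient.sound (u2Setoid.trans ⟨f, hf, rfl⟩ (⟨g, hg, rfl⟩ : u2Setoid (actU f d) _))
  rw [h1]
  exact image_closure_subset_closure_image continuous_quotient_mk' ⟨_, hcl, rfl⟩

/-- A closed U(2)-invariant set `C` is the preimage of its image, so that image is closed in the
quotient topology. It suffices to test the members of the families against `C`. -/
theorem not_hypoSpace_subset_closure {n₁ n₂ : Node} {C : Set Brackets} (hC : IsClosed C)
    (hsat : ∀ d ∈ C, ∀ f ∈ U2, actU f d ∈ C)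
    (h : ∀ d ∈ orbitGL (node n₁), d.1 ∈ family₁ ∪ family₂ ∪ family₃ → d ∈ C)
    {d₂ : Brackets} (hd₂ : d₂ ∈ orbitGL (node n₂)) (hh₂ : IsHypo d₂) (h₂ : d₂ ∉ C) :
    ¬ hypoSpace (node n₂) ⊆ closure (hypoSpace (node n₁)) := by
  intro hsub
  have hpre : Quotient.mk u2Setoid ⁻¹' (Quotient.mk u2Setoid '' C) = C := by
    refine Set.Subset.antisymm ?_ (Set.subset_preimage_image _ _)
    rintro d ⟨d', hd', he⟩
    obtain ⟨f, hf, hfd⟩ := Quotient.exact he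
    have : d = actU f d' := Subtype.ext hfd
    rw [this]
    exact hsat d' hd' f hf
  have hcl : IsClosed (Quotient.mk u2Setoid '' C) := by
    rw [← isQuotientMap_quotient_mk'.isClosed_preimage]
    exact hpre.symm ▸ hC
  have hle : hypoSpace (node n₁) ⊆ Quotient.mk u2Setoid '' C := by
    rintro _ ⟨d, ⟨hd, hh⟩, rfl⟩
    obtain ⟨f, hf, hfam⟩ :=
      meetsFamily_of_isHypo hh (isNilpotent_of_mem_orbitGL hd (node_isNilpotent n₁))
    exact ⟨actU f d, h _ (mem_orbitGL_trans hd (actU_mem_orbitGL f d)) hfam,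
      Quotient.sound (u2Setoid.symm ⟨f, hf, rfl⟩)⟩
  have hmem := closure_minimal hle hcl (hsub ⟨d₂, ⟨hd₂, hh₂⟩, rfl⟩)
  exact h₂ (hpre ▸ hmem)

/-- A degeneration of hypo loci forces one of the orbits: the GL-invariant closed sets are in
particular U(2)-invariant. -/
theorem not_hypoSpace_subset_of_not_arrow {n₁ n₂ : Node} (hn : n₁ ≠ n₂) (ha : ¬ Arrow n₁ n₂) :
    ¬ hypoSpace (node n₂) ⊆ closure (hypoSpace (node n₁)) := by
  obtain ⟨C, hcl, hC, h1, h2⟩ := exists_invariant hn ha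
  obtain ⟨d, hd, hh⟩ := exists_hypo_mem_orbitGL n₂
  exact not_hypoSpace_subset_closure hcl (fun d hd f _ => hC d hd (actU_mem_orbitGL f d))
    (fun d hd _ => hC _ h1 hd) hd hh (fun hdC => h2 (hC d hdC (mem_orbitGL_symm hd)))

open Topology

theorem actU_one (d : Brackets) : actU 1 d = d :=
  Subtype.ext (hom12_ext_bracket fun x y => bracket_actU 1 d x y)

theorem actU_eq {f : V ≃ₗᵢ[ℝ] V} {d d' : Brackets}
    (h : ∀ x y, bracket d'.1 (f x) (f y) = f (bracket d.1 x y)) : actU f d = d' := by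
  refine Subtype.ext (hom12_ext_bracket fun x y => ?_)
  obtain ⟨x, rfl⟩ := f.surjective x
  obtain ⟨y, rfl⟩ := f.surjective y
  rw [bracket_actU, h]

theorem exists_bracket_ne_zero {n : Node} {d : Brackets} (hd : d ∈ orbitGL (node n)) :
    ¬ ∀ x y, bracket d.1 x y = 0 := by
  intro h
  obtain ⟨f, hf⟩ := mem_orbitGL_symm hd
  refine node_ne_zero n (bracket_eq_zero_iff.1 fun x y => ?_)
  rw [hf, bracket_act, h, map_zero]

/-! ### The closures containing a hypo locus -/

theorem eventually_add_ne_zero (p : ℝ) : ∀ᶠ ε in 𝓝[≠] (0 : ℝ), p + ε ≠ 0 := by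
  by_cases hp : p = 0
  · filter_upwards [self_mem_nhdsWithin] with ε hε
    simpa [hp] using hε
  · refine nhdsWithin_le_nhds (ContinuousAt.eventually_ne (by fun_prop) (by simpa using hp))

theorem mem_closure_of_eventually {S : Set Brackets} (γ : ℝ → Brackets) (hγ : Continuous γ)
    (h : ∀ᶠ ε in 𝓝[≠] (0 : ℝ), γ ε ∈ S) : γ 0 ∈ closure S :=
  mem_closure_of_tendsto (hγ.continuousAt.tendsto.mono_left nhdsWithin_le_nhds) h

/-- Replacing A, p, q by ε, p + ε, q + ε keeps the rank condition and makes x = Apq nonzero for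
small ε ≠ 0, which is the condition for node `a`. -/
theorem pointTwo_mem_closure (B p q : ℝ) :
    pointTwo 0 B p q ∈ closure {d | d ∈ orbitGL (node .a) ∧ IsHypo d} := by
  have h := mem_closure_of_eventually (S := {d | d ∈ orbitGL (node .a) ∧ IsHypo d})
    (fun ε => pointTwo ε B (p + ε) (q + ε))
    (Continuous.subtype_mk (continuous_ofTuple.comp (continuous_pi fun i => by
      fin_cases i <;> simp <;> fun_prop)) _) (by
      filter_upwards [self_mem_nhdsWithin, eventually_add_ne_zero p, eventually_add_ne_zero q]
        with ε hε hp hq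
      exact ⟨(family₂_classify (rank_pointTwo (Or.inl hp)) rfl).1 (mul_ne_zero (mul_ne_zero hε hp) hq),
        isHypo_of_mem_family (pointTwo_mem (Or.inl hp))⟩)
  simpa only [add_zero] using h

theorem add_wedgeTwo (α β γ : OneForm) : (α + β) ⋏ γ = α ⋏ γ + β ⋏ γ := add_wedge _ _ _

theorem smul_wedgeTwo (c : ℝ) (α β : OneForm) : (c • α) ⋏ β = c • (α ⋏ β) := by
  refine form_two_ext fun x y => ?_
  rw [ContinuousAlternatingMap.smul_apply, wedgeTwo_apply, wedgeTwo_apply]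
  simp
  ring

theorem pointOne_mem_closure (l m h k : ℝ) :
    pointOne l m h k ∈ closure {d | d ∈ orbitGL (node .f) ∧ IsHypo d} := by
  have h := mem_closure_of_eventually (S := {d | d ∈ orbitGL (node .f) ∧ IsHypo d})
    (fun ε => pointOne (l + ε) m h (k + ε))
    (Continuous.subtype_mk (continuous_ofTuple.comp (continuous_pi fun i => by
      fin_cases i <;> simp [add_wedgeTwo, smul_wedgeTwo, -neg_smul] <;> fun_prop)) _) (by
      filter_upwards [eventually_add_ne_zero l, eventually_add_ne_zero k] with ε hl hk
      exact ⟨(family₁_classify rfl).1 hl hk, isHypo_of_mem_family (pointOne_mem _ _ _ _)⟩)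
  simpa only [add_zero] using h

/-- A degenerate binary quadratic form kX² + 2hXY + mY² is a multiple s(aX + bY)² of a square. -/
theorem exists_eq_mul_sq {h k m : ℝ} (hd : h ^ 2 = k * m) :
    ∃ s a b : ℝ, 0 < a ^ 2 + b ^ 2 ∧ k = s * a ^ 2 ∧ h = s * (a * b) ∧ m = s * b ^ 2 := by
  by_cases hk : k = 0
  · exact ⟨m, 0, 1, by norm_num, by simp [hk], by simpa [hk] using hd, by simp⟩
  · refine ⟨k, 1, h / k, by positivity, by simp, by field_simp, ?_⟩
    field_simp
    linarith

/-- Up to U(2), each hypo structure on `c` in any of the families is a point of ℳ₂ with A = 0, and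
such points are limits of hypo structures on `a`. -/
theorem hypoSpace_c_subset : hypoSpace (node .c) ⊆ closure (hypoSpace (node .a)) := by
  refine hypoSpace_subset_closure fun d hc hd => ?_
  suffices h : ∃ f ∈ U2, ∃ B p q, actU f d = pointTwo 0 B p q by
    obtain ⟨f, hf, B, p, q, he⟩ := h
    exact ⟨f, hf, he ▸ pointTwo_mem_closure B p q⟩
  rcases hd with (⟨l, m, h, k, hd⟩ | ⟨x, y, h, k, l, m, hr, hd⟩) | ⟨l, m, hd⟩
  · obtain ⟨c1, c2, c3, -, -⟩ := family₁_classify hd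
    have hl : l = 0 := by
      by_contra hl
      by_cases hk : k = 0
      · exact nomatch node_unique hc (c2 hl hk)
      · exact nomatch node_unique hc (c1 hl hk)
    have hdet : h ^ 2 = k * m := by
      by_contra hdet
      exact nomatch node_unique hc (c3 hl hdet)
    obtain ⟨s, a, b, hab, rfl, rfl, rfl⟩ := exists_eq_mul_sq hdet
    obtain ⟨n, hn0, hn⟩ : ∃ n : ℝ, n ≠ 0 ∧ n ^ 2 = a ^ 2 + b ^ 2 :=
      ⟨√(a ^ 2 + b ^ 2), (Real.sqrt_pos.2 hab).ne', Real.sq_sqrt hab.le⟩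
    have h1 : (a / n) ^ 2 + (b / n) ^ 2 = 1 := by
      field_simp
      exact hn.symm
    -- Here de² and de⁴ are sa and sb times (a e¹ + b e³) ∧ e⁵. A real rotation of ℂ² aligns a e¹ +
    -- b e³ with e³, leaving only a multiple of e³⁵ in de⁴.
    obtain ⟨f, hf, hact⟩ := exists_mem_U2 ⟨b / n, 0⟩ ⟨-(a / n), 0⟩ ⟨a / n, 0⟩ ⟨b / n, 0⟩
      (by simp only; linarith) (by simp only; linarith) (by simp only; ring) (by simp)
    refine ⟨f, hf, s, 0, n, actU_eq fun x y => ?_⟩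
    rw [pointTwo, bracket_eq_family₂, hd, bracket_eq_family₁, hl]
    have e2 : ∀ x, n * f x 2 = a * x 0 + b * x 2 := fun x => by
      rw [hact.two]; simp; field_simp
    refine PiLp.ext fun i => mul_left_cancel₀ hn0 ?_
    fin_cases i
    · simp [hact.zero]
    · simp [hact.one]
      refine Or.inr ?_
      field_simp
      ring
    · simp [hact.two]
    · simp [hact.three, hact.four]
      field_simp
      linear_combination (-s * n ^ 2) * (y 4 * e2 x - x 4 * e2 y) -
        s * (y 4 * (a * x 0 + b * x 2) - x 4 * (a * y 0 + b * y 2)) * hn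
    · simp [hact.four]
  · obtain ⟨c1, c2, c3, -, -⟩ := family₂_classify hr hd
    have hx : x = 0 := by
      by_contra hx
      exact nomatch node_unique hc (c1 hx)
    have hh : h = 0 := by
      by_contra hh
      exact nomatch node_unique hc (c2 hx hh)
    have hl : l = 0 := by
      by_contra hl
      exact nomatch node_unique hc (c3 hx hh hl)
    obtain ⟨s, a, b, -, rfl, rfl, rfl⟩ := exists_eq_mul_sq (h := y) (k := k) (m := m) (by
      have := minor_eq_zero hr 1 3
      simp at this
      linarith)
    refine ⟨1, U2.one_mem, -s, a, -b, ?_⟩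
    rw [actU_one]
    refine Subtype.ext (hom12_ext_bracket fun u v => ?_)
    rw [pointTwo, bracket_eq_family₂, hd, bracket_eq_family₂, hx, hh, hl]
    ext i
    fin_cases i <;> simp [-mul_eq_mul_left_iff, -mul_eq_mul_right_iff] <;> ring
  · obtain ⟨c1, -, -⟩ := family₃_classify hd
    by_cases hp : l + m = 0
    · refine ⟨1, U2.one_mem, -(l - m), 1, 0, ?_⟩
      rw [actU_one]
      refine Subtype.ext (hom12_ext_bracket fun u v => ?_)
      rw [pointTwo, bracket_eq_family₂, hd, bracket_eq_family₃, hp]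
      ext i
      fin_cases i <;> simp
    · have hm : l - m = 0 := by
        by_contra hm
        exact nomatch node_unique hc (c1 hp hm)
      -- Exchanging the two complex coordinates turns e¹² into e³⁴.
      obtain ⟨f, hf, hact⟩ := exists_mem_U2 0 1 1 0
        (by simp) (by simp) (by simp) (by simp)
      refine ⟨f, hf, -(l + m), 1, 0, actU_eq fun x y => ?_⟩
      rw [pointTwo, bracket_eq_family₂, hd, bracket_eq_family₃, hm]
      ext i
      fin_cases i <;> simp [hact.zero, hact.one, hact.two, hact.three, hact.four]

/-- The hypo structures on `g` in ℳ₂ already belong to ℳ₁, ℳ₃ contains none, and every point of ℳ₁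
is a limit of points with l and k nonzero. -/
theorem hypoSpace_g_subset : hypoSpace (node .g) ⊆ closure (hypoSpace (node .f)) := by
  refine hypoSpace_subset_closure fun d hg hd => ⟨1, U2.one_mem, ?_⟩
  rw [actU_one]
  suffices h : ∃ l m h k, d = pointOne l m h k by
    obtain ⟨l, m, h, k, rfl⟩ := h
    exact pointOne_mem_closure l m h k
  rcases hd with (⟨l, m, h, k, hd⟩ | ⟨x, y, h, k, l, m, hr, hd⟩) | ⟨l, m, hd⟩
  · exact ⟨l, m, h, k, Subtype.ext hd⟩
  · obtain ⟨c1, c2, -, c4, c5⟩ := family₂_classify hr hd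
    have hx : x = 0 := by
      by_contra hx
      exact nomatch node_unique hg (c1 hx)
    have hh : h = 0 := by
      by_contra hh
      exact nomatch node_unique hg (c2 hx hh)
    have m12 := minor_eq_zero hr 1 2
    have m13 := minor_eq_zero hr 1 3
    have m23 := minor_eq_zero hr 2 3
    simp [hx] at m12 m13 m23
    have hk : k = 0 := by
      by_contra hk
      have hl : l = 0 := by tauto
      have hm : m = 0 := by
        by_contra hm
        exact nomatch node_unique hg (c4 hx hh hl hm)
      exact nomatch node_unique hg (c5 hx hh hl hm hk)
    have hy : y = 0 := by simpa [hk] using m13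
    refine ⟨0, -m, l, 0, Subtype.ext (hom12_ext_bracket fun u v => ?_)⟩
    rw [pointOne, bracket_eq_family₁, hd, bracket_eq_family₂, hx, hh, hk, hy]
    ext i
    fin_cases i <;> simp; ring
  · exfalso
    obtain ⟨c1, c2, c3⟩ := family₃_classify hd
    by_cases hp : l + m = 0
    · by_cases hm : l - m = 0
      · refine exists_bracket_ne_zero hg fun x y => ?_
        rw [hd, bracket_eq_family₃, hp, hm]
        ext i; fin_cases i <;> simp
      · exact nomatch node_unique hg (c3 hp hm)
    · by_cases hm : l - m = 0
      · exact nomatch node_unique hg (c2 hp hm)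
      · exact nomatch node_unique hg (c1 hp hm)

/-! ### Closed conditions on the hypo structures of a node -/

/-- Some unit vector `z` of `ℂ²` satisfies the three closed conditions shared by all the hypo
structures on the Lie algebra `a`. -/
def HasComplexPlane (d : Brackets) : Prop :=
  ∃ z : V, ‖z‖ = 1 ∧ z 4 = 0 ∧ bracket d.1 z (J z) 4 = 0 ∧
    inner ℝ (bracket d.1 (basisVec 4) z) (J z) = 0 ∧
    inner ℝ (bracket d.1 (basisVec 4) (J z)) z = 0

theorem continuous_J : Continuous J := by
  unfold J
  fun_prop

/-- The conditions are closed in (d, z) and z ranges over a compact sphere, so the projection to `d`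
is closed. -/
theorem isClosed_hasComplexPlane : IsClosed {d | HasComplexPlane d} := by
  let S : Set (Brackets × Metric.sphere (0 : V) 1) := {t | t.2.1 4 = 0 ∧
    bracket t.1.1 t.2.1 (J t.2.1) 4 = 0 ∧
    inner ℝ (bracket t.1.1 (basisVec 4) t.2.1) (J t.2.1) = 0 ∧
    inner ℝ (bracket t.1.1 (basisVec 4) (J t.2.1)) t.2.1 = 0}
  have hd : Continuous fun t : Brackets × Metric.sphere (0 : V) 1 => t.1.1 :=
    continuous_subtype_val.comp continuous_fst
  have hz : Continuous fun t : Brackets × Metric.sphere (0 : V) 1 => t.2.1 :=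
    continuous_subtype_val.comp continuous_snd
  have hJ := continuous_J.comp hz
  have hS : IsClosed S := by
    refine IsClosed.inter (isClosed_eq (by fun_prop) continuous_const) (IsClosed.inter
      (isClosed_eq ?_ continuous_const) (IsClosed.inter (isClosed_eq ?_ continuous_const)
      (isClosed_eq ?_ continuous_const)))
    · have := continuous_bracket hd hz hJ
      exact (EuclideanSpace.proj (𝕜 := ℝ) (4 : Fin 5)).continuous.comp this
    · exact (continuous_bracket hd continuous_const hz).inner hJ
    · exact (continuous_bracket hd continuous_const hJ).inner hz
  convert isClosedMap_fst_of_compactSpace S hS using 1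
  ext d
  constructor
  · rintro ⟨z, hz, h⟩
    exact ⟨(d, ⟨z, by simpa using hz⟩), h, rfl⟩
  · rintro ⟨⟨d', z, hz⟩, h, rfl⟩
    exact ⟨z, by simpa using hz, h⟩

theorem U2_apply_four {f : V ≃ₗᵢ[ℝ] V} (hf : f ∈ U2) (x : V) : f x 4 = x 4 := by
  obtain ⟨p, q, r, s, h⟩ := exists_actsBy hf
  exact h.four x

theorem HasComplexPlane.actU {d : Brackets} (h : HasComplexPlane d) {f : V ≃ₗᵢ[ℝ] V}
    (hf : f ∈ U2) : HasComplexPlane (HypoLie.actU f d) := by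
  obtain ⟨z, h1, h2, h3, h4, h5⟩ := h
  refine ⟨f z, by rw [f.norm_map, h1], by rw [U2_apply_four hf, h2], ?_, ?_, ?_⟩
  · rw [← hf.1, bracket_actU, U2_apply_four hf, h3]
  · rw [← hf.1, ← hf.2, bracket_actU, f.inner_map_map, h4]
  · rw [← hf.1, ← hf.2, bracket_actU, f.inner_map_map, h5]

/-- Node `a` occurs only in ℳ₂, where z = e₁ works: de⁵ has no e¹² term, [e₅, e₁] lies in the plane
of e₄ and e₅, and [e₅, e₂] = 0. -/
theorem hasComplexPlane_of_mem_family {d : Brackets} (ha : d ∈ orbitGL (node .a))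
    (hd : d.1 ∈ family₁ ∪ family₂ ∪ family₃) : HasComplexPlane d := by
  rcases hd with (⟨l, m, h, k, hd⟩ | ⟨x, y, h, k, l, m, hr, hd⟩) | ⟨l, m, hd⟩
  · exfalso
    obtain ⟨c1, c2, c3, c4, c5⟩ := family₁_classify hd
    by_cases hl : l = 0
    · by_cases hdet : h ^ 2 = k * m
      · by_cases hk : k = 0
        · obtain rfl : h = 0 := by simpa [hk] using hdet
          by_cases hm : m = 0
          · refine exists_bracket_ne_zero ha fun x y => ?_
            rw [hd, bracket_eq_family₁, hl, hk, hm]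
            ext i; fin_cases i <;> simp
          · exact nomatch node_unique ha (c5 hl rfl hk hm)
        · exact nomatch node_unique ha (c4 hl hdet hk)
      · exact nomatch node_unique ha (c3 hl hdet)
    · by_cases hk : k = 0
      · exact nomatch node_unique ha (c2 hl hk)
      · exact nomatch node_unique ha (c1 hl hk)
  · refine ⟨basisVec 0, by simp, by simp, ?_⟩
    simp only [hd, bracket_eq_family₂, EuclideanSpace.inner_eq_star_dotProduct]
    simp [J, dotProduct, Fin.sum_univ_five]
  · exfalso
    obtain ⟨c1, c2, c3⟩ := family₃_classify hd
    by_cases hp : l + m = 0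
    · by_cases hm : l - m = 0
      · refine exists_bracket_ne_zero ha fun x y => ?_
        rw [hd, bracket_eq_family₃, hp, hm]
        ext i; fin_cases i <;> simp
      · exact nomatch node_unique ha (c3 hp hm)
    · by_cases hm : l - m = 0
      · exact nomatch node_unique ha (c2 hp hm)
      · exact nomatch node_unique ha (c1 hp hm)

/-! ### Arrows that fail for hypo structures -/

theorem norm_sq_eq {z : V} (hz : ‖z‖ = 1) :
    z 0 ^ 2 + z 1 ^ 2 + z 2 ^ 2 + z 3 ^ 2 + z 4 ^ 2 = 1 := by
  have h := EuclideanSpace.norm_sq_eq z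
  rw [hz] at h
  simpa [Fin.sum_univ_five] using h.symm

/-- For de⁵ = e¹² + e³⁴, the last component of [z, J z] is -|z|² on ℂ², which is never zero on the
unit sphere. -/
theorem not_hypoSpace_b_subset_closure_a :
    ¬ hypoSpace (node .b) ⊆ closure (hypoSpace (node .a)) := by
  refine not_hypoSpace_subset_closure isClosed_hasComplexPlane (fun d hd f hf => hd.actU hf)
    (fun d ha hd => hasComplexPlane_of_mem_family ha hd) (d₂ := pointThree 1 0)
    ((family₃_classify rfl).1 (by norm_num) (by norm_num))
    (isHypo_of_mem_family (pointThree_mem _ _)) ?_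
  rintro ⟨z, h1, h2, h3, -, -⟩
  have hn := norm_sq_eq h1
  rw [pointThree, bracket_eq_family₃] at h3
  simp [J] at h3
  rw [h2] at hn
  linarith

/-- For de² = e¹⁵ and de⁴ = e³⁵, the two inner products are z₀² + z₂² and -(z₁² + z₃²), which cannot
both vanish for a unit z in ℂ². -/
theorem not_hypoSpace_g_subset_closure_a :
    ¬ hypoSpace (node .g) ⊆ closure (hypoSpace (node .a)) := by
  refine not_hypoSpace_subset_closure isClosed_hasComplexPlane (fun d hd f hf => hd.actU hf)
    (fun d ha hd => hasComplexPlane_of_mem_family ha hd) (d₂ := pointOne 0 1 0 1)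
    ((family₁_classify rfl).2.2.1 rfl (by norm_num))
    (isHypo_of_mem_family (pointOne_mem _ _ _ _)) ?_
  rintro ⟨z, h1, h2, -, h4, h5⟩
  have hn := norm_sq_eq h1
  rw [pointOne, bracket_eq_family₁, EuclideanSpace.inner_eq_star_dotProduct] at h4 h5
  simp [J, dotProduct, Fin.sum_univ_five] at h4 h5
  rw [h2] at hn
  linarith

/-- Hypo structures on `b` have derived algebra in the line of e₅, a closed condition, while `c`
carries one with derived algebra spanned by e₄. -/
theorem not_hypoSpace_c_subset_closure_b :
    ¬ hypoSpace (node .c) ⊆ closure (hypoSpace (node .b)) := by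
  refine not_hypoSpace_subset_closure
    (C := {d | ∀ x y, bracket d.1 x y = bracket d.1 x y 4 • basisVec 4}) ?_ ?_ ?_
    (d₂ := pointOne 0 1 0 0) ((family₁_classify rfl).2.2.2.2 rfl rfl rfl one_ne_zero)
    (isHypo_of_mem_family (pointOne_mem _ _ _ _)) ?_
  · simp only [Set.ofPred_forall]
    refine isClosed_iInter fun x => isClosed_iInter fun y => ?_
    have := continuous_bracket_brackets x y
    exact isClosed_eq this (by fun_prop)
  · intro d hd f hf x y
    obtain ⟨x, rfl⟩ := f.surjective x
    obtain ⟨y, rfl⟩ := f.surjective y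
    rw [bracket_actU, U2_apply_four hf]
    conv_lhs => rw [hd, map_smul, hf.2]
  · intro d hb hd
    rcases hd with (⟨l, m, h, k, hd⟩ | ⟨x, y, h, k, l, m, hr, hd⟩) | ⟨l, m, hd⟩
    · exfalso
      obtain ⟨c1, c2, c3, c4, c5⟩ := family₁_classify hd
      by_cases hl : l = 0
      · by_cases hdet : h ^ 2 = k * m
        · by_cases hk : k = 0
          · obtain rfl : h = 0 := by simpa [hk] using hdet
            by_cases hm : m = 0
            · refine exists_bracket_ne_zero hb fun x y => ?_
              rw [hd, bracket_eq_family₁, hl, hk, hm]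
              ext i; fin_cases i <;> simp
            · exact nomatch node_unique hb (c5 hl rfl hk hm)
          · exact nomatch node_unique hb (c4 hl hdet hk)
        · exact nomatch node_unique hb (c3 hl hdet)
      · by_cases hk : k = 0
        · exact nomatch node_unique hb (c2 hl hk)
        · exact nomatch node_unique hb (c1 hl hk)
    · obtain ⟨c1, -, c3, c4, -⟩ := family₂_classify hr hd
      have hx : x = 0 := by
        by_contra hx
        exact nomatch node_unique hb (c1 hx)
      have m01 := minor_eq_zero hr 0 1
      have m02 := minor_eq_zero hr 0 2
      have m03 := minor_eq_zero hr 0 3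
      have m13 := minor_eq_zero hr 1 3
      simp [hx] at m01 m02 m03 m13
      have hl : l = 0 := by
        by_contra hl
        exact nomatch node_unique hb (c3 hx (by tauto) hl)
      have hm : m = 0 := by
        by_contra hm
        exact nomatch node_unique hb (c4 hx (by tauto) hl hm)
      have hy : y = 0 := by simpa [hm] using m13
      intro u v
      rw [hd, bracket_eq_family₂, hx, hl, hm, hy]
      ext i
      fin_cases i <;> simp
    · intro u v
      rw [hd, bracket_eq_family₃]
      ext i
      fin_cases i <;> simp
  · intro h
    have h3 := congrArg (fun v : V => v 3) (h (basisVec 2) (basisVec 4))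
    rw [pointOne, bracket_eq_family₁] at h3
    simp at h3

/-- Hypo structures on `f` and `g` satisfy de⁵ = 0, while `c` carries one with de⁵ = 2e¹². -/
theorem not_hypoSpace_c_subset_closure {n : Node} (hn : n = .f ∨ n = .g) :
    ¬ hypoSpace (node .c) ⊆ closure (hypoSpace (node n)) := by
  have hne : ∀ d ∈ orbitGL (node n), d ∉ orbitGL (node .a) ∧ d ∉ orbitGL (node .b) ∧
      d ∉ orbitGL (node .c) := fun d hd => by
    refine ⟨fun h => ?_, fun h => ?_, fun h => ?_⟩ <;>
    · obtain rfl := node_unique hd h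
      simp at hn
  refine not_hypoSpace_subset_closure (C := {d | ∀ x y, bracket d.1 x y 4 = 0}) ?_ ?_ ?_
    (d₂ := pointThree 1 1) ((family₃_classify rfl).2.1 (by norm_num) (by norm_num))
    (isHypo_of_mem_family (pointThree_mem _ _)) ?_
  · simp only [Set.ofPred_forall]
    refine isClosed_iInter fun x => isClosed_iInter fun y => ?_
    have := continuous_bracket_brackets x y
    exact isClosed_eq (by fun_prop) continuous_const
  · intro d hd f hf x y
    obtain ⟨x, rfl⟩ := f.surjective x
    obtain ⟨y, rfl⟩ := f.surjective y
    rw [bracket_actU, U2_apply_four hf, hd]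
  · intro d hdn hd
    obtain ⟨ha, hb, hc⟩ := hne d hdn
    rcases hd with (⟨l, m, h, k, hd⟩ | ⟨x, y, h, k, l, m, hr, hd⟩) | ⟨l, m, hd⟩
    · intro u v
      rw [hd, bracket_eq_family₁]
      simp
    · obtain ⟨c1, c2, -, c4, c5⟩ := family₂_classify hr hd
      have hx : x = 0 := by
        by_contra hx
        exact ha (c1 hx)
      have hh : h = 0 := by
        by_contra hh
        exact hb (c2 hx hh)
      have m12 := minor_eq_zero hr 1 2
      have m13 := minor_eq_zero hr 1 3
      simp [hx] at m12 m13
      have hk : k = 0 := by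
        by_contra hk
        have hl : l = 0 := by tauto
        have hm : m = 0 := by
          by_contra hm
          exact hc (c4 hx hh hl hm)
        exact hc (c5 hx hh hl hm hk)
      have hy : y = 0 := by simpa [hk] using m13
      intro u v
      rw [hd, bracket_eq_family₂, hx, hh, hk, hy]
      simp
    · obtain ⟨c1, c2, c3⟩ := family₃_classify hd
      have hp : l + m = 0 := by
        by_contra hp
        by_cases hm : l - m = 0
        · exact hc (c2 hp hm)
        · exact hb (c1 hp hm)
      have hm : l - m = 0 := by
        by_contra hm
        exact hc (c3 hp hm)
      intro u v
      rw [hd, bracket_eq_family₃, hp, hm]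
      simp
  · intro h
    have h4 := h (basisVec 0) (basisVec 1)
    rw [pointThree, bracket_eq_family₃] at h4
    simp at h4

theorem doubleArrow_iff {n₁ n₂ : Node} (hn : n₁ ≠ n₂) :
    DoubleArrow n₁ n₂ ↔ hypoSpace (node n₂) ⊆ closure (hypoSpace (node n₁)) := by
  constructor
  · rintro (_ | _)
    · exact hypoSpace_c_subset
    · exact hypoSpace_g_subset
  · intro h
    have ha : Arrow n₁ n₂ := by
      by_contra ha
      exact not_hypoSpace_subset_of_not_arrow hn ha h
    cases ha
    · exact .a_c
    · exact absurd h not_hypoSpace_b_subset_closure_a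
    · exact absurd h not_hypoSpace_g_subset_closure_a
    · exact absurd h not_hypoSpace_c_subset_closure_b
    · exact .f_g
    · exact absurd h (not_hypoSpace_c_subset_closure (Or.inl rfl))
    · exact absurd h (not_hypoSpace_c_subset_closure (Or.inr rfl))

end HypoLie

end

theorem mainTheorem3 :
    (∀ d : Brackets, (LieRing.IsNilpotent (LieAlg d) ∧ IsHypo d) ↔
      ∃ f ∈ U2, act f.toContinuousLinearEquiv d.1 ∈ family₁ ∪ family₂ ∪ family₃) ∧
    (∀ (𝔤 : Type*) [LieRing 𝔤] [LieAlgebra ℝ 𝔤], Module.finrank ℝ 𝔤 = 5 →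
      ((LieRing.IsNilpotent 𝔤 ∧ ¬ IsLieAbelian 𝔤 ∧
          ∃ d : Brackets, Nonempty (𝔤 ≃ₗ⁅ℝ⁆ LieAlg d) ∧ IsHypo d) ↔
        ∃! n : Node, Nonempty (𝔤 ≃ₗ⁅ℝ⁆ LieAlg (node n)))) ∧
    (∀ n₁ n₂ : Node, n₁ ≠ n₂ →
      (Arrow n₁ n₂ ↔ node n₂ ∈ closure (orbitGL (node n₁)))) ∧
    (∀ n₁ n₂ : Node, n₁ ≠ n₂ →
      (DoubleArrow n₁ n₂ ↔ hypoSpace (node n₂) ⊆ closure (hypoSpace (node n₁)))) := by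
  exact ⟨fun d => nilpotent_and_hypo_iff d, fun 𝔤 _ _ _ => lieAlgebra_hypo_iff 𝔤,
    fun _ _ hn => arrow_iff hn, fun _ _ hn => doubleArrow_iff hn⟩
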